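/- Let $p$ be a prime number, let $k$ be a commutative ring in which $p$ is nilpotent, and let $X\to\operatorname{Spec} k$ be a smooth and proper morphism of schemes. Let $\underline{\mathrm{HH}}_X$ be the Hochschild homology complex of $X$ over $k$: the complex of $\mathcal{O}_X$-modules (in non-negative homological degrees) obtained by sheafifying $U\mapsto (C_\bullet(\mathcal{O}_X(U)/k),b)$, where $C_n(A/k)=A^{\otimes_k(n+1)}$ is an $A$-module through the first factor and $b$ is the Hochschild differential. For $t\ge 0$ let $\pi_t:\underline{\mathrm{HH}}_X\to\Omega^t_{X/k}[t]$ be the map of complexes induced in degree $t$ by $r_0\otimes r_1\otimes\cdots\otimes r_t\mapsto r_0\,dr_1\wedge\cdots\wedge dr_t$. Let $\tau_{\le p-1}\underline{\mathrm{HH}}_X$ be the quotient of $\underline{\mathrm{HH}}_X$ given by the canonical truncation that keeps the homology sheaves of degree $\le p-1$. Then: 1. The map through which $(\pi_t)_{0\le t\le p-1}$ factors is a quasi-isomorphism $$\tau_{\le p-1}\underline{\mathrm{HH}}_X\xrightarrow{\ \sim\ }\bigoplus_{t=0}^{p-1}\Omega^t_{X/k}[t],$$ where the right-hand side has zero differential.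 2. This map is natural in $X$: for every morphism $h:X\to Y$ of smooth and proper $k$-schemes the two composites $$\tau_{\le p-1}\underline{\mathrm{HH}}_Y\longrightarrow h_*\Big(\bigoplus_{t=0}^{p-1}\Omega^t_{X/k}[t]\Big)$$ (first pull back Hochschild chains and then project to forms, or first project and then pull back forms) are equal. 3. For every $t\ge 0$ there is an isomorphism of $\mathcal{O}_X$-modules (the Hochschild–Kostant–Rosenberg isomorphism) $\varepsilon_t:\Omega^t_{X/k}\to\mathcal{H}_t(\underline{\mathrm{HH}}_X)$ which sends a local section $r_0\,dr_1\wedge\cdots\wedge dr_t$ to the class of the antisymmetrization $\sum_{\sigma\in S_t}\operatorname{sgn}(\sigma)\,r_0\otimes r_{\sigma(1)}\otimes\cdots\otimes r_{\sigma(t)}$, and the composite $\mathcal{H}_t(\pi_t)\circ\varepsilon_t:\Omega^t_{X/k}\to\Omega^t_{X/k}$ is multiplication by $t!$. -/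

import Mathlib

open CategoryTheory Limits AlgebraicGeometry TopologicalSpace
open scoped TensorProduct

universe u

set_option linter.unusedSimpArgs false
set_option linter.style.haveILetI false

noncomputable section

namespace HKR

section Algebra

variable (k : Type u) [CommRing k] (A : Type u) [CommRing A] [Algebra k A]

/-- The `k`-algebra `A ⊗ A ⊗ ⋯ ⊗ A` (`n + 1` factors, tensor products over `k`): the degree `n` term
of the Hochschild complex of the commutative `k`-algebra `A`. -/
def Cyc (n : ℕ) : Type u := ⨂[k] (_ : Fin (n + 1)), A

namespace Cyc

instance (n : ℕ) : CommRing (Cyc k A n) :=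
  inferInstanceAs (CommRing (⨂[k] (_ : Fin (n + 1)), A))

instance (n : ℕ) : Algebra k (Cyc k A n) :=
  inferInstanceAs (Algebra k (⨂[k] (_ : Fin (n + 1)), A))

variable {A} in
/-- The pure tensor `a 0 ⊗ ⋯ ⊗ a n`. -/
def mk {n : ℕ} (a : Fin (n + 1) → A) : Cyc k A n := PiTensorProduct.tprod k a

/-- The inclusion of `A` as the `i`-th tensor factor. -/
def ι {n : ℕ} (i : Fin (n + 1)) : A →ₐ[k] Cyc k A n :=
  PiTensorProduct.singleAlgHom (R := k) (A := fun _ : Fin (n + 1) => A) i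

/-- `A` acts on `A ⊗ ⋯ ⊗ A` through the first factor. -/
instance (n : ℕ) : Algebra A (Cyc k A n) := (ι k A (0 : Fin (n + 1))).toRingHom.toAlgebra

instance (n : ℕ) : IsScalarTower k A (Cyc k A n) :=
  IsScalarTower.of_algebraMap_eq fun x => ((ι k A (0 : Fin (n + 1))).commutes x).symm

variable {k A}

lemma algebraMap_eq {n : ℕ} (a : A) : algebraMap A (Cyc k A n) a = ι k A 0 a := rfl

/-- The map `a 0 ⊗ ⋯ ⊗ a n ↦ ∏ i, f i (a i)` into a commutative algebra. -/
def lift {B : Type u} [CommRing B] [Algebra k B] {n : ℕ} (f : Fin (n + 1) → A →ₐ[k] B) :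
    Cyc k A n →ₐ[k] B :=
  PiTensorProduct.liftAlgHom
    ((MultilinearMap.mkPiAlgebra k (Fin (n + 1)) B).compLinearMap fun i => (f i).toLinearMap)
    (by simp) (by intro x y; simp [Finset.prod_mul_distrib])

@[simp] lemma lift_mk {B : Type u} [CommRing B] [Algebra k B] {n : ℕ}
    (f : Fin (n + 1) → A →ₐ[k] B) (a : Fin (n + 1) → A) :
    lift f (mk k a) = ∏ i, f i (a i) := by
  refine (PiTensorProduct.liftAlgHom_apply _ _ _ _).trans ?_
  exact (PiTensorProduct.lift.tprod _).trans (by simp)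

lemma mk_mul {n : ℕ} (a b : Fin (n + 1) → A) : mk k a * mk k b = mk k (a * b) :=
  PiTensorProduct.tprod_mul_tprod a b

lemma mk_prod {κ : Type*} {n : ℕ} (s : Finset κ) (x : κ → Fin (n + 1) → A) :
    ∏ j ∈ s, mk k (x j) = mk k (∏ j ∈ s, x j) :=
  (PiTensorProduct.tprod_prod s x).symm

lemma ι_eq_mk {n : ℕ} (i : Fin (n + 1)) (a : A) : ι k A i a = mk k (Pi.mulSingle i a) :=
  PiTensorProduct.singleAlgHom_apply (R := k) (A := fun _ : Fin (n + 1) => A) i a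

@[simp] lemma lift_ι {B : Type u} [CommRing B] [Algebra k B] {n : ℕ}
    (f : Fin (n + 1) → A →ₐ[k] B) (i : Fin (n + 1)) (a : A) :
    lift f (ι k A i a) = f i a := by
  rw [ι_eq_mk, lift_mk, Finset.prod_eq_single i]
  · simp
  · intro j _ hj
    simp [hj]
  · simp

lemma algHom_ext {B : Type u} [CommRing B] [Algebra k B] {n : ℕ} {f g : Cyc k A n →ₐ[k] B}
    (h : ∀ i a, f (ι k A i a) = g (ι k A i a)) : f = g :=
  PiTensorProduct.algHom_ext (A := fun _ : Fin (n + 1) => A) fun i => AlgHom.ext fun a => h i a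

lemma linearMap_ext {M : Type u} [AddCommGroup M] [Module k M] {n : ℕ} {f g : Cyc k A n →ₗ[k] M}
    (h : ∀ a : Fin (n + 1) → A, f (mk k a) = g (mk k a)) : f = g :=
  PiTensorProduct.ext (MultilinearMap.ext h)

lemma smul_mk {n : ℕ} (r : A) (a : Fin (n + 1) → A) :
    r • mk k a = mk k (Pi.mulSingle 0 r * a) := by
  rw [Algebra.smul_def, algebraMap_eq, ι_eq_mk, mk_mul]

/-- The map of index sets `{0, …, n + 1} → {0, …, n}` which underlies the `i`-th face: for `i ≤ n` it
is the monotone surjection that identifies `i` and `i + 1`; for `i = n + 1` it fixes `0, …, n` and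
sends `n + 1` to `0`. -/
def faceIdx {n : ℕ} (i : Fin (n + 2)) (j : Fin (n + 2)) : Fin (n + 1) :=
  ⟨if (j : ℕ) ≤ i then (if (j : ℕ) = n + 1 then 0 else j) else j - 1, by
    split_ifs <;> omega⟩

lemma faceIdx_zero {n : ℕ} (i : Fin (n + 2)) : faceIdx i 0 = 0 := by
  ext; simp [faceIdx]

/-- The `i`-th face as a map of `k`-algebras:
`a 0 ⊗ ⋯ ⊗ a (n + 1) ↦ a 0 ⊗ ⋯ ⊗ a i * a (i + 1) ⊗ ⋯ ⊗ a (n + 1)` for `i ≤ n`, and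
`a 0 ⊗ ⋯ ⊗ a (n + 1) ↦ a (n + 1) * a 0 ⊗ a 1 ⊗ ⋯ ⊗ a n` for `i = n + 1` (see `face_mk`). -/
def faceHom {n : ℕ} (i : Fin (n + 2)) : Cyc k A (n + 1) →ₐ[k] Cyc k A n :=
  lift fun j => ι k A (faceIdx i j)

lemma faceHom_ι {n : ℕ} (i j : Fin (n + 2)) (a : A) :
    faceHom i (ι k A j a) = ι k A (faceIdx i j) a := lift_ι _ _ _

/-- The `i`-th face; it is linear over the first factor. -/
def face {n : ℕ} (i : Fin (n + 2)) : Cyc k A (n + 1) →ₐ[A] Cyc k A n :=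
  { (faceHom i : Cyc k A (n + 1) →ₐ[k] Cyc k A n).toRingHom with
    commutes' := fun a => by
      have := faceHom_ι (k := k) i 0 a
      rw [faceIdx_zero] at this
      exact this }

lemma face_apply {n : ℕ} (i : Fin (n + 2)) (x : Cyc k A (n + 1)) :
    face i x = faceHom i x := rfl

lemma face_mk {n : ℕ} (i : Fin (n + 2)) (a : Fin (n + 2) → A) :
    face i (mk k a) = mk k (fun l => ∏ j with faceIdx i j = l, a j) := by
  rw [face_apply, faceHom, lift_mk]
  simp only [ι_eq_mk]
  rw [mk_prod]
  congr 1
  ext l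
  rw [Finset.prod_apply, Finset.prod_filter]
  refine Finset.prod_congr rfl fun j _ => ?_
  by_cases h : faceIdx i j = l
  · subst h; simp
  · rw [if_neg h, Pi.mulSingle_eq_of_ne (Ne.symm h)]

lemma face_face {n : ℕ} (i : Fin (n + 2)) (j : Fin (n + 3)) (h : (j : ℕ) ≤ i)
    (x : Cyc k A (n + 2)) :
    face i (face j x) = face (⟨j, by omega⟩ : Fin (n + 2)) (face i.succ x) := by
  have : (faceHom (k := k) (A := A) i).comp (faceHom j) =
      (faceHom (⟨j, by omega⟩ : Fin (n + 2))).comp (faceHom i.succ) := by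
    refine algHom_ext fun l a => ?_
    simp only [AlgHom.comp_apply, faceHom_ι]
    congr 2
    ext
    simp only [faceIdx, Fin.val_succ]
    split_ifs <;> omega
  exact DFunLike.congr_fun this x

/-- The Hochschild differential `b = ∑ i, (-1) ^ i • d i`. -/
def b (n : ℕ) : Cyc k A (n + 1) →ₗ[A] Cyc k A n :=
  ∑ i : Fin (n + 2), (-1 : ℤ) ^ (i : ℕ) • (face i).toLinearMap

lemma b_apply {n : ℕ} (x : Cyc k A (n + 1)) :
    b n x = ∑ i : Fin (n + 2), (-1 : ℤ) ^ (i : ℕ) • face i x := by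
  simp [b]

lemma b_b {n : ℕ} (x : Cyc k A (n + 2)) : b n (b (n + 1) x) = 0 := by
  simp only [b_apply, map_sum, map_zsmul, Finset.smul_sum, smul_smul]
  rw [Finset.sum_comm, ← Finset.sum_product', Finset.univ_product_univ]
  let P := Fin (n + 2) × Fin (n + 3)
  let S : Finset P := {ij : P | (ij.2 : ℕ) ≤ (ij.1 : ℕ)}
  rw [← Finset.sum_add_sum_compl S, ← eq_neg_iff_add_eq_zero, ← Finset.sum_neg_distrib]
  let φ : ∀ ij : P, ij ∈ S → P := fun ij hij =>
    (Fin.castLT ij.2 (lt_of_le_of_lt (Finset.mem_filter.mp hij).right (Fin.is_lt ij.1)), ij.1.succ)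
  apply Finset.sum_bij φ
  · intro ij hij
    simp_rw [S, φ, Finset.compl_filter, Finset.mem_filter_univ, Fin.val_succ,
      Fin.val_castLT] at hij ⊢
    lia
  · rintro ⟨i, j⟩ hij ⟨i', j'⟩ hij' h
    rw [Prod.mk_inj]
    exact ⟨by simpa [φ] using! congr_arg Prod.snd h,
      by simpa [φ, Fin.castSucc_castLT] using! congr_arg Fin.castSucc (congr_arg Prod.fst h)⟩
  · rintro ⟨i', j'⟩ hij'
    simp_rw [S, Finset.compl_filter, Finset.mem_filter_univ, not_le] at hij'
    refine ⟨(j'.pred <| ?_, Fin.castSucc i'), ?_, ?_⟩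
    · rintro rfl
      simp only [Fin.val_zero, not_lt_zero] at hij'
    · simpa [S] using! Nat.le_sub_one_of_lt hij'
    · simp only [φ, Fin.castLT_castSucc, Fin.succ_pred]
  · rintro ⟨i, j⟩ hij
    have hij' : (j : ℕ) ≤ i := by simpa [S] using hij
    dsimp only
    rw [face_face i j hij', ← neg_smul]
    congr 1
    simp only [φ, Fin.val_succ, Fin.val_castLT, pow_add, pow_one]
    ring


/-- Functoriality of `A ⊗ ⋯ ⊗ A` in `A`. -/
def mapHom {B : Type u} [CommRing B] [Algebra k B] (φ : A →ₐ[k] B) (n : ℕ) :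
    Cyc k A n →ₐ[k] Cyc k B n :=
  lift fun i => (ι k B i).comp φ

lemma mapHom_ι {B : Type u} [CommRing B] [Algebra k B] (φ : A →ₐ[k] B) {n : ℕ}
    (i : Fin (n + 1)) (a : A) : mapHom φ n (ι k A i a) = ι k B i (φ a) := lift_ι _ _ _

lemma mapHom_smul {B : Type u} [CommRing B] [Algebra k B] (φ : A →ₐ[k] B) {n : ℕ}
    (r : A) (x : Cyc k A n) : mapHom φ n (r • x) = φ r • mapHom φ n x := by
  rw [Algebra.smul_def, Algebra.smul_def, map_mul, algebraMap_eq, algebraMap_eq, mapHom_ι]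

lemma mapHom_mk {B : Type u} [CommRing B] [Algebra k B] (φ : A →ₐ[k] B) {n : ℕ}
    (a : Fin (n + 1) → A) : mapHom φ n (mk k a) = mk k (fun i => φ (a i)) := by
  rw [mapHom, lift_mk]
  simp only [AlgHom.comp_apply, ι_eq_mk]
  rw [mk_prod]
  congr 1
  ext l
  rw [Finset.prod_apply, Finset.prod_eq_single l]
  · simp
  · intro j _ hj
    rw [Pi.mulSingle_eq_of_ne hj.symm]
  · simp

lemma mapHom_id {n : ℕ} (x : Cyc k A n) : mapHom (AlgHom.id k A) n x = x := by
  have : mapHom (AlgHom.id k A) n = AlgHom.id k _ := algHom_ext fun i a => by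
    rw [mapHom_ι]; rfl
  rw [this]; rfl

lemma mapHom_comp {B C : Type u} [CommRing B] [Algebra k B] [CommRing C] [Algebra k C]
    (φ : A →ₐ[k] B) (ψ : B →ₐ[k] C) {n : ℕ} (x : Cyc k A n) :
    mapHom (ψ.comp φ) n x = mapHom ψ n (mapHom φ n x) := by
  have : mapHom (ψ.comp φ) n = (mapHom ψ n).comp (mapHom φ n) := algHom_ext fun i a => by
    rw [mapHom_ι, AlgHom.comp_apply, AlgHom.comp_apply, mapHom_ι, mapHom_ι]
  rw [this]; rfl

lemma mapHom_face {B : Type u} [CommRing B] [Algebra k B] (φ : A →ₐ[k] B) {n : ℕ}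
    (i : Fin (n + 2)) (x : Cyc k A (n + 1)) :
    mapHom φ n (face i x) = face i (mapHom φ (n + 1) x) := by
  have : (mapHom φ n).comp (faceHom i) = (faceHom i).comp (mapHom φ (n + 1)) :=
    algHom_ext fun j a => by
      simp only [AlgHom.comp_apply, faceHom_ι, mapHom_ι]
  exact DFunLike.congr_fun this x

lemma mapHom_b {B : Type u} [CommRing B] [Algebra k B] (φ : A →ₐ[k] B) {n : ℕ}
    (x : Cyc k A (n + 1)) : mapHom φ n (b n x) = b n (mapHom φ (n + 1) x) := by
  simp only [b_apply, map_sum, map_zsmul, mapHom_face]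

/-- The antisymmetrization `∑ σ, sgn σ • (a ⊗ r (σ 0) ⊗ ⋯ ⊗ r (σ (n - 1)))`. -/
def antisymm {n : ℕ} (a : A) (r : Fin n → A) : Cyc k A n :=
  ∑ σ : Equiv.Perm (Fin n), (σ.sign : ℤ) • mk k (Fin.cons a (r ∘ σ) : Fin (n + 1) → A)

end Cyc

section Forms

variable {k A} {B : Type u} [CommRing B] [Algebra k B]

/-- The differential form `a • d (r 0) ∧ ⋯ ∧ d (r (n - 1))`. -/
def dForm {n : ℕ} (a : A) (r : Fin n → A) : ⋀[A]^n Ω[A⁄k] :=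
  a • exteriorPower.ιMulti A n fun i => KaehlerDifferential.D k A (r i)

lemma dForm_induction {n : ℕ} {P : ⋀[A]^n Ω[A⁄k] → Prop} (zero : P 0)
    (form : ∀ a r, P (dForm a r)) (add : ∀ x y, P x → P y → P (x + y)) (x : ⋀[A]^n Ω[A⁄k]) :
    P x := by
  have hx : x ∈ (⊤ : Submodule A (⋀[A]^n Ω[A⁄k])) := trivial
  rw [← exteriorPower.ιMulti_span_of_span A n _ (KaehlerDifferential.span_range_derivation k A)] at hx
  induction hx using Submodule.closure_induction with
  | zero => exact zero
  | add x y _ _ hx hy => exact add x y hx hy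
  | smul_mem a x hx =>
    obtain ⟨m, hm, rfl⟩ := hx
    choose r hr using fun i => hm (Set.mem_range_self i)
    rw [← (funext hr : (fun i => KaehlerDifferential.D k A (r i)) = m)]
    exact form a r

/-- Functoriality of the module of `n`-forms for an `A`-algebra `B`. -/
def formsMapAlg [Algebra A B] [IsScalarTower k A B] (n : ℕ) :
    ⋀[A]^n Ω[A⁄k] →ₗ[A] ⋀[B]^n Ω[B⁄k] :=
  exteriorPower.alternatingMapLinearEquiv
    { ((exteriorPower.ιMulti B n (M := Ω[B⁄k])).toMultilinearMap.restrictScalars A).compLinearMap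
        (fun _ => KaehlerDifferential.map k k A B) with
      map_eq_zero_of_eq' := fun v _ _ h hij =>
        (exteriorPower.ιMulti B n (M := Ω[B⁄k])).map_eq_zero_of_eq
          (fun i => KaehlerDifferential.map k k A B (v i)) (congrArg _ h) hij }

/-- Functoriality of the module of `n`-forms: `a dr₁ ∧ ⋯ ∧ drₙ ↦ φ(a) dφ(r₁) ∧ ⋯ ∧ dφ(rₙ)`. -/
def formsMap (φ : A →ₐ[k] B) (n : ℕ) : ⋀[A]^n Ω[A⁄k] →+ ⋀[B]^n Ω[B⁄k] :=
  letI := φ.toRingHom.toAlgebra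
  haveI : IsScalarTower k A B := IsScalarTower.of_algebraMap_eq fun x => (φ.commutes x).symm
  (formsMapAlg n).toAddMonoidHom

lemma formsMap_smul (φ : A →ₐ[k] B) {n : ℕ} (a : A) (x : ⋀[A]^n Ω[A⁄k]) :
    formsMap φ n (a • x) = φ a • formsMap φ n x := by
  let := φ.toRingHom.toAlgebra
  have : IsScalarTower k A B := IsScalarTower.of_algebraMap_eq fun x => (φ.commutes x).symm
  refine ((formsMapAlg (k := k) (A := A) (B := B) n).map_smul a x).trans ?_
  exact algebra_compatible_smul B a _

lemma formsMap_dForm (φ : A →ₐ[k] B) {n : ℕ} (a : A) (r : Fin n → A) :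
    formsMap φ n (dForm a r) = dForm (φ a) (fun i => φ (r i)) := by
  rw [dForm, formsMap_smul, dForm]
  congr 1
  let := φ.toRingHom.toAlgebra
  have : IsScalarTower k A B := IsScalarTower.of_algebraMap_eq fun x => (φ.commutes x).symm
  refine (exteriorPower.alternatingMapLinearEquiv_apply_ιMulti _ _).trans ?_
  change exteriorPower.ιMulti B n _ = _
  congr 1
  funext i
  exact KaehlerDifferential.map_D k k A B (r i)

lemma formsMap_id {n : ℕ} (x : ⋀[A]^n Ω[A⁄k]) : formsMap (AlgHom.id k A) n x = x := by
  induction x using dForm_induction with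
  | zero => simp
  | form a r => rw [formsMap_dForm]; rfl
  | add x y hx hy => rw [map_add, hx, hy]

lemma formsMap_comp {C : Type u} [CommRing C] [Algebra k C] (φ : A →ₐ[k] B) (ψ : B →ₐ[k] C)
    {n : ℕ} (x : ⋀[A]^n Ω[A⁄k]) :
    formsMap (ψ.comp φ) n x = formsMap ψ n (formsMap φ n x) := by
  induction x using dForm_induction with
  | zero => simp
  | form a r => simp only [formsMap_dForm]; rfl
  | add x y hx hy => simp only [map_add, hx, hy]

variable (k A) in
def dFormMultilinear (n : ℕ) :
    MultilinearMap k (fun _ : Fin (n + 1) => A) (⋀[A]^n Ω[A⁄k]) :=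
  LinearMap.uncurryLeft (M := fun _ : Fin (n + 1) => A)
    { toFun := fun a => a • (((exteriorPower.ιMulti A n
        (M := Ω[A⁄k])).toMultilinearMap.restrictScalars k).compLinearMap
          fun _ => (KaehlerDifferential.D k A).toLinearMap)
      map_add' := fun _ _ => add_smul _ _ _
      map_smul' := fun _ _ => MultilinearMap.ext fun _ => smul_assoc _ _ _ }

lemma dFormMultilinear_apply {n : ℕ} (a : Fin (n + 1) → A) :
    dFormMultilinear k A n a = dForm (a 0) (Fin.tail a) := rfl

variable (k A) in
def projAux (n : ℕ) : Cyc k A n →ₗ[k] ⋀[A]^n Ω[A⁄k] :=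
  PiTensorProduct.lift (dFormMultilinear k A n)

lemma projAux_mk {n : ℕ} (a : Fin (n + 1) → A) :
    projAux k A n (Cyc.mk k a) = dForm (a 0) (Fin.tail a) :=
  (PiTensorProduct.lift.tprod _).trans (dFormMultilinear_apply a)

lemma projAux_smul {n : ℕ} (r : A) (x : Cyc k A n) :
    projAux k A n (r • x) = r • projAux k A n x := by
  have : (projAux k A n).comp ((LinearMap.lsmul A (Cyc k A n) r).restrictScalars k) =
      ((LinearMap.lsmul A (⋀[A]^n Ω[A⁄k]) r).restrictScalars k).comp (projAux k A n) := by
    refine Cyc.linearMap_ext fun a => ?_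
    change projAux k A n (r • Cyc.mk k a) = r • projAux k A n (Cyc.mk k a)
    have h0 : (Pi.mulSingle 0 r * a : Fin (n + 1) → A) 0 = r * a 0 := by
      rw [Pi.mul_apply, Pi.mulSingle_eq_same]
    have h1 : Fin.tail (Pi.mulSingle 0 r * a : Fin (n + 1) → A) = Fin.tail a := by
      funext i
      rw [Fin.tail, Pi.mul_apply, Pi.mulSingle_eq_of_ne (Fin.succ_ne_zero i), one_mul, Fin.tail]
    rw [Cyc.smul_mk, projAux_mk, projAux_mk, h0, h1, dForm, dForm, smul_smul]
  exact LinearMap.congr_fun this x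

variable (k A) in
/-- The projection from Hochschild chains to forms, `a 0 ⊗ ⋯ ⊗ a n ↦ a 0 • d (a 1) ∧ ⋯ ∧ d (a n)`
(see `proj_mk`). -/
def proj (n : ℕ) : Cyc k A n →ₗ[A] ⋀[A]^n Ω[A⁄k] :=
  { toFun := projAux k A n, map_add' := map_add _, map_smul' := projAux_smul }

lemma proj_apply {n : ℕ} (x : Cyc k A n) : proj k A n x = projAux k A n x := rfl

lemma proj_mk {n : ℕ} (a : Fin (n + 1) → A) :
    proj k A n (Cyc.mk k a) = dForm (a 0) (Fin.tail a) := by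
  rw [proj_apply, projAux_mk]

lemma dForm_leibniz {n : ℕ} (a x y : A) (r : Fin n → A) (i : Fin n) :
    (dForm a (Function.update r i (x * y)) : ⋀[A]^n Ω[A⁄k]) =
      dForm (a * x) (Function.update r i y) + dForm (a * y) (Function.update r i x) := by
  have key (z : A) : (fun j => KaehlerDifferential.D k A (Function.update r i z j)) =
      Function.update (fun j => KaehlerDifferential.D k A (r j)) i (KaehlerDifferential.D k A z) := by
    funext j
    by_cases h : j = i
    · subst h; simp
    · simp [h]
  simp only [dForm, key, Derivation.leibniz]
  rw [AlternatingMap.map_update_add, AlternatingMap.map_update_smul,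
    AlternatingMap.map_update_smul, smul_add, smul_smul, smul_smul]

def leibnizTerm (a : ℕ → A) (n m : ℕ) : ⋀[A]^n Ω[A⁄k] :=
  if m = 0 ∨ m = n + 2 then 0 else
    dForm (a 0 * a m) (fun l : Fin n => a (if l + 1 < m then l + 1 else l + 2))

lemma proj_face {n : ℕ} (a : ℕ → A) (i : Fin (n + 2)) :
    proj k A n (Cyc.face i (Cyc.mk k fun j => a j)) =
      leibnizTerm a n i + leibnizTerm a n (i + 1) := by
  rw [Cyc.face_mk, proj_mk, leibnizTerm, leibnizTerm]
  have single (l : Fin (n + 1)) (m : Fin (n + 2)) (h : ∀ j, Cyc.faceIdx i j = l ↔ j = m) :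
      ∏ j with Cyc.faceIdx i j = l, a j = a m := by
    simp [h, Finset.filter_eq']
  have pair (l : Fin (n + 1)) (m m' : Fin (n + 2)) (hm : m ≠ m')
      (h : ∀ j, Cyc.faceIdx i j = l ↔ j = m ∨ j = m') :
      ∏ j with Cyc.faceIdx i j = l, a j = a m * a m' := by
    have : (Finset.univ.filter fun j => Cyc.faceIdx i j = l) = {m, m'} := by ext j; simp [h]
    rw [this, Finset.prod_pair hm]
  have hi := i.isLt
  by_cases h0 : (i : ℕ) = 0
  · rw [if_pos (Or.inl h0), if_neg (by omega), zero_add]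
    congr 1
    · rw [pair 0 0 1 (by simp)]
      · simp [h0]
      · intro j
        simp only [Cyc.faceIdx, Fin.ext_iff, Fin.val_zero, Fin.val_one, Fin.val_succ,
          Fin.val_castSucc]
        split_ifs <;> omega
    · funext l
      rw [Fin.tail, single _ l.succ.succ]
      · simp [h0]
      · intro j
        simp only [Cyc.faceIdx, Fin.ext_iff, Fin.val_zero, Fin.val_one, Fin.val_succ,
          Fin.val_castSucc]
        split_ifs <;> omega
  by_cases h1 : (i : ℕ) = n + 1
  · rw [if_neg (by omega), if_pos (Or.inr (by omega)), add_zero]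
    congr 1
    · rw [pair 0 0 i (by rw [Ne, Fin.ext_iff]; simp; omega)]
      · simp
      · intro j
        simp only [Cyc.faceIdx, Fin.ext_iff, Fin.val_zero, Fin.val_one, Fin.val_succ,
          Fin.val_castSucc]
        split_ifs <;> omega
    · funext l
      rw [Fin.tail, single _ l.succ.castSucc]
      · rw [if_pos (show (l : ℕ) + 1 < i by omega)]; simp
      · intro j
        have hj := j.isLt
        have hl := l.isLt
        simp only [Cyc.faceIdx, Fin.ext_iff, Fin.val_zero, Fin.val_one, Fin.val_succ,
          Fin.val_castSucc]
        split_ifs <;> first | omega | (rw [false_iff]; omega)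
  rw [if_neg (by omega), if_neg (by omega)]
  rw [single 0 0]
  swap
  · intro j
    simp only [Cyc.faceIdx, Fin.ext_iff, Fin.val_zero]
    split_ifs <;> omega
  have ht : Fin.tail (fun l => ∏ j with Cyc.faceIdx i j = l, a j) =
      Function.update (fun l : Fin n => a (if l + 1 < (i : ℕ) then l + 1 else l + 2))
        (⟨i - 1, by omega⟩ : Fin n) (a i * a (i + 1)) := by
    funext l
    rw [Fin.tail]
    by_cases hl : l = ⟨i - 1, by omega⟩
    · subst hl
      rw [pair _ i ⟨i + 1, by omega⟩ (by simp [Fin.ext_iff])]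
      · simp
      · intro j
        simp only [Cyc.faceIdx, Fin.ext_iff, Fin.val_zero, Fin.val_one, Fin.val_succ,
          Fin.val_castSucc]
        split_ifs <;> omega
    · rw [Function.update_of_ne hl]
      have hl' : (l : ℕ) ≠ i - 1 := fun h => hl (Fin.ext h)
      rw [single _ ⟨if l + 1 < (i : ℕ) then l + 1 else l + 2, by split_ifs <;> omega⟩]
      · intro j
        simp only [Cyc.faceIdx, Fin.ext_iff, Fin.val_zero, Fin.val_one, Fin.val_succ,
          Fin.val_castSucc]
        split_ifs <;> omega
  rw [ht, dForm_leibniz]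
  congr 2
  · funext l
    by_cases hl : l = ⟨i - 1, by omega⟩
    · subst hl
      rw [Function.update_self, if_neg (show ¬ (i : ℕ) - 1 + 1 < i by omega)]
      exact congrArg a (by change (i : ℕ) + 1 = i - 1 + 2; omega)
    · rw [Function.update_of_ne hl]
  · funext l
    by_cases hl : l = ⟨i - 1, by omega⟩
    · subst hl
      rw [Function.update_self, if_pos (show (i : ℕ) - 1 + 1 < i + 1 by omega)]
      exact congrArg a (by change (i : ℕ) = i - 1 + 1; omega)
    · rw [Function.update_of_ne hl]
      have hl' : (l : ℕ) ≠ i - 1 := fun h => hl (Fin.ext h)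
      congr 1
      split_ifs <;> omega

lemma sum_alternating {M : Type*} [AddCommGroup M] (T : ℕ → M) (N : ℕ) :
    ∑ i ∈ Finset.range N, (-1 : ℤ) ^ i • (T i + T (i + 1)) = T 0 - (-1 : ℤ) ^ N • T N := by
  induction N with
  | zero => simp
  | succ N ih =>
    rw [Finset.sum_range_succ, ih, pow_succ, smul_add]
    simp only [mul_neg, mul_one, neg_smul]
    abel

lemma proj_b {n : ℕ} (x : Cyc k A (n + 1)) : proj k A n (Cyc.b n x) = 0 := by
  have : ((proj k A n).comp (Cyc.b n)).restrictScalars k = 0 := by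
    refine Cyc.linearMap_ext fun a => ?_
    change proj k A n (Cyc.b n (Cyc.mk k a)) = 0
    have ha : a = fun j : Fin (n + 2) => (fun m : ℕ => if h : m < n + 2 then a ⟨m, h⟩ else 0) j := by
      funext j; simp
    rw [ha]
    simp only [Cyc.b_apply, map_sum, map_zsmul]
    simp_rw [proj_face (k := k) (fun m : ℕ => if h : m < n + 2 then a ⟨m, h⟩ else 0)]
    rw [Fin.sum_univ_eq_sum_range (fun i => (-1 : ℤ) ^ i • (leibnizTerm (k := k) _ n i + leibnizTerm _ n (i + 1))), sum_alternating]
    simp [leibnizTerm]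
  exact LinearMap.congr_fun this x

lemma formsMap_proj (φ : A →ₐ[k] B) {n : ℕ} (x : Cyc k A n) :
    formsMap φ n (proj k A n x) = proj k B n (Cyc.mapHom φ n x) := by
  let := φ.toRingHom.toAlgebra
  have : IsScalarTower k A B := IsScalarTower.of_algebraMap_eq fun x => (φ.commutes x).symm
  have : ((formsMapAlg (k := k) (A := A) (B := B) n).restrictScalars k).comp
      ((proj k A n).restrictScalars k) =
      ((proj k B n).restrictScalars k).comp (Cyc.mapHom φ n).toLinearMap := by
    refine Cyc.linearMap_ext fun a => ?_
    change formsMap φ n (proj k A n (Cyc.mk k a)) = proj k B n (Cyc.mapHom φ n (Cyc.mk k a))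
    rw [proj_mk, formsMap_dForm, Cyc.mapHom_mk, proj_mk]
    rfl
  exact LinearMap.congr_fun this x

end Forms

end Algebra

section Functors

variable (k : Type u) [CommRing k]

/-- A rule `A ↦ M(A)` that attaches to every commutative `k`-algebra `A` an `A`-module, functorially
in `A` through semilinear maps. -/
structure ModuleFunctor where
  obj (A : CommAlgCat.{u} k) : ModuleCat.{u} A
  map {A B : CommAlgCat.{u} k} (φ : A ⟶ B) : obj A →+ obj B
  map_smul {A B : CommAlgCat.{u} k} (φ : A ⟶ B) (a : A) (x : obj A) :
    map φ (a • x) = φ.hom a • map φ x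
  map_id {A : CommAlgCat.{u} k} (x : obj A) : map (𝟙 A) x = x
  map_comp {A B C : CommAlgCat.{u} k} (φ : A ⟶ B) (ψ : B ⟶ C) (x : obj A) :
    map (φ ≫ ψ) x = map ψ (map φ x)

namespace ModuleFunctor

variable {k}

/-- Natural families of `A`-linear maps `M(A) → N(A)`. -/
@[ext]
structure Hom (M N : ModuleFunctor k) where
  app (A : CommAlgCat.{u} k) : M.obj A →ₗ[A] N.obj A
  naturality {A B : CommAlgCat.{u} k} (φ : A ⟶ B) (x : M.obj A) :
    app B (M.map φ x) = N.map φ (app A x)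

instance : Category (ModuleFunctor k) where
  Hom := Hom
  id M := ⟨fun _ => LinearMap.id, fun _ _ => rfl⟩
  comp f g := ⟨fun A => (g.app A).comp (f.app A), fun φ x => by
    rw [LinearMap.comp_apply, f.naturality, g.naturality, LinearMap.comp_apply]⟩

end ModuleFunctor

/-- `A ↦ A ⊗ ⋯ ⊗ A` (`n + 1` factors). -/
def cyc (n : ℕ) : ModuleFunctor k where
  obj A := ModuleCat.of A (Cyc k A n)
  map φ := (Cyc.mapHom φ.hom n).toRingHom.toAddMonoidHom
  map_smul φ a x := Cyc.mapHom_smul φ.hom a x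
  map_id x := Cyc.mapHom_id x
  map_comp φ ψ x := Cyc.mapHom_comp φ.hom ψ.hom x

/-- `A ↦ ⋀ⁿ Ω_{A/k}`. -/
def forms (n : ℕ) : ModuleFunctor k where
  obj A := ModuleCat.of A (⋀[A]^n Ω[A⁄k])
  map φ := formsMap φ.hom n
  map_smul φ a x := formsMap_smul φ.hom a x
  map_id x := formsMap_id x
  map_comp φ ψ x := formsMap_comp φ.hom ψ.hom x

/-- The Hochschild differential as a natural map. -/
def cycD (n : ℕ) : cyc k (n + 1) ⟶ cyc k n where
  app A := (Cyc.b n : Cyc k A (n + 1) →ₗ[A] Cyc k A n)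
  naturality φ x := (Cyc.mapHom_b φ.hom x).symm

/-- The projection `a 0 ⊗ ⋯ ⊗ a n ↦ a 0 • d (a 1) ∧ ⋯ ∧ d (a n)` as a natural map. -/
def cycProj (n : ℕ) : cyc k n ⟶ forms k n where
  app A := proj k A n
  naturality φ x := (formsMap_proj φ.hom x).symm

end Functors

section Sheaves

variable {k : Type u} [CommRing k] {X Y : Scheme.{u}} (f : X ⟶ Spec (.of k))

/-- The structure map `k → Γ(X, U)` of a scheme over `Spec k`. -/
def structureHom (U : X.Opens) : CommRingCat.of k ⟶ Γ(X, U) :=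
  (Scheme.ΓSpecIso (.of k)).inv ≫ f.appTop ≫ X.presheaf.map (homOfLE le_top).op

lemma structureHom_map {U V : X.Opens} (i : U ⟶ V) :
    structureHom f V ≫ X.presheaf.map i.op = structureHom f U := by
  simp only [structureHom, Category.assoc, ← Functor.map_comp]
  rfl

lemma structureHom_app {f} {g : Y ⟶ Spec (.of k)} (h : X ⟶ Y) (w : h ≫ g = f) (U : Y.Opens) :
    structureHom g U ≫ h.app U = structureHom f (h ⁻¹ᵁ U) := by
  subst w
  simp only [structureHom, Category.assoc, Scheme.Hom.naturality, Scheme.Hom.comp_appTop]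
  rfl

def structureMap (U : X.Opens) : k →+* Γ(X, U) := (structureHom f U).hom

/-- `Γ(X, U)` as a `k`-algebra. -/
def sections (U : X.Opens) : CommAlgCat.{u} k :=
  letI := (structureMap f U).toAlgebra
  CommAlgCat.of k Γ(X, U)

/-- Restriction of functions, as a map of `k`-algebras. -/
def restr {U V : X.Opens} (i : U ⟶ V) : sections f V ⟶ sections f U :=
  letI := (structureMap f U).toAlgebra
  letI := (structureMap f V).toAlgebra
  CommAlgCat.ofHom
    { (X.presheaf.map i.op).hom with
      commutes' := fun c => by
        exact ConcreteCategory.congr_hom (structureHom_map f i) c }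

/-- Pullback of functions along a morphism of `k`-schemes, as a map of `k`-algebras. -/
def pull {g : Y ⟶ Spec (.of k)} (h : X ⟶ Y) (w : h ≫ g = f) (U : Y.Opens) :
    sections g U ⟶ sections f (h ⁻¹ᵁ U) :=
  letI := (structureMap g U).toAlgebra
  letI := (structureMap f (h ⁻¹ᵁ U)).toAlgebra
  CommAlgCat.ofHom
    { (h.app U).hom with
      commutes' := fun c => by
        exact ConcreteCategory.congr_hom (structureHom_app h w U) c }

lemma restr_id (U : X.Opens) : restr f (𝟙 U) = 𝟙 _ := by
  ext x
  exact ConcreteCategory.congr_hom (X.presheaf.map_id (.op U)) x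

lemma restr_comp {U V W : X.Opens} (i : U ⟶ V) (j : V ⟶ W) :
    restr f (i ≫ j) = restr f j ≫ restr f i := by
  ext x
  exact ConcreteCategory.congr_hom (X.presheaf.map_comp j.op i.op) x

lemma restr_pull {g : Y ⟶ Spec (.of k)} (h : X ⟶ Y) (w : h ≫ g = f) {U V : Y.Opens}
    (i : U ⟶ V) :
    restr g i ≫ pull f h w U = pull f h w V ≫ restr f ((Opens.map h.base).map i) := by
  ext x
  exact ConcreteCategory.congr_hom (h.naturality i.op) x

namespace ModuleFunctor

def presheafAb (M : ModuleFunctor k) : (X.Opens)ᵒᵖ ⥤ Ab.{u} where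
  obj U := AddCommGrpCat.of (M.obj (sections f U.unop))
  map i := AddCommGrpCat.ofHom (M.map (restr f i.unop))
  map_id U := by
    ext x
    change M.map (restr f (𝟙 U.unop)) x = x
    rw [restr_id, M.map_id]
  map_comp i j := by
    ext x
    change M.map (restr f (j.unop ≫ i.unop)) x = M.map (restr f j.unop) (M.map (restr f i.unop) x)
    rw [restr_comp, M.map_comp]

/-- The presheaf of `𝒪_X`-modules `U ↦ M(Γ(X, U))`. -/
def presheaf (M : ModuleFunctor k) : X.PresheafOfModules :=
  letI _inst : ∀ U : (X.Opens)ᵒᵖ, Module (X.ringCatSheaf.obj.obj U) ((M.presheafAb f).obj U) :=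
    fun U => (M.obj (sections f U.unop)).isModule
  PresheafOfModules.ofPresheaf (R := X.ringCatSheaf.obj) (M.presheafAb f) fun _ _ i r m =>
    M.map_smul (restr f i.unop) r m

def presheafAbMap {M N : ModuleFunctor k} (φ : M ⟶ N) : M.presheafAb f ⟶ N.presheafAb f where
  app U := AddCommGrpCat.ofHom (φ.app (sections f U.unop)).toAddMonoidHom
  naturality _ _ i := by
    ext x
    exact φ.naturality (restr f i.unop) x

def presheafMap {M N : ModuleFunctor k} (φ : M ⟶ N) : M.presheaf f ⟶ N.presheaf f :=
  PresheafOfModules.homMk (presheafAbMap f φ)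
    fun U r m => (φ.app (sections f U.unop)).map_smul r m

/-- The sheaf of `𝒪_X`-modules associated with `U ↦ M(Γ(X, U))`. -/
def sheaf (M : ModuleFunctor k) : X.Modules :=
  (PresheafOfModules.sheafification (𝟙 X.ringCatSheaf.obj)).obj (M.presheaf f)

/-- The map of sheaves of `𝒪_X`-modules induced by a natural map `M → N`. -/
def sheafMap {M N : ModuleFunctor k} (φ : M ⟶ N) : M.sheaf f ⟶ N.sheaf f :=
  (PresheafOfModules.sheafification (𝟙 X.ringCatSheaf.obj)).map (presheafMap f φ)

lemma sheafMap_comp {M N P : ModuleFunctor k} (φ : M ⟶ N) (ψ : N ⟶ P) :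
    sheafMap f (φ ≫ ψ) = sheafMap f φ ≫ sheafMap f ψ :=
  (PresheafOfModules.sheafification (𝟙 X.ringCatSheaf.obj)).map_comp
    (presheafMap f φ) (presheafMap f ψ)

lemma sheafMap_eq_zero {M N : ModuleFunctor k} (φ : M ⟶ N) (h : ∀ A x, φ.app A x = 0) :
    sheafMap f φ = 0 := by
  have : presheafMap f φ = 0 := by
    ext U x
    exact h (sections f U.unop) x
  rw [sheafMap, this]
  exact Functor.map_zero _ _ _

/-- The section over `U` of the associated sheaf given by an element of `M(Γ(X, U))`. -/
def sheafSection (M : ModuleFunctor k) (U : X.Opens) :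
    M.obj (sections f U) →+ Γ(M.sheaf f, U) :=
  ((CategoryTheory.toSheafify (Opens.grothendieckTopology X) (M.presheaf f).presheaf).app
    (.op U)).hom

lemma sheafSection_smul (M : ModuleFunctor k) (U : X.Opens) (r : Γ(X, U))
    (x : M.obj (sections f U)) :
    sheafSection f M U ((show sections f U from r) • x) = r • sheafSection f M U x :=
  (((PresheafOfModules.sheafificationAdjunction (𝟙 X.ringCatSheaf.obj)).unit.app
    (M.presheaf f)).app (.op U)).hom.map_smul r x

lemma sheafSection_map (M : ModuleFunctor k) {U V : X.Opens} (i : U ⟶ V)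
    (x : M.obj (sections f V)) :
    (M.sheaf f).presheaf.map i.op (sheafSection f M V x) =
      sheafSection f M U (M.map (restr f i) x) :=
  (ConcreteCategory.congr_hom
    ((CategoryTheory.toSheafify (Opens.grothendieckTopology X)
      (M.presheaf f).presheaf).naturality i.op) x).symm

lemma map_pull_restr (M : ModuleFunctor k) {g : Y ⟶ Spec (.of k)} (h : X ⟶ Y) (w : h ≫ g = f)
    {U V : Y.Opens} (i : U ⟶ V) (x : M.obj (sections g V)) :
    M.map (pull f h w U) (M.map (restr g i) x) =
      M.map (restr f ((Opens.map h.base).map i)) (M.map (pull f h w V) x) := by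
  rw [← M.map_comp, restr_pull, M.map_comp]

def pullPreAb (M : ModuleFunctor k) {g : Y ⟶ Spec (.of k)} (h : X ⟶ Y) (w : h ≫ g = f) :
    M.presheafAb g ⟶ ((Scheme.Modules.pushforward h).obj (M.sheaf f)).presheaf where
  app U := AddCommGrpCat.ofHom
    ((sheafSection f M (h ⁻¹ᵁ U.unop)).comp (M.map (pull f h w U.unop)))
  naturality U V i := by
    ext x
    exact (congrArg (sheafSection f M (h ⁻¹ᵁ V.unop)) (map_pull_restr f M h w i.unop x)).trans
      (sheafSection_map f M ((Opens.map h.base).map i.unop) _).symm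

lemma sheafSection_pull_smul (M : ModuleFunctor k) {g : Y ⟶ Spec (.of k)} (h : X ⟶ Y)
    (w : h ≫ g = f) (U : Y.Opens) (r : sections g U) (x : M.obj (sections g U)) :
    sheafSection f M (h ⁻¹ᵁ U) (M.map (pull f h w U) (r • x)) =
      (show Γ(X, h ⁻¹ᵁ U) from (pull f h w U).hom r) •
        sheafSection f M (h ⁻¹ᵁ U) (M.map (pull f h w U) x) := by
  rw [M.map_smul]
  exact sheafSection_smul f M _ _ _

def pullPre (M : ModuleFunctor k) {g : Y ⟶ Spec (.of k)} (h : X ⟶ Y) (w : h ≫ g = f) :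
    M.presheaf g ⟶ (PresheafOfModules.restrictScalars (𝟙 Y.ringCatSheaf.obj)).obj
      ((SheafOfModules.forget _).obj ((Scheme.Modules.pushforward h).obj (M.sheaf f))) :=
  PresheafOfModules.homMk (pullPreAb f M h w)
    fun U r m => sheafSection_pull_smul f M h w U.unop r m

/-- For a morphism `h : X ⟶ Y` of `k`-schemes, the induced map from the sheaf on `Y` to the direct
image of the sheaf on `X`; on sections it comes from `M(Γ(Y, U)) → M(Γ(X, h⁻¹U))`, see
`pullback_sheafSection`. -/
def pullback (M : ModuleFunctor k) {g : Y ⟶ Spec (.of k)} (h : X ⟶ Y) (w : h ≫ g = f) :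
    M.sheaf g ⟶ (Scheme.Modules.pushforward h).obj (M.sheaf f) :=
  ((PresheafOfModules.sheafificationAdjunction (𝟙 Y.ringCatSheaf.obj)).homEquiv
    (M.presheaf g) _).symm (pullPre f M h w)

lemma hom_ext_sheaf (M : ModuleFunctor k) {F : X.Modules} {φ ψ : M.sheaf f ⟶ F}
    (H : ∀ (U : X.Opens) (x : M.obj (sections f U)),
      φ.app U (sheafSection f M U x) = ψ.app U (sheafSection f M U x)) : φ = ψ := by
  apply ((PresheafOfModules.sheafificationAdjunction (𝟙 X.ringCatSheaf.obj)).homEquiv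
    (M.presheaf f) _).injective
  ext U x
  exact H U.unop x

lemma sheafMap_sheafSection {M N : ModuleFunctor k} (φ : M ⟶ N) (U : X.Opens)
    (x : M.obj (sections f U)) :
    (sheafMap f φ).app U (sheafSection f M U x) = sheafSection f N U (φ.app _ x) := by
  have := (PresheafOfModules.sheafificationAdjunction (𝟙 X.ringCatSheaf.obj)).unit.naturality
    (presheafMap f φ)
  exact (ConcreteCategory.congr_hom (congrArg (fun t => PresheafOfModules.Hom.app t (.op U)) this) x).symm

lemma pullback_sheafSection (M : ModuleFunctor k) {g : Y ⟶ Spec (.of k)} (h : X ⟶ Y)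
    (w : h ≫ g = f) (U : Y.Opens) (x : M.obj (sections g U)) :
    (pullback f M h w).app U (sheafSection g M U x) =
      sheafSection f M (h ⁻¹ᵁ U) (M.map (pull f h w U) x) := by
  have := ((PresheafOfModules.sheafificationAdjunction (𝟙 Y.ringCatSheaf.obj)).homEquiv
    (M.presheaf g) _).apply_symm_apply (pullPre f M h w)
  exact (ConcreteCategory.congr_hom (congrArg (fun t => PresheafOfModules.Hom.app t (.op U)) this) x)

lemma pullback_sheafMap {M N : ModuleFunctor k} (φ : M ⟶ N) {g : Y ⟶ Spec (.of k)} (h : X ⟶ Y)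
    (w : h ≫ g = f) :
    pullback f M h w ≫ (Scheme.Modules.pushforward h).map (sheafMap f φ) =
      sheafMap g φ ≫ pullback f N h w := by
  refine hom_ext_sheaf g M fun U x => ?_
  change (sheafMap f φ).app _ ((pullback f M h w).app U (sheafSection g M U x)) =
    (pullback f N h w).app U ((sheafMap g φ).app U (sheafSection g M U x))
  rw [pullback_sheafSection, sheafMap_sheafSection, sheafMap_sheafSection, pullback_sheafSection,
    φ.naturality]

end ModuleFunctor

end Sheaves

section Complexes

open HomologicalComplex

section General

variable {C D : Type*} [Category* C] [Category* D] [Abelian C] [Abelian D]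

/-- A map from `K` to a complex that vanishes in cohomological degrees `< n` factors uniquely through
the canonical truncation of `K` in cohomological degrees `≥ n`; this is the factorization. -/
def truncLift {K L : CochainComplex C ℤ} (φ : K ⟶ L) (n : ℤ) [L.IsStrictlyGE n] :
    K.truncGE n ⟶ L :=
  CochainComplex.truncGEMap φ n ≫ inv (HomologicalComplex.πTruncGE L (ComplexShape.embeddingUpIntGE n))

lemma π_truncLift {K L : CochainComplex C ℤ} (φ : K ⟶ L) (n : ℤ) [L.IsStrictlyGE n] :
    K.πTruncGE n ≫ truncLift φ n = φ := by
  rw [truncLift, CochainComplex.πTruncGE_naturality_assoc]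
  exact (congrArg (φ ≫ ·) (IsIso.hom_inv_id
    (HomologicalComplex.πTruncGE L (ComplexShape.embeddingUpIntGE n)))).trans (Category.comp_id _)

def extendCompareX {ι : Type*} {c : ComplexShape ι} (F : C ⥤ D) [F.Additive]
    (K : HomologicalComplex C c) : (i : Option ι) →
    (extend.X ((F.mapHomologicalComplex c).obj K) i ⟶ F.obj (extend.X K i))
  | some _ => 𝟙 _
  | none => 0

/-- An additive functor commutes with regarding a chain complex as a cochain complex on `ℤ`. -/
def extendCompare (F : C ⥤ D) [F.Additive] (K : ChainComplex C ℕ) :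
    ((F.mapHomologicalComplex _).obj K).extend ComplexShape.embeddingDownNat ⟶
      (F.mapHomologicalComplex _).obj (K.extend ComplexShape.embeddingDownNat) where
  f i := extendCompareX F K (ComplexShape.embeddingDownNat.r i)
  comm' i j _ := by
    change extendCompareX F K _ ≫ F.map (extend.d K _ _) =
      extend.d ((F.mapHomologicalComplex _).obj K) _ _ ≫ extendCompareX F K _
    generalize ComplexShape.embeddingDownNat.r i = i'
    generalize ComplexShape.embeddingDownNat.r j = j'
    match i', j' with
    | some _, some _ => exact (Category.id_comp _).trans (Category.comp_id _).symm
    | none, _ => simp [extendCompareX, extend.d]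
    | some _, none => simp [extendCompareX, extend.d]; exact comp_zero

end General

variable {k : Type u} [CommRing k] {X Y : Scheme.{u}} (f : X ⟶ Spec (.of k))

open ModuleFunctor

/-- The sheafified Hochschild complex of `X` over `k`: the chain complex of `𝒪_X`-modules associated
with the complex of presheaves `U ↦ C_•(Γ(X, U) / k)`. When `X` is flat over `k`, as all smooth
schemes are, tensor products over `k` of local rings of functions need not be derived, and this
complex represents the Hochschild homology complex of `X` in the derived category. -/
def hochschildComplex : ChainComplex X.Modules ℕ :=
  ChainComplex.of (fun n => (cyc k n).sheaf f) (fun n => sheafMap f (cycD k n)) fun n => by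
    rw [← sheafMap_comp]
    exact sheafMap_eq_zero f _ fun A x => Cyc.b_b x

lemma hochschildComplex_d (n : ℕ) :
    (hochschildComplex f).d (n + 1) n = sheafMap f (cycD k n) :=
  ChainComplex.of_d (fun n => (cyc k n).sheaf f) (fun n => sheafMap f (cycD k n)) n

/-- The Hochschild homology complex of `X` over `k` as a complex on `ℤ` with cohomological indexing:
Hochschild chains of degree `n` sit in degree `-n`. -/
def HH : CochainComplex X.Modules ℤ :=
  (hochschildComplex f).extend ComplexShape.embeddingDownNat

/-- The sheaf `Ω^t_{X/k}`, associated with `U ↦ ⋀^t Ω_{Γ(X, U)/k}`. -/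
def Omega (t : ℕ) : X.Modules := (forms k t).sheaf f

/-- The map of complexes from Hochschild chains to `Ω^t` in homological degree `t`, given in degree `t`
by `a₀ ⊗ ⋯ ⊗ aₜ ↦ a₀ da₁ ∧ ⋯ ∧ daₜ`. -/
def toOmega (t : ℕ) :
    hochschildComplex f ⟶ (HomologicalComplex.single X.Modules _ t).obj (Omega f t) :=
  mkHomToSingle (sheafMap f (cycProj k t)) fun i hi => by
    obtain rfl : t + 1 = i := hi
    refine (congrArg (· ≫ _) (hochschildComplex_d f t)).trans ?_
    refine (sheafMap_comp f _ _).symm.trans ?_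
    exact sheafMap_eq_zero f _ fun A x => proj_b x

/-- The map `HH_X ⟶ Ω^t[t]`, where `Ω^t[t]` is `Ω^t` placed in cohomological degree `-t`. -/
def HHToOmega (t : ℕ) :
    HH f ⟶ (HomologicalComplex.single X.Modules (.up ℤ) (-t)).obj (Omega f t) :=
  extendMap (toOmega f t) ComplexShape.embeddingDownNat ≫
    (extendSingleIso ComplexShape.embeddingDownNat (Omega f t) t (-t) rfl).hom

/-- The truncation `τ_{≤ p - 1} HH_X` (homological indexing), which is the canonical truncation in
cohomological degrees `≥ 1 - p`: it keeps the homology sheaves of degree `≤ p - 1`. -/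
abbrev truncHH (p : ℕ) : CochainComplex X.Modules ℤ := (HH f).truncGE (1 - p)

instance : HasFiniteBiproducts (CochainComplex X.Modules ℤ) := Abelian.hasFiniteBiproducts

/-- The complex `⨁_{t = 0}^{p - 1} Ω^t[t]` (with zero differential). -/
abbrev sumOmega (p : ℕ) : CochainComplex X.Modules ℤ :=
  ⨁ fun t : Fin p => (HomologicalComplex.single X.Modules (.up ℤ) (-(t : ℤ))).obj (Omega f t)

/-- The map `τ_{≤ p - 1} HH_X ⟶ ⨁_{t = 0}^{p - 1} Ω^t[t]` through which the maps `HH_X ⟶ Ω^t[t]`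
factor. -/
def truncHHToSumOmega (p : ℕ) : truncHH f p ⟶ sumOmega f p :=
  biproduct.lift fun t : Fin p =>
    haveI : CochainComplex.IsStrictlyGE ((HomologicalComplex.single X.Modules (.up ℤ)
        (-(t : ℤ))).obj (Omega f t)) (1 - p) :=
      (CochainComplex.isStrictlyGE_iff _ _).2 fun i hi =>
        isZero_single_obj_X _ _ _ _ (by have := t.isLt; omega)
    truncLift (HHToOmega f t) (1 - p)

/-- Functoriality of the sheafified Hochschild complex along a morphism of `k`-schemes. -/
def hochschildPullback {g : Y ⟶ Spec (.of k)} (h : X ⟶ Y) (w : h ≫ g = f) :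
    hochschildComplex g ⟶
      ((Scheme.Modules.pushforward h).mapHomologicalComplex _).obj (hochschildComplex f) where
  f n := pullback f (cyc k n) h w
  comm' i j hij := by
    obtain rfl : j + 1 = i := hij
    refine Eq.trans ?_ ((pullback_sheafMap f (cycD k j) h w).trans ?_)
    · exact congrArg (fun d => pullback f (cyc k (j + 1)) h w ≫
        (Scheme.Modules.pushforward h).map d) (hochschildComplex_d f j)
    · exact congrArg (· ≫ pullback f (cyc k j) h w) (hochschildComplex_d g j).symm

/-- Functoriality of `HH` along a morphism of `k`-schemes: `HH_Y ⟶ h_* HH_X`. -/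
def HHPullback {g : Y ⟶ Spec (.of k)} (h : X ⟶ Y) (w : h ≫ g = f) :
    HH g ⟶ ((Scheme.Modules.pushforward h).mapHomologicalComplex _).obj (HH f) :=
  extendMap (hochschildPullback f h w) ComplexShape.embeddingDownNat ≫
    extendCompare (Scheme.Modules.pushforward h) (hochschildComplex f)

/-- Functoriality of the truncation: `τ_{≤ p - 1} HH_Y ⟶ h_* τ_{≤ p - 1} HH_X`, induced by
`HH_Y ⟶ h_* HH_X ⟶ h_* τ_{≤ p - 1} HH_X`. -/
def truncHHPullback {g : Y ⟶ Spec (.of k)} (h : X ⟶ Y) (w : h ≫ g = f) (p : ℕ) :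
    truncHH g p ⟶
      ((Scheme.Modules.pushforward h).mapHomologicalComplex _).obj (truncHH f p) :=
  haveI : (truncHH f p).IsStrictlyGE (1 - p) :=
    inferInstanceAs (((HH f).truncGE (1 - p)).IsStrictlyGE (1 - p))
  truncLift (HHPullback f h w ≫ ((Scheme.Modules.pushforward h).mapHomologicalComplex _).map
    ((HH f).πTruncGE (1 - p))) (1 - p)

/-- Functoriality of forms: `⨁ Ω^t_Y[t] ⟶ h_* ⨁ Ω^t_X[t]`, given by the pullback of forms. -/
def sumOmegaPullback {g : Y ⟶ Spec (.of k)} (h : X ⟶ Y) (w : h ≫ g = f) (p : ℕ) :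
    sumOmega g p ⟶
      ((Scheme.Modules.pushforward h).mapHomologicalComplex _).obj (sumOmega f p) :=
  biproduct.desc fun t : Fin p =>
    (HomologicalComplex.single Y.Modules (.up ℤ) (-(t : ℤ))).map (pullback f (forms k t) h w) ≫
      (HomologicalComplex.singleMapHomologicalComplex (Scheme.Modules.pushforward h) (.up ℤ)
        (-(t : ℤ))).inv.app (Omega f t) ≫
      ((Scheme.Modules.pushforward h).mapHomologicalComplex _).map
        (biproduct.ι (fun t : Fin p => (HomologicalComplex.single X.Modules (.up ℤ)
          (-(t : ℤ))).obj (Omega f t)) t)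

/-- The map `ℋ_t(HH_X) ⟶ Ω^t` induced on homology sheaves by `HH_X ⟶ Ω^t[t]`. -/
def homologyToOmega (t : ℕ) : (hochschildComplex f).homology t ⟶ Omega f t :=
  homologyMap (toOmega f t) t ≫ (singleObjHomologySelfIso _ t (Omega f t)).hom

/-- The section `a dr₁ ∧ ⋯ ∧ drₜ` of `Ω^t` over `U`. -/
def formSection (t : ℕ) (U : X.Opens) (a : Γ(X, U)) (r : Fin t → Γ(X, U)) : Γ(Omega f t, U) :=
  sheafSection f (forms k t) U (dForm (k := k) (A := sections f U) a r)

/-- The section over `U` of the sheaf of Hochschild `t`-chains given by the antisymmetrization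
`∑ σ, sgn σ • (a ⊗ r_{σ(1)} ⊗ ⋯ ⊗ r_{σ(t)})`. -/
def antisymmSection (t : ℕ) (U : X.Opens) (a : Γ(X, U)) (r : Fin t → Γ(X, U)) :
    Γ((hochschildComplex f).X t, U) :=
  sheafSection f (cyc k t) U (Cyc.antisymm (k := k) (A := sections f U) a r)

end Complexes


end HKR

end

/-! The Hochschild complex of a commutative `k`-algebra `A` is the quotient `B / I B` of the bar
complex `B`, where `A ⊗ A` acts on `B` through the two outer factors and `I` is the ideal of the
diagonal. The bar complex resolves `A`. For every `x : A`, signed insertion of `x` in the inner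
positions is a homotopy from multiplication by `x ⊗ 1 - 1 ⊗ x` to zero (`Cyc.barD_insertion`).

If `A` is étale over a polynomial ring, the differences `ξ i` of the coordinates form a regular
sequence on `B` in every order (`Cyc.regular_coord`). Dividing by one `ξ i` at a time, on which the
homotopy kills homology, doubles the homology. So the homology of `B / (ξ)` is free over `A`, with
one generator for each set of coordinates, obtained from the unit by iterated insertion. A
separability element gives `f` congruent to `1` modulo `I` with `f I` contained in `(ξ)`. As `I`
acts by zero on the homology of `B / (ξ)`, the passage to `B / I B` changes nothing. There iterated
insertions become antisymmetrizations, so Hochschild homology is free on the antisymmetrized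
coordinates (`Cyc.exists_eq_sum_antisymm`, `Cyc.eq_zero_of_sum_antisymm`).

For a coordinate-free map from forms, antisymmetrization has to be a derivation in each variable up
to boundaries (`Cyc.antisymm_leibniz`). It suffices to check this in a polynomial ring over the
integers. The projection to forms composed with antisymmetrization is `n!`, and nothing has torsion
there, so forms detect homology; on forms the identity is the Leibniz rule. The resulting map sends
a basis of forms to the basis found above.

Smooth schemes have étale coordinates locally, and sheafification is exact. Hence `Ω^n` is the
kernel of the differential on chains modulo boundaries, which is the homology sheaf
(`hochschildHomologyData`). Its composite with the projection is `n!` (`hkrIso_homologyToOmega`),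
which is invertible for `n < p` because `p` is nilpotent. The projections are therefore isomorphisms
on homology in degrees below `p`, and assemble to a quasi-isomorphism from the truncation.
Naturality already holds for chains: pullback of functions commutes with `a₀ ⊗ ⋯ ⊗ aₙ ↦ a₀ da₁ ∧ ⋯ ∧
daₙ`. -/

noncomputable section

namespace HKR

/-! ### Homology of a complex modulo a regular sequence that acts null-homotopically -/

section Koszul

variable {S A B ι K : Type*} [CommRing S] [CommRing A] [AddCommGroup B] [Module S B] [Algebra A S]
  [Module A B] [IsScalarTower A S B]

/-- The submodule `∑ i ∈ s, ξ i • B` of `B`. -/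
def sumSMul (B : Type*) [AddCommGroup B] [Module S B] (ξ : ι → S) (s : Finset ι) :
    Submodule S B :=
  LinearMap.range (∑ i ∈ s, ξ i • LinearMap.proj i : (ι → B) →ₗ[S] B)

lemma mem_sumSMul {ξ : ι → S} {s : Finset ι} {x : B} :
    x ∈ sumSMul B ξ s ↔ ∃ y : ι → B, ∑ i ∈ s, ξ i • y i = x := by
  simp [sumSMul, LinearMap.mem_range, LinearMap.sum_apply]

lemma sumSMul_mono {ξ : ι → S} {s t : Finset ι} (h : s ⊆ t) :
    sumSMul B ξ s ≤ sumSMul B ξ t := by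
  classical
  intro x hx
  obtain ⟨y, rfl⟩ := mem_sumSMul.1 hx
  refine mem_sumSMul.2 ⟨fun i => if i ∈ s then y i else 0, ?_⟩
  rw [← Finset.sum_subset h fun i _ hi => by simp [hi]]
  exact Finset.sum_congr rfl fun i hi => by simp [hi]

lemma smul_mem_sumSMul {ξ : ι → S} {s : Finset ι} {i : ι} (hi : i ∈ s) (v : B) :
    ξ i • v ∈ sumSMul B ξ s := by
  classical
  refine mem_sumSMul.2 ⟨Pi.single i v, ?_⟩
  rw [Finset.sum_eq_single i (fun j _ hj => by simp [hj]) (fun h => (h hi).elim), Pi.single_eq_same]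

lemma mem_sumSMul_insert [DecidableEq ι] {ξ : ι → S} {s : Finset ι} {i : ι} (hi : i ∉ s) {x : B} :
    x ∈ sumSMul B ξ (insert i s) ↔ ∃ v, x - ξ i • v ∈ sumSMul B ξ s := by
  constructor
  · intro hx
    obtain ⟨y, rfl⟩ := mem_sumSMul.1 hx
    exact ⟨y i, mem_sumSMul.2 ⟨y, by rw [Finset.sum_insert hi]; abel⟩⟩
  · rintro ⟨v, hv⟩
    rw [← sub_add_cancel x (ξ i • v)]
    exact add_mem (sumSMul_mono (Finset.subset_insert i s) hv)
      (smul_mem_sumSMul (Finset.mem_insert_self i s) v)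

lemma map_mem_sumSMul {B' : Type*} [AddCommGroup B'] [Module S B'] (φ : B →ₗ[S] B') {ξ : ι → S}
    {s : Finset ι} {x : B} (hx : x ∈ sumSMul B ξ s) : φ x ∈ sumSMul B' ξ s := by
  obtain ⟨y, rfl⟩ := mem_sumSMul.1 hx
  exact mem_sumSMul.2 ⟨fun i => φ (y i), by simp⟩

/-- A complex `(B, d)` of `S`-modules (with the grading forgotten) on which multiplication by the
elements `ξ i`, a regular sequence in every order, is null-homotopic, with homology generated over
`A` by the class of `unit`; `elt s` is obtained from `unit` by applying the homotopies. -/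
structure KoszulData (S A B ι : Type*) [CommRing S] [CommRing A] [AddCommGroup B] [Module S B]
    [Module A B] [LinearOrder ι] where
  d : B →ₗ[S] B
  d_d (v : B) : d (d v) = 0
  ξ : ι → S
  h : ι → B →ₗ[S] B
  d_h (i : ι) (v : B) : d (h i v) + h i (d v) = ξ i • v
  regular (i : ι) (s : Finset ι) (_ : i ∉ s) (v : B) : ξ i • v ∈ sumSMul B ξ s → v ∈ sumSMul B ξ s
  unit : B
  d_unit : d unit = 0
  exists_of_d_eq_zero (z : B) : d z = 0 → ∃ (c : A) (w : B), z = c • unit + d w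
  eq_zero_of_smul_unit (c : A) (w : B) : c • unit = d w → c = 0
  elt : Finset ι → B
  elt_empty : elt ∅ = unit
  elt_insert (i : ι) (s : Finset ι) (_ : ∀ j ∈ s, i < j) : elt (insert i s) = h i (elt s)

namespace KoszulData

variable [LinearOrder ι] (D : KoszulData S A B ι)

/-- Since `d h = ξ - h d`, each new homotopy contributes a multiple of `ξ i`. Thus `elt t` becomes a
cycle after division by the `ξ i` with `i ∈ t`. -/
lemma d_elt_mem (t : Finset ι) : D.d (D.elt t) ∈ sumSMul B D.ξ t := by
  induction t using Finset.induction_on_min with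
  | empty => rw [D.elt_empty, D.d_unit]; exact zero_mem _
  | insert i s hi ih =>
    rw [D.elt_insert i s hi, eq_sub_of_add_eq (D.d_h i _)]
    exact sub_mem (smul_mem_sumSMul (Finset.mem_insert_self i s) _)
      (map_mem_sumSMul (D.h i) (sumSMul_mono (Finset.subset_insert i s) ih))

lemma d_smul_A (c : A) (v : B) : D.d (c • v) = c • D.d v := D.d.map_smul_of_tower c v

lemma smul_A_mem {s : Finset ι} (c : A) {v : B} (hv : v ∈ sumSMul B D.ξ s) :
    c • v ∈ sumSMul B D.ξ s := by
  rw [← algebraMap_smul S c v]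
  exact Submodule.smul_mem _ _ hv

lemma smul_smul_comm_A (c : A) (g : S) (v : B) : c • g • v = g • c • v := by
  rw [← algebraMap_smul S c, ← algebraMap_smul S c, smul_smul, smul_smul, mul_comm]

/-- The homotopy `h i` realizes `ξ i` times a combination of generators as a boundary, up to the
submodule already divided out. This lifts the generators along the connecting map for multiplication
by `ξ i`. -/
lemma d_sum_h_sub_mem {s : Finset ι} (i : ι) (c : Finset ι → A) :
    D.d (∑ t ∈ s.powerset, c t • D.h i (D.elt t)) - D.ξ i • ∑ t ∈ s.powerset, c t • D.elt t ∈
      sumSMul B D.ξ s := by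
  rw [map_sum, Finset.smul_sum, ← Finset.sum_sub_distrib]
  refine sum_mem fun t ht => ?_
  rw [D.d_smul_A, ← smul_smul_comm_A, ← smul_sub, ← D.d_h i, sub_add_cancel_left, smul_neg]
  exact neg_mem (D.smul_A_mem _ (map_mem_sumSMul _
    (sumSMul_mono (Finset.mem_powerset.1 ht) (D.d_elt_mem t))))

lemma sum_powerset_insert_elt {s : Finset ι} {i : ι} (hi : ∀ j ∈ s, i < j) (c : Finset ι → A) :
    ∑ t ∈ (insert i s).powerset, c t • D.elt t = ∑ t ∈ s.powerset, c t • D.elt t +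
      ∑ t ∈ s.powerset, c (insert i t) • D.h i (D.elt t) := by
  rw [Finset.sum_powerset_insert fun h => lt_irrefl _ (hi i h)]
  congr 1
  refine Finset.sum_congr rfl fun t ht => ?_
  rw [D.elt_insert i t fun j hj => hi j (Finset.mem_powerset.1 ht hj)]

/-- Cycles modulo `∑ i ∈ s, ξ i • B`. -/
lemma exists_of_d_mem (s : Finset ι) (z : B) (hz : D.d z ∈ sumSMul B D.ξ s) :
    ∃ (c : Finset ι → A) (w : B), z - ∑ t ∈ s.powerset, c t • D.elt t - D.d w ∈ sumSMul B D.ξ s := by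
  induction s using Finset.induction_on_min generalizing z with
  | empty =>
    obtain ⟨y, hy⟩ := mem_sumSMul.1 hz
    obtain ⟨c, w, rfl⟩ := D.exists_of_d_eq_zero z (by simpa using hy.symm)
    exact ⟨fun _ => c, w, by simp [D.elt_empty]⟩
  | insert i s hi ih =>
    have his : i ∉ s := fun h => lt_irrefl _ (hi i h)
    obtain ⟨y, hy⟩ := (mem_sumSMul_insert his).1 hz
    -- The differential of `hy` puts `ξ i • d y` in the smaller submodule. Regularity cancels `ξ i`,
    -- so `y` is a cycle modulo that submodule.
    have hdy : D.d y ∈ sumSMul B D.ξ s := by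
      refine D.regular i s his _ ?_
      have := neg_mem (map_mem_sumSMul D.d hy)
      rwa [map_sub, D.d_d, zero_sub, map_smul, neg_neg] at this
    obtain ⟨c₁, w₁, h₁⟩ := ih y hdy
    -- The chain `ξ i • w₁ + ∑ c₁ t • h i (elt t)` has boundary `ξ i • y` modulo the smaller
    -- submodule, so subtracting it from `z` leaves a cycle there. The generators whose index set
    -- contains `i` get the coefficients `c₁`.
    obtain ⟨c₀, w₀, h₀⟩ := ih
      (z - D.ξ i • w₁ - ∑ t ∈ s.powerset, c₁ t • D.h i (D.elt t)) (by
        have := sub_mem (add_mem hy (Submodule.smul_mem _ (D.ξ i) h₁)) (D.d_sum_h_sub_mem i c₁)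
        convert this using 1
        simp only [map_sub, map_smul, smul_sub]
        abel)
    refine ⟨fun t => if i ∈ t then c₁ (t.erase i) else c₀ t, w₀, ?_⟩
    rw [mem_sumSMul_insert his, D.sum_powerset_insert_elt hi]
    refine ⟨w₁, ?_⟩
    convert h₀ using 1
    have e₀ : ∑ t ∈ s.powerset, (if i ∈ t then c₁ (t.erase i) else c₀ t) • D.elt t =
        ∑ t ∈ s.powerset, c₀ t • D.elt t := Finset.sum_congr rfl fun t ht => by
      rw [if_neg fun h => his (Finset.mem_powerset.1 ht h)]
    have e₁ : ∑ t ∈ s.powerset, (if i ∈ insert i t then c₁ ((insert i t).erase i) else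
        c₀ (insert i t)) • D.h i (D.elt t) = ∑ t ∈ s.powerset, c₁ t • D.h i (D.elt t) :=
      Finset.sum_congr rfl fun t ht => by
        rw [if_pos (Finset.mem_insert_self i t),
          Finset.erase_insert fun h => his (Finset.mem_powerset.1 ht h)]
    rw [e₀, e₁]
    abel

/-- Linear independence of the generators in homology. The coefficients of sets containing `i` are
isolated by applying `d` and cancelling `ξ i`; the others are then treated over the smaller set. -/
lemma eq_zero_of_sum_sub_d_mem (s : Finset ι) (c : Finset ι → A) (w : B)
    (h : ∑ t ∈ s.powerset, c t • D.elt t - D.d w ∈ sumSMul B D.ξ s) :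
    ∀ t ∈ s.powerset, c t = 0 := by
  induction s using Finset.induction_on_min generalizing c w with
  | empty =>
    obtain ⟨y, hy⟩ := mem_sumSMul.1 h
    intro t ht
    obtain rfl : t = ∅ := by simpa using ht
    have hy' := hy.symm
    exact D.eq_zero_of_smul_unit _ w (by simpa [D.elt_empty, sub_eq_zero] using hy')
  | insert i s hi ih =>
    have his : i ∉ s := fun h => lt_irrefl _ (hi i h)
    obtain ⟨v, hv⟩ := (mem_sumSMul_insert his).1 h
    rw [D.sum_powerset_insert_elt hi] at hv
    have hd : D.d (∑ t ∈ s.powerset, c t • D.elt t) ∈ sumSMul B D.ξ s := by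
      rw [map_sum]
      refine sum_mem fun t ht => ?_
      rw [D.d_smul_A]
      exact D.smul_A_mem _ (sumSMul_mono (Finset.mem_powerset.1 ht) (D.d_elt_mem t))
    have h₁ : ∀ t ∈ s.powerset, c (insert i t) = 0 := by
      refine ih (fun t => c (insert i t)) v (D.regular i s his _ ?_)
      have := sub_mem (sub_mem (map_mem_sumSMul D.d hv) hd)
        (D.d_sum_h_sub_mem (s := s) i (fun t => c (insert i t)))
      convert this using 1
      simp only [map_sub, map_add, map_smul, smul_sub, D.d_d]
      abel
    have e₁ : ∑ t ∈ s.powerset, c (insert i t) • D.h i (D.elt t) = 0 :=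
      Finset.sum_eq_zero fun t ht => by rw [h₁ t ht, zero_smul]
    rw [e₁, add_zero] at hv
    have hdv : D.d v ∈ sumSMul B D.ξ s := by
      refine D.regular i s his _ ?_
      have := sub_mem hd (map_mem_sumSMul D.d hv)
      convert this using 1
      simp only [map_sub, map_smul, D.d_d]
      abel
    -- Since `d v` lies in the smaller submodule, `ξ i • v` is the boundary of `h i v` modulo it and
    -- can be absorbed in `d w`.
    have h₀ := ih c (w + D.h i v) (by
      have := add_mem hv (map_mem_sumSMul (D.h i) hdv)
      convert this using 1
      rw [← D.d_h, map_add]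
      abel)
    intro t ht
    by_cases hit : i ∈ t
    · rw [← Finset.insert_erase hit]
      refine h₁ _ (Finset.mem_powerset.2 ?_)
      have := Finset.erase_subset_erase i (Finset.mem_powerset.1 ht)
      rwa [Finset.erase_insert his] at this
    · refine h₀ t (Finset.mem_powerset.2 ?_)
      exact (Finset.subset_insert_iff_of_notMem hit).1 (Finset.mem_powerset.1 ht)

variable (s : Finset ι) (I : Ideal S)

/-- The ideal `I` acts by zero on the homology of the quotient by the `ξ i`, because each of its
generators is null-homotopic on `B`. -/
lemma exists_sub_d_mem (ζ : K → S) (hI : I = Ideal.span (Set.range ζ)) (h : K → B →ₗ[S] B)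
    (d_h : ∀ a v, D.d (h a v) + h a (D.d v) = ζ a • v) {g : S} (hg : g ∈ I) (v : B)
    (hv : D.d v ∈ sumSMul B D.ξ s) : ∃ w, g • v - D.d w ∈ sumSMul B D.ξ s := by
  rw [hI] at hg
  induction hg using Submodule.span_induction generalizing v with
  | mem g hg =>
    obtain ⟨a, rfl⟩ := hg
    refine ⟨h a v, ?_⟩
    rw [← d_h, add_sub_cancel_left]
    exact map_mem_sumSMul _ hv
  | zero => exact ⟨0, by simp⟩
  | add x y _ _ hx hy =>
    obtain ⟨w₁, h₁⟩ := hx v hv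
    obtain ⟨w₂, h₂⟩ := hy v hv
    refine ⟨w₁ + w₂, ?_⟩
    convert add_mem h₁ h₂ using 1
    rw [add_smul, map_add]
    abel
  | smul r x _ hx =>
    obtain ⟨w, hw⟩ := hx (r • v) (by rw [map_smul]; exact Submodule.smul_mem _ _ hv)
    exact ⟨w, by rwa [smul_eq_mul, mul_comm, ← smul_smul]⟩

variable {s I}

/-- Multiplication by `f` turns a cycle modulo `I B` into a cycle modulo the `ξ i`, and does not
change it modulo `I B`. -/
lemma exists_of_d_mem_ideal {f : S}
    (hf : f - 1 ∈ I) (hfI : ∀ v ∈ I • (⊤ : Submodule S B), f • v ∈ sumSMul B D.ξ s)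
    (hξ : ∀ i, D.ξ i ∈ I) (z : B) (hz : D.d z ∈ I • (⊤ : Submodule S B)) :
    ∃ (c : Finset ι → A) (w : B),
      z - ∑ t ∈ s.powerset, c t • D.elt t - D.d w ∈ I • (⊤ : Submodule S B) := by
  obtain ⟨c, w, h⟩ := D.exists_of_d_mem s (f • z) (by rw [map_smul]; exact hfI _ hz)
  refine ⟨c, w, ?_⟩
  have h' : f • z - ∑ t ∈ s.powerset, c t • D.elt t - D.d w ∈ I • (⊤ : Submodule S B) := by
    obtain ⟨y, hy⟩ := mem_sumSMul.1 h
    rw [← hy]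
    exact sum_mem fun i _ => Submodule.smul_mem_smul (hξ i) trivial
  convert sub_mem h' (Submodule.smul_mem_smul hf (trivial : z ∈ (⊤ : Submodule S B))) using 1
  rw [sub_smul, one_smul]
  abel

/-- A relation modulo `I B` becomes a relation modulo the `ξ i` after multiplication by `f`. The
factor `f` can be removed, since `f - 1 ∈ I` acts by zero on homology there. -/
lemma eq_zero_of_sum_sub_d_mem_ideal {f : S}
    (hf : f - 1 ∈ I) (hfI : ∀ v ∈ I • (⊤ : Submodule S B), f • v ∈ sumSMul B D.ξ s)
    (ζ : K → S) (hI : I = Ideal.span (Set.range ζ))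
    (h : K → B →ₗ[S] B) (d_h : ∀ a v, D.d (h a v) + h a (D.d v) = ζ a • v)
    (c : Finset ι → A) (w : B)
    (hc : ∑ t ∈ s.powerset, c t • D.elt t - D.d w ∈ I • (⊤ : Submodule S B)) :
    ∀ t ∈ s.powerset, c t = 0 := by
  have hd : D.d (∑ t ∈ s.powerset, c t • D.elt t) ∈ sumSMul B D.ξ s := by
    rw [map_sum]
    refine sum_mem fun t ht => ?_
    rw [D.d_smul_A]
    exact D.smul_A_mem _ (sumSMul_mono (Finset.mem_powerset.1 ht) (D.d_elt_mem t))
  obtain ⟨w', hw'⟩ := D.exists_sub_d_mem s I ζ hI h d_h hf _ hd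
  refine D.eq_zero_of_sum_sub_d_mem s c (f • w - w') ?_
  convert sub_mem (hfI _ hc) hw' using 1
  simp only [map_sub, map_smul, smul_sub, sub_smul, one_smul]
  abel

end KoszulData

end Koszul

/-! ### Cancellation in alternating double sums -/

section Sums

variable {M : Type*} [AddCommGroup M]

/-- The entries at `(i, j)` and `(j, i + 1)` with `j ≤ i` agree and carry opposite signs. The
induction removes the last row and the last column together. -/
lemma sum_simplicial_eq_zero (G : ℕ → ℕ → M) (n : ℕ)
    (hG : ∀ i j, j ≤ i → i < n → G i j = G j (i + 1)) :
    ∑ i ∈ Finset.range n, ∑ j ∈ Finset.range (n + 1), (-1 : ℤ) ^ (i + j) • G i j = 0 := by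
  induction n with
  | zero => simp
  | succ n ih =>
    simp_rw [Finset.sum_range_succ _ (n + 1)]
    rw [Finset.sum_add_distrib, Finset.sum_range_succ (fun i => ∑ j ∈ Finset.range (n + 1), _),
      ih fun i j h h' => hG i j h (by omega), zero_add, ← Finset.sum_add_distrib]
    refine Finset.sum_eq_zero fun i hi => ?_
    rw [Finset.mem_range] at hi
    rw [hG n i (by omega) (by omega), ← add_smul, show i + (n + 1) = n + i + 1 by ring, pow_succ]
    simp

/-- Here `F i j` stands for the `i`-th face after the `j`-th insertion and `G i j` for the `j`-th
insertion after the `i`-th face. Faces away from the insertion cancel between the two sums; the two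
faces that absorb the inserted factor telescope. -/
lemma sum_homotopy (m : ℕ) (F G : ℕ → ℕ → M) (U : ℕ → M)
    (h₁ : ∀ i j, i ≤ j → j < m → F i (j + 1) = G i j) (h₂ : ∀ j, j ≤ m → F j j = U j)
    (h₃ : ∀ j, j ≤ m → F (j + 1) j = U (j + 1))
    (h₄ : ∀ i j, j < i → i ≤ m → F (i + 1) j = G i j) :
    ∑ i ∈ Finset.range (m + 2), ∑ j ∈ Finset.range (m + 1), (-1 : ℤ) ^ (i + j) • F i j +
      ∑ i ∈ Finset.range (m + 1), ∑ j ∈ Finset.range m, (-1 : ℤ) ^ (i + j) • G i j =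
      U 0 - U (m + 1) := by
  -- The sums `P j` and `Q j` are the parts `i ≤ j` and `i > j` of column `j` of the sum over `G`.
  let P (j : ℕ) : M := ∑ i ∈ Finset.range (j + 1), (-1 : ℤ) ^ (i + j) • G i j
  let Q (j : ℕ) : M := ∑ i ∈ Finset.range (m - j), (-1 : ℤ) ^ (j + 1 + i + j) • G (j + 1 + i) j
  have hF (j : ℕ) (hj : j < m + 1) :
      ∑ i ∈ Finset.range (m + 2), (-1 : ℤ) ^ (i + j) • F i j =
        (∑ i ∈ Finset.range j, (-1 : ℤ) ^ (i + j) • F i j) + (U j - U (j + 1)) - Q j := by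
    rw [show m + 2 = j + 1 + 1 + (m - j) by omega, Finset.sum_range_add, Finset.sum_range_succ,
      Finset.sum_range_succ, h₂ j (by omega), h₃ j (by omega)]
    have e : ∑ i ∈ Finset.range (m - j), (-1 : ℤ) ^ (j + 1 + 1 + i + j) • F (j + 1 + 1 + i) j =
        - Q j := by
      rw [← Finset.sum_neg_distrib]
      refine Finset.sum_congr rfl fun i hi => ?_
      rw [Finset.mem_range] at hi
      rw [show j + 1 + 1 + i = j + 1 + i + 1 by ring, h₄ _ _ (by omega) (by omega), ← neg_smul,
        show j + 1 + i + 1 + j = j + 1 + i + j + 1 by ring, pow_succ, mul_neg_one]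
    rw [e, Even.neg_one_pow ⟨j, rfl⟩, show j + 1 + j = 2 * j + 1 by ring, pow_succ, pow_mul]
    simp
    abel
  have hP (j : ℕ) (hj : j < m) :
      ∑ i ∈ Finset.range (j + 1), (-1 : ℤ) ^ (i + (j + 1)) • F i (j + 1) = - P j := by
    rw [← Finset.sum_neg_distrib]
    refine Finset.sum_congr rfl fun i hi => ?_
    rw [Finset.mem_range] at hi
    rw [h₁ _ _ (by omega) hj, ← neg_smul, ← add_assoc, pow_succ, mul_neg_one]
  have hG (j : ℕ) (hj : j < m) :
      ∑ i ∈ Finset.range (m + 1), (-1 : ℤ) ^ (i + j) • G i j = P j + Q j := by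
    rw [show m + 1 = j + 1 + (m - j) by omega, Finset.sum_range_add]
  rw [Finset.sum_comm (s := Finset.range (m + 2)), Finset.sum_comm (s := Finset.range (m + 1)) (t := Finset.range m),
    Finset.sum_congr rfl fun j hj => hF j (Finset.mem_range.1 hj),
    Finset.sum_congr rfl fun j hj => hG j (Finset.mem_range.1 hj)]
  simp only [Finset.sum_sub_distrib, Finset.sum_add_distrib]
  rw [Finset.sum_range_succ' (fun j => ∑ i ∈ Finset.range j, _),
    Finset.sum_congr rfl fun j hj => hP j (Finset.mem_range.1 hj), Finset.sum_range_succ Q,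
    ← Finset.sum_sub_distrib, Finset.sum_range_sub']
  simp only [Q, Nat.sub_self, Finset.range_zero, Finset.sum_empty, Finset.sum_neg_distrib]
  abel

end Sums

namespace Cyc

variable {k : Type u} [CommRing k] {A : Type u} [CommRing A] [Algebra k A]

/-! ### The bar complex, insertion homotopies and the contracting homotopy -/

section Bar

/-- The map `A ⊗ A → A ⊗ ⋯ ⊗ A` given by the first and the last factor. -/
def ends (k A : Type u) [CommRing k] [CommRing A] [Algebra k A] (m : ℕ) :
    A ⊗[k] A →ₐ[k] Cyc k A m :=
  Algebra.TensorProduct.productMap (ι k A 0) (ι k A (Fin.last m))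

instance (m : ℕ) : Algebra (A ⊗[k] A) (Cyc k A m) := (ends k A m).toRingHom.toAlgebra

lemma tensor_smul_def {m : ℕ} (g : A ⊗[k] A) (v : Cyc k A m) : g • v = ends k A m g * v := rfl

@[simp] lemma ends_tmul {m : ℕ} (a b : A) :
    ends k A m (a ⊗ₜ b) = ι k A 0 a * ι k A (Fin.last m) b :=
  Algebra.TensorProduct.productMap_apply_tmul _ _ _ _

lemma tmul_smul {m : ℕ} (a b : A) (v : Cyc k A m) :
    (a ⊗ₜ[k] b) • v = ι k A 0 a * ι k A (Fin.last m) b * v := by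
  rw [tensor_smul_def, ends_tmul]

lemma smul_eq {m : ℕ} (a : A) (v : Cyc k A m) : a • v = ι k A 0 a * v := rfl

instance (m : ℕ) : IsScalarTower A (A ⊗[k] A) (Cyc k A m) :=
  IsScalarTower.of_algebraMap_smul fun a v => by
    change (a ⊗ₜ[k] (1 : A)) • v = a • v
    rw [tmul_smul, map_one, mul_one, smul_eq]

/-- The index `i`, clipped to `{0, …, m}`. -/
def clip (m i : ℕ) : Fin (m + 1) := ⟨min i m, by omega⟩

/-- An algebra map which is the identity on the first and the last factor, as an `A ⊗ A`-linear
map. -/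
def endsLinear {m m' : ℕ} (φ : Cyc k A m →ₐ[k] Cyc k A m')
    (h₀ : ∀ a, φ (ι k A 0 a) = ι k A 0 a)
    (h₁ : ∀ a, φ (ι k A (Fin.last m) a) = ι k A (Fin.last m') a) :
    Cyc k A m →ₗ[A ⊗[k] A] Cyc k A m' :=
  { φ with
    map_smul' := fun g v => by
      have : φ.comp (ends k A m) = ends k A m' := by
        refine Algebra.TensorProduct.ext ?_ ?_ <;> ext a <;>
          simp [h₀, h₁]
      change φ (g • v) = g • φ v
      rw [tensor_smul_def, tensor_smul_def, map_mul, ← this]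
      rfl }

/-- Multiplication of the neighbouring factors `i` and `i + 1`. -/
def barFaceHom (m i : ℕ) : Cyc k A (m + 1) →ₐ[k] Cyc k A m :=
  lift fun j => ι k A (clip m (if (j : ℕ) ≤ i then j else j - 1))

/-- Insertion of a factor `1` in position `i`. -/
def insertHom (m i : ℕ) : Cyc k A m →ₐ[k] Cyc k A (m + 1) :=
  lift fun j => ι k A (clip (m + 1) (if (j : ℕ) < i then j else j + 1))

lemma barFaceHom_ι {m i : ℕ} (j : Fin (m + 2)) (a : A) :
    barFaceHom m i (ι k A j a) = ι k A (clip m (if (j : ℕ) ≤ i then j else j - 1)) a := lift_ι _ _ _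

lemma insertHom_ι {m i : ℕ} (j : Fin (m + 1)) (a : A) :
    insertHom m i (ι k A j a) = ι k A (clip (m + 1) (if (j : ℕ) < i then j else j + 1)) a :=
  lift_ι _ _ _

lemma face_castSucc {m : ℕ} (i : Fin (m + 1)) (v : Cyc k A (m + 1)) :
    face i.castSucc v = barFaceHom m i v := by
  rw [face_apply]
  have : (faceHom i.castSucc : Cyc k A (m + 1) →ₐ[k] _) = barFaceHom m i :=
    algHom_ext fun j a => by
      rw [faceHom_ι, barFaceHom_ι]
      congr 2
      ext
      simp only [faceIdx, clip, Fin.val_castSucc]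
      split_ifs <;> omega
  rw [this]

lemma barFaceHom_barFaceHom {m i j : ℕ} (h : j ≤ i) (v : Cyc k A (m + 2)) :
    barFaceHom m i (barFaceHom (m + 1) j v) = barFaceHom m j (barFaceHom (m + 1) (i + 1) v) := by
  have : (barFaceHom (k := k) (A := A) m i).comp (barFaceHom (m + 1) j) =
      (barFaceHom m j).comp (barFaceHom (m + 1) (i + 1)) := algHom_ext fun l a => by
    simp only [AlgHom.comp_apply, barFaceHom_ι]
    congr 2
    ext
    simp only [clip]
    split_ifs <;> omega
  exact DFunLike.congr_fun this v

/-- The `i`-th face of the bar complex. -/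
def barFace (m i : ℕ) : Cyc k A (m + 1) →ₗ[A ⊗[k] A] Cyc k A m :=
  endsLinear (barFaceHom m i)
    (fun a => by
      rw [barFaceHom_ι]; congr 1)
    (fun a => by
      rw [barFaceHom_ι]; congr 2; ext; simp only [clip, Fin.val_last]; split_ifs <;> omega)

lemma barFace_apply {m i : ℕ} (v : Cyc k A (m + 1)) : barFace m i v = barFaceHom m i v := rfl

/-- Insertion of `x` right after position `i`. -/
def insertAfter (x : A) (m i : ℕ) (hi : i < m) : Cyc k A m →ₗ[A ⊗[k] A] Cyc k A (m + 1) :=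
  LinearMap.mulLeft (A ⊗[k] A) (ι k A (clip (m + 1) (i + 1)) x) ∘ₗ
    endsLinear (insertHom m (i + 1))
      (fun a => by rw [insertHom_ι, if_pos (by simp)]; rfl)
      (fun a => by
        rw [insertHom_ι, if_neg (by rw [Fin.val_last]; omega)]; congr 2; ext; simp [clip])

lemma insertAfter_apply (x : A) {m i : ℕ} (hi : i < m) (v : Cyc k A m) :
    insertAfter x m i hi v = ι k A (clip (m + 1) (i + 1)) x * insertHom m (i + 1) v := rfl

/-- The differential of the bar complex. -/
def barD (m : ℕ) : Cyc k A (m + 1) →ₗ[A ⊗[k] A] Cyc k A m :=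
  ∑ i ∈ Finset.range (m + 1), (-1 : ℤ) ^ i • barFace m i

lemma barD_apply {m : ℕ} (v : Cyc k A (m + 1)) :
    barD m v = ∑ i ∈ Finset.range (m + 1), (-1 : ℤ) ^ i • barFaceHom m i v := by
  simp [barD, barFace_apply]

lemma barD_barD {m : ℕ} (v : Cyc k A (m + 2)) : barD m (barD (m + 1) v) = 0 := by
  rw [← sum_simplicial_eq_zero (fun i j => barFaceHom m i (barFaceHom (m + 1) j v)) (m + 1)
    fun i j h _ => barFaceHom_barFaceHom h v]
  simp only [barD_apply, map_sum, map_zsmul, Finset.smul_sum, smul_smul, pow_add]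
  rw [Finset.sum_comm]
  simp only [mul_comm]

/-- Signed insertion of `x` in all inner positions. -/
def insertion (x : A) (m : ℕ) : Cyc k A m →ₗ[A ⊗[k] A] Cyc k A (m + 1) :=
  ∑ j : Fin m, (-1 : ℤ) ^ (j : ℕ) • insertAfter x m j j.isLt

lemma insertion_apply (x : A) {m : ℕ} (v : Cyc k A m) :
    insertion x m v = ∑ j ∈ Finset.range m,
      (-1 : ℤ) ^ j • (ι k A (clip (m + 1) (j + 1)) x * insertHom m (j + 1) v) := by
  rw [← Fin.sum_univ_eq_sum_range fun j =>
    (-1 : ℤ) ^ j • (ι k A (clip (m + 1) (j + 1)) x * insertHom m (j + 1) v)]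
  simp [insertion, insertAfter_apply]

lemma barFaceHom_insertHom_of_le {m i j : ℕ} (h : i ≤ j) (hj : j < m) (v : Cyc k A (m + 1)) :
    barFaceHom (m + 1) i (insertHom (m + 1) (j + 2) v) = insertHom m (j + 1) (barFaceHom m i v) := by
  have : (barFaceHom (k := k) (A := A) (m + 1) i).comp (insertHom (m + 1) (j + 2)) =
      (insertHom m (j + 1)).comp (barFaceHom m i) := algHom_ext fun l a => by
    simp only [AlgHom.comp_apply, barFaceHom_ι, insertHom_ι]
    congr 2
    ext
    simp only [clip]
    grind
  exact DFunLike.congr_fun this v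

lemma barFaceHom_insertHom_of_lt {m i j : ℕ} (h : j ≤ i) (hi : i ≤ m) (v : Cyc k A (m + 1)) :
    barFaceHom (m + 1) (i + 1) (insertHom (m + 1) j v) = insertHom m j (barFaceHom m i v) := by
  have : (barFaceHom (k := k) (A := A) (m + 1) (i + 1)).comp (insertHom (m + 1) j) =
      (insertHom m j).comp (barFaceHom m i) := algHom_ext fun l a => by
    simp only [AlgHom.comp_apply, barFaceHom_ι, insertHom_ι]
    congr 2
    ext
    simp only [clip]
    grind
  exact DFunLike.congr_fun this v

lemma barFaceHom_insertHom_self {m j : ℕ} (v : Cyc k A m) :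
    barFaceHom m j (insertHom m j v) = v := by
  have : (barFaceHom (k := k) (A := A) m j).comp (insertHom m j) = AlgHom.id k _ :=
    algHom_ext fun l a => by
      simp only [AlgHom.comp_apply, barFaceHom_ι, insertHom_ι, AlgHom.id_apply]
      congr 2
      ext
      simp only [clip]
      grind
  exact DFunLike.congr_fun this v

lemma barFaceHom_insertHom_succ {m j : ℕ} (v : Cyc k A m) :
    barFaceHom m j (insertHom m (j + 1) v) = v := by
  have : (barFaceHom (k := k) (A := A) m j).comp (insertHom m (j + 1)) = AlgHom.id k _ :=
    algHom_ext fun l a => by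
      simp only [AlgHom.comp_apply, barFaceHom_ι, insertHom_ι, AlgHom.id_apply]
      congr 2
      ext
      simp only [clip]
      grind
  exact DFunLike.congr_fun this v

/-- In the telescoping sum, `U j` is `v` with `x` multiplied into slot `j`. Only the two outer slots
survive, and multiplication there is the action of `x ⊗ 1` and `1 ⊗ x`. -/
lemma barD_insertion (x : A) {m : ℕ} (v : Cyc k A (m + 1)) :
    barD (m + 1) (insertion x (m + 1) v) + insertion x m (barD m v) =
      (x ⊗ₜ[k] (1 : A) - 1 ⊗ₜ[k] x) • v := by
  have hU : (x ⊗ₜ[k] (1 : A) - 1 ⊗ₜ[k] x) • v = ι k A (clip (m + 1) 0) x * v -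
      ι k A (clip (m + 1) (m + 1)) x * v := by
    rw [sub_smul, tmul_smul, tmul_smul, map_one, map_one, mul_one, one_mul]
    congr 3
    congr 1
    ext; simp [clip]
  rw [hU, ← sum_homotopy m
    (fun i j => barFaceHom (m + 1) i (ι k A (clip (m + 2) (j + 1)) x * insertHom (m + 1) (j + 1) v))
    (fun i j => ι k A (clip (m + 1) (j + 1)) x * insertHom m (j + 1) (barFaceHom m i v))
    (fun j => ι k A (clip (m + 1) j) x * v)]
  · congr 1
    · simp only [barD_apply, insertion_apply, map_sum, map_zsmul, Finset.smul_sum, smul_smul, pow_add]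
      rw [Finset.sum_comm]
      exact Finset.sum_congr rfl fun _ _ => Finset.sum_congr rfl fun _ _ => by
        rw [mul_comm ((-1 : ℤ) ^ _)]
    · simp only [barD_apply, insertion_apply, map_sum, map_zsmul, Finset.smul_sum, smul_smul, pow_add,
        Finset.mul_sum, mul_smul_comm]
  · intro i j hij hj
    rw [map_mul, barFaceHom_insertHom_of_le hij hj, barFaceHom_ι]
    congr 3
    ext
    simp only [clip]
    grind
  · intro j hj
    rw [map_mul, barFaceHom_insertHom_succ, barFaceHom_ι]
    congr 3
    ext
    simp only [clip]
    grind
  · intro j hj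
    rw [map_mul, barFaceHom_insertHom_self, barFaceHom_ι]
    congr 3
    ext
    simp only [clip]
    grind
  · intro i j hij hi
    rw [map_mul, barFaceHom_insertHom_of_lt (by omega) hi, barFaceHom_ι]
    congr 3
    ext
    simp only [clip]
    grind

/-- The contracting homotopy of the augmented bar complex. -/
lemma barD_insertHom_zero {m : ℕ} (v : Cyc k A (m + 1)) :
    barD (m + 1) (insertHom (m + 1) 0 v) = v - insertHom m 0 (barD m v) := by
  rw [barD_apply, Finset.sum_range_succ', barFaceHom_insertHom_self,
    Finset.sum_congr rfl fun i hi => by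
      rw [barFaceHom_insertHom_of_lt (Nat.zero_le i) (Nat.le_of_lt_succ (Finset.mem_range.1 hi))]]
  simp only [barD_apply, map_sum, map_zsmul, pow_succ,
    mul_neg_one, neg_smul, Finset.sum_neg_distrib, pow_zero, one_smul]
  abel

end Bar

end Cyc

namespace Cyc

/-! ### The bar complex as a resolution of the algebra -/

section Total

variable (k : Type u) [CommRing k] (A : Type u) [CommRing A] [Algebra k A]

/-- The product of all terms of the bar complex. -/
abbrev BarTotal : Type u := (n : ℕ) → Cyc k A (n + 1)

variable {k A}

/-- The differential of the bar complex, in all degrees at once. -/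
def totalD : BarTotal k A →ₗ[A ⊗[k] A] BarTotal k A :=
  LinearMap.pi fun n => barD (n + 1) ∘ₗ LinearMap.proj (n + 1)

lemma totalD_apply (v : BarTotal k A) (n : ℕ) : totalD v n = barD (n + 1) (v (n + 1)) := rfl

/-- Signed insertion of `x`, in all degrees at once. -/
def totalInsertion (x : A) : BarTotal k A →ₗ[A ⊗[k] A] BarTotal k A :=
  LinearMap.pi fun
    | 0 => 0
    | n + 1 => insertion x (n + 1) ∘ₗ LinearMap.proj n

lemma totalInsertion_succ (x : A) (v : BarTotal k A) (n : ℕ) :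
    totalInsertion x v (n + 1) = insertion x (n + 1) (v n) := rfl

lemma totalD_totalD (v : BarTotal k A) : totalD (totalD v) = 0 :=
  funext fun _ => barD_barD _

variable (k) in
/-- The element `a ⊗ 1 - 1 ⊗ a` of `A ⊗ A`. -/
def diff (a : A) : A ⊗[k] A := a ⊗ₜ[k] (1 : A) - 1 ⊗ₜ[k] a

lemma totalD_totalInsertion (x : A) (v : BarTotal k A) :
    totalD (totalInsertion x v) + totalInsertion x (totalD v) = diff k x • v := by
  funext n
  rw [Pi.smul_apply, diff, ← barD_insertion x (v n)]
  cases n with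
  | zero =>
    -- In degree `0` the term `insertion x 0` is an empty sum, since a single factor has no inner
    -- position.
    change barD 1 (insertion x 1 (v 0)) + 0 = _
    congr 1
  | succ n => rfl

/-- The unit in degree `0`. -/
def totalUnit : BarTotal k A := Pi.single 0 1

lemma totalD_totalUnit : totalD (totalUnit : BarTotal k A) = 0 := by
  funext n
  rw [totalD_apply, totalUnit, Pi.single_eq_of_ne (by simp), map_zero]
  rfl

/-- The product of all factors. -/
def mulAll (m : ℕ) : Cyc k A m →ₐ[k] A := lift fun _ => AlgHom.id k A

lemma mulAll_ι {m : ℕ} (i : Fin (m + 1)) (a : A) : mulAll m (ι k A i a) = a := lift_ι _ _ _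

lemma mulAll_smul {m : ℕ} (a : A) (v : Cyc k A m) : mulAll m (a • v) = a * mulAll m v := by
  rw [smul_eq, map_mul, mulAll_ι]

lemma ι_mulAll (v : Cyc k A 0) : ι k A 0 (mulAll 0 v) = v := by
  have : (ι k A (0 : Fin 1)).comp (mulAll 0) = AlgHom.id k _ := algHom_ext fun i a => by
    obtain rfl : i = 0 := Fin.fin_one_eq_zero i
    rw [AlgHom.comp_apply, mulAll_ι]; rfl
  exact DFunLike.congr_fun this v

lemma mulAll_barD_zero (v : Cyc k A 1) : mulAll 0 (barD 0 v) = mulAll 1 v := by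
  have : (mulAll 0).comp (barFaceHom 0 0) = mulAll (k := k) (A := A) 1 := algHom_ext fun i a => by
    rw [AlgHom.comp_apply, barFaceHom_ι, mulAll_ι, mulAll_ι]
  simpa [barD_apply] using DFunLike.congr_fun this v

/-- Subtracting a multiple of the unit makes the degree `0` part vanish under multiplication `A ⊗ A
→ A`. The result is a cycle of the augmented bar complex, which inserting `1` in front contracts.
That homotopy need not be `A ⊗ A`-linear, since only a primitive of one element is wanted. -/
lemma exists_of_totalD_eq_zero (z : BarTotal k A) (hz : totalD z = 0) :
    ∃ (c : A) (w : BarTotal k A), z = c • totalUnit + totalD w := by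
  let c := mulAll 1 (z 0)
  let z' := z - c • totalUnit
  have hz' : totalD z' = 0 := by
    rw [map_sub, hz, LinearMap.map_smul_of_tower, totalD_totalUnit, smul_zero, sub_zero]
  have h (n : ℕ) : barD n (z' n) = 0 := by
    cases n with
    | zero =>
      rw [← ι_mulAll (barD 0 _), mulAll_barD_zero]
      have : mulAll 1 (z' 0) = 0 := by
        change mulAll 1 (z 0 - c • totalUnit 0) = 0
        rw [map_sub, mulAll_smul, totalUnit, Pi.single_eq_same, map_one, mul_one, sub_self]
      rw [this, map_zero]
    | succ n => exact congrFun hz' n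
  refine ⟨c, fun
    | 0 => 0
    | n + 1 => insertHom (n + 1) 0 (z' n), ?_⟩
  rw [← sub_eq_iff_eq_add']
  funext n
  change z' n = barD (n + 1) (insertHom (n + 1) 0 (z' n))
  rw [barD_insertHom_zero, h, map_zero, sub_zero]

/-- The augmentation `A ⊗ A → A` kills boundaries and sends `c • totalUnit` to `c`. -/
lemma eq_zero_of_smul_totalUnit (c : A) (w : BarTotal k A) (h : c • totalUnit = totalD w) :
    c = 0 := by
  have h0 : c • (1 : Cyc k A 1) = barD 1 (w 1) := by
    have := congrFun h 0
    rwa [Pi.smul_apply, totalUnit, Pi.single_eq_same] at this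
  have := mulAll_barD_zero (c • (1 : Cyc k A 1))
  rwa [mulAll_smul, map_one, mul_one, h0, barD_barD, map_zero, eq_comm] at this

end Total

/-! ### Regularity of coordinate differences on the bar complex -/

section Flat

variable {k : Type u} [CommRing k] {A : Type u} [CommRing A] [Algebra k A]

/-- Splitting off the first factor. -/
def consEquiv (n : ℕ) : A ⊗[k] Cyc k A n ≃ₐ[k] Cyc k A (n + 1) :=
  AlgEquiv.ofAlgHom
    (Algebra.TensorProduct.productMap (ι k A 0) (lift fun i => ι k A i.succ))
    (lift (Fin.cons Algebra.TensorProduct.includeLeft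
      fun i => Algebra.TensorProduct.includeRight.comp (ι k A i)))
    (algHom_ext fun i a => by
      rw [AlgHom.comp_apply, lift_ι]
      cases i using Fin.cases <;> simp)
    (Algebra.TensorProduct.ext (by ext a; simp) (algHom_ext fun i a => by simp))

lemma consEquiv_tmul_one {n : ℕ} (a : A) : consEquiv n (a ⊗ₜ[k] 1) = ι k A 0 a := by
  simp [consEquiv]

lemma consEquiv_one_tmul_ι {n : ℕ} (i : Fin (n + 1)) (a : A) :
    consEquiv n (1 ⊗ₜ[k] ι k A i a) = ι k A i.succ a := by
  simp [consEquiv]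

lemma flat_ι_last [Module.Flat k A] (n : ℕ) : (ι k A (Fin.last n)).Flat := by
  induction n with
  | zero =>
    refine RingHom.Flat.of_bijective (Function.bijective_iff_has_inverse.2
      ⟨mulAll 0, fun a => ?_, fun v => ?_⟩)
    · exact mulAll_ι _ a
    · exact ι_mulAll v
  | succ n ih =>
    have e : (ι k A (Fin.last (n + 1))).toRingHom = ((consEquiv n).toAlgHom.toRingHom.comp
        (Algebra.TensorProduct.includeRight : Cyc k A n →ₐ[k] A ⊗[k] Cyc k A n).toRingHom).comp
          (ι k A (Fin.last n)).toRingHom :=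
      RingHom.ext fun a => (consEquiv_one_tmul_ι (Fin.last n) a).symm
    change (ι k A (Fin.last (n + 1))).toRingHom.Flat
    rw [e]
    refine RingHom.Flat.comp ih (RingHom.Flat.comp ?_ (.of_bijective (consEquiv n).bijective))
    have e' : (Algebra.TensorProduct.includeRight : Cyc k A n →ₐ[k] A ⊗[k] Cyc k A n).toRingHom =
        (Algebra.TensorProduct.comm k (Cyc k A n) A).toAlgHom.toRingHom.comp
          (algebraMap (Cyc k A n) (Cyc k A n ⊗[k] A)) := by
      ext; rfl
    rw [e']
    refine RingHom.Flat.comp ?_ (.of_bijective (Algebra.TensorProduct.comm k _ _).bijective)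
    rw [RingHom.flat_algebraMap_iff]
    infer_instance

/-- After splitting off the first factor, this map is the tensor product of the identity of `A` with
the inclusion of the last factor, which is flat. -/
lemma flat_ends [Module.Flat k A] (n : ℕ) : (ends k A (n + 1)).Flat := by
  have e : (ends k A (n + 1)).toRingHom = (consEquiv n).toAlgHom.toRingHom.comp
      (Algebra.TensorProduct.map (AlgHom.id k A) (ι k A (Fin.last n))).toRingHom := by
    have : ends k A (n + 1) = (consEquiv n).toAlgHom.comp
        (Algebra.TensorProduct.map (AlgHom.id k A) (ι k A (Fin.last n))) := by
      refine Algebra.TensorProduct.ext ?_ ?_ <;> ext a <;>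
        simp [consEquiv_tmul_one, consEquiv_one_tmul_ι]
    rw [this]; rfl
  change (ends k A (n + 1)).toRingHom.Flat
  rw [e]
  exact RingHom.Flat.comp (RingHom.Flat.tensorProductMap (.id _) (flat_ι_last n))
    (.of_bijective (consEquiv n).bijective)

variable {ι' : Type} [Algebra (MvPolynomial ι' k) A] [IsScalarTower k (MvPolynomial ι' k) A]

variable (k A) in
/-- The coordinates of an algebra over a polynomial ring. -/
def coord (i : ι') : A := algebraMap (MvPolynomial ι' k) A (MvPolynomial.X i)

variable (k A ι') in
/-- The map `A[X] → A ⊗ A` which sends the variables to the elements `x ⊗ 1 - 1 ⊗ x`. -/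
def diffHom : MvPolynomial ι' A →ₐ[A] A ⊗[k] A :=
  MvPolynomial.aeval fun i => diff k (coord k A i)

/-- The involution `X i ↦ x i - X i` of `A[X]` changes this map into the one with `X i ↦ 1 ⊗ x i`,
which is the base change to `A` of the flat map from the polynomial ring to `A`. -/
lemma flat_diffHom [Module.Flat (MvPolynomial ι' k) A] : (diffHom k A ι').Flat := by
  let σ : MvPolynomial ι' A →ₐ[A] MvPolynomial ι' A :=
    MvPolynomial.aeval fun i => algebraMap A _ (coord k A i) - MvPolynomial.X i
  have hσ : σ.comp σ = AlgHom.id A _ := by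
    ext i
    simp [σ]
  have hσ' : Function.Bijective σ :=
    Function.bijective_iff_has_inverse.2 ⟨σ, fun x => DFunLike.congr_fun hσ x,
      fun x => DFunLike.congr_fun hσ x⟩
  let τ : A ⊗[k] MvPolynomial ι' k →ₐ[A] A ⊗[k] A :=
    Algebra.TensorProduct.map (AlgHom.id A A) (IsScalarTower.toAlgHom k (MvPolynomial ι' k) A)
  have hτ : τ.Flat := by
    refine RingHom.Flat.tensorProductMap (.id _) ?_
    change (algebraMap (MvPolynomial ι' k) A).Flat
    rw [RingHom.flat_algebraMap_iff]
    infer_instance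
  let e := MvPolynomial.algebraTensorAlgEquiv k A (σ := ι')
  have h : diffHom k A ι' = (τ.comp e.symm.toAlgHom).comp σ := by
    ext i
    have h₁ : σ (MvPolynomial.X i) = algebraMap A _ (coord k A i) - MvPolynomial.X i := by simp [σ]
    rw [AlgHom.comp_apply, h₁, map_sub, AlgHom.commutes, AlgHom.comp_apply, diffHom,
      MvPolynomial.aeval_X]
    change _ = _ - τ (e.symm (MvPolynomial.X i))
    rw [MvPolynomial.algebraTensorAlgEquiv_symm_X]
    simp [τ, diff, coord]
  rw [h]
  exact RingHom.Flat.comp (.of_bijective hσ') (RingHom.Flat.comp (.of_bijective e.symm.bijective) hτ)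

/-- The equational criterion of flatness reduces the claim to the polynomial ring, where `X i` is a
nonzerodivisor modulo the other variables: each monomial of `X i * c` is divisible by some `X l`
with `l ∈ s`, and `l ≠ i`. -/
lemma mem_sumSMul_of_flat {R M : Type*} [CommRing R] {σ : Type*} [Fintype σ] [AddCommGroup M]
    [Module (MvPolynomial σ R) M] [Module.Flat (MvPolynomial σ R) M] {i : σ} {s : Finset σ}
    (hi : i ∉ s) {v : M}
    (hv : (MvPolynomial.X i : MvPolynomial σ R) • v ∈ sumSMul M (MvPolynomial.X : σ → MvPolynomial σ R) s) :
    v ∈ sumSMul M (MvPolynomial.X : σ → MvPolynomial σ R) s := by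
  classical
  obtain ⟨y, hy⟩ := mem_sumSMul.1 hv
  -- The relation is `X i • v - ∑ j ∈ s, X j • y j = 0`, extended by zero coefficients to all
  -- indices.
  obtain ⟨m, a, w, h₁, h₂⟩ := Module.Flat.isTrivialRelation_of_sum_smul_eq_zero
    (f := fun j => if j = i then MvPolynomial.X i else
      if j ∈ s then (- MvPolynomial.X j : MvPolynomial σ R) else 0)
    (x := fun j => if j = i then v else y j) (by
      rw [← Finset.add_sum_erase _ _ (Finset.mem_univ i), if_pos rfl, if_pos rfl, ← hy,
        ← Finset.sum_subset (s₁ := s) (s₂ := Finset.univ.erase i) (fun j hj => Finset.mem_erase.2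
          ⟨fun h => hi (by rwa [← h]), Finset.mem_univ j⟩) (fun j hj hj' => by
            rw [if_neg (Finset.mem_erase.1 hj).1, if_neg hj', zero_smul]),
        ← Finset.sum_add_distrib]
      refine Finset.sum_eq_zero fun j hj => ?_
      have hji : j ≠ i := fun h => hi (h ▸ hj)
      simp [hji, hj])
  have hv' : v = ∑ j, a i j • w j := by simpa using h₁ i
  rw [hv']
  refine sum_mem fun j _ => ?_
  have ha : a i j ∈ Ideal.span ((MvPolynomial.X : σ → MvPolynomial σ R) '' s) := by
    have h₃ : MvPolynomial.X i * a i j ∈ Ideal.span ((MvPolynomial.X : σ → MvPolynomial σ R) '' s) := by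
      have := h₂ j
      beta_reduce at this
      rw [← Finset.add_sum_erase _ _ (Finset.mem_univ i), if_pos rfl,
        add_eq_zero_iff_eq_neg] at this
      rw [this]
      refine neg_mem (sum_mem fun l hl => ?_)
      rw [if_neg (Finset.mem_erase.1 hl).1]
      split_ifs with hls
      · exact Ideal.mul_mem_right _ _ (neg_mem (Ideal.subset_span ⟨l, hls, rfl⟩))
      · rw [zero_mul]; exact zero_mem _
    rw [MvPolynomial.mem_ideal_span_X_image] at h₃ ⊢
    intro μ hμ
    obtain ⟨l, hl, hl'⟩ := h₃ (Finsupp.single i 1 + μ) (by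
      rw [MvPolynomial.mem_support_iff, MvPolynomial.coeff_X_mul]
      exact MvPolynomial.mem_support_iff.1 hμ)
    have hli : i ≠ l := fun h => hi (h ▸ hl)
    exact ⟨l, hl, by simpa [hli] using hl'⟩
  generalize a i j = c at ha
  induction ha using Submodule.span_induction with
  | mem x hx =>
    obtain ⟨l, hl, rfl⟩ := hx
    exact smul_mem_sumSMul hl _
  | zero => rw [zero_smul]; exact zero_mem _
  | add x y _ _ hx hy => rw [add_smul]; exact add_mem hx hy
  | smul r x _ hx => rw [smul_assoc]; exact Submodule.smul_mem _ _ hx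

/-- Every term of the bar complex is flat over `A[X]`, with `X i` acting as the difference of the
`i`-th coordinate, so regularity is inherited from the variables. -/
lemma regular_coord [Fintype ι'] [Module.Flat (MvPolynomial ι' k) A] {n : ℕ} {i : ι'}
    {s : Finset ι'} (hi : i ∉ s) {v : Cyc k A (n + 1)}
    (hv : diff k (coord k A i) • v ∈ sumSMul (Cyc k A (n + 1)) (fun i => diff k (coord k A i)) s) :
    v ∈ sumSMul (Cyc k A (n + 1)) (fun i : ι' => diff k (coord k A i)) s := by
  have : Module.Flat k A := Module.Flat.trans k (MvPolynomial ι' k) A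
  let := ((ends k A (n + 1)).toRingHom.comp (diffHom k A ι').toRingHom).toAlgebra
  have : Module.Flat (MvPolynomial ι' A) (Cyc k A (n + 1)) := by
    have h := RingHom.Flat.comp (flat_diffHom (k := k) (A := A) (ι' := ι')) (flat_ends n)
    exact h
  have key (j : ι') (w : Cyc k A (n + 1)) :
      (MvPolynomial.X j : MvPolynomial ι' A) • w = diff k (coord k A j) • w := by
    change ends k A (n + 1) (diffHom k A ι' (MvPolynomial.X j)) * w = _
    rw [diffHom, MvPolynomial.aeval_X]
    rfl
  have h (w : Cyc k A (n + 1)) :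
      w ∈ sumSMul (Cyc k A (n + 1)) (fun i : ι' => diff k (coord k A i)) s ↔
        w ∈ sumSMul (Cyc k A (n + 1)) (MvPolynomial.X : ι' → MvPolynomial ι' A) s := by
    simp only [mem_sumSMul, key]
  rw [h] at hv ⊢
  exact mem_sumSMul_of_flat hi (by rwa [key])

/-- Iterated signed insertion. -/
def insertList (l : List A) : BarTotal k A := l.foldr (fun x v => totalInsertion x v) totalUnit

/-- The bar complex of an algebra which is flat over a polynomial ring. -/
def barKoszul [Fintype ι'] [LinearOrder ι'] [Module.Flat (MvPolynomial ι' k) A] :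
    KoszulData (A ⊗[k] A) A (BarTotal k A) ι' where
  d := totalD
  d_d := totalD_totalD
  ξ i := diff k (coord k A i)
  h i := totalInsertion (coord k A i)
  d_h i v := totalD_totalInsertion _ v
  regular i s hi v hv := by
    obtain ⟨y, hy⟩ := mem_sumSMul.1 hv
    have (n : ℕ) := mem_sumSMul.1 (regular_coord (k := k) (A := A) (n := n) hi (v := v n)
      (mem_sumSMul.2 ⟨fun j => y j n, by
        rw [← Pi.smul_apply, ← hy, Finset.sum_apply]; rfl⟩))
    choose w hw using this
    exact mem_sumSMul.2 ⟨fun j n => w n j, funext fun n => by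
      rw [← hw n, Finset.sum_apply]; rfl⟩
  unit := totalUnit
  d_unit := totalD_totalUnit
  exists_of_d_eq_zero := exists_of_totalD_eq_zero
  eq_zero_of_smul_unit := eq_zero_of_smul_totalUnit
  elt s := insertList ((s.sort (· ≤ ·)).map (coord k A))
  elt_empty := by simp [insertList]
  elt_insert i s hi := by
    rw [Finset.sort_insert _ (fun j hj => (hi j hj).le) fun h => lt_irrefl _ (hi i h)]
    rfl

end Flat

end Cyc

namespace Cyc

variable {k : Type u} [CommRing k] {A : Type u} [CommRing A] [Algebra k A]

/-! ### From the bar complex to the Hochschild complex -/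

section Closing

/-- Signed insertion of `x` after each factor. -/
def cyclicInsertion (x : A) (n : ℕ) : Cyc k A n →+ Cyc k A (n + 1) :=
  ∑ j : Fin (n + 1), (-1 : ℤ) ^ (j : ℕ) • (AddMonoidHom.mulLeft (ι k A j.succ x)).comp
    (insertHom n (j + 1)).toRingHom.toAddMonoidHom

lemma cyclicInsertion_apply (x : A) {n : ℕ} (v : Cyc k A n) :
    cyclicInsertion x n v =
      ∑ j : Fin (n + 1), (-1 : ℤ) ^ (j : ℕ) • (ι k A j.succ x * insertHom n (j + 1) v) := by
  simp [cyclicInsertion]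

lemma mk_eq_prod {n : ℕ} (a : Fin (n + 1) → A) : mk k a = ∏ i, ι k A i (a i) := by
  simp only [ι_eq_mk]
  rw [mk_prod]
  congr 1
  ext l
  rw [Finset.prod_apply, Finset.prod_eq_single l]
  · simp
  · intro j _ hj
    rw [Pi.mulSingle_eq_of_ne hj.symm]
  · simp

lemma insertHom_ι' {n : ℕ} (j : Fin (n + 1)) (i : Fin (n + 1)) (a : A) :
    insertHom n (j + 1) (ι k A i a) = ι k A (j.succ.succAbove i) a := by
  rw [insertHom_ι]
  congr 2
  ext
  simp only [clip, Fin.succAbove, Fin.lt_def, Fin.val_castSucc, Fin.val_succ]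
  split_ifs <;> simp <;> omega

lemma ι_mul_insertHom_mk {n : ℕ} (j : Fin (n + 1)) (x : A) (a : Fin (n + 1) → A) :
    ι k A j.succ x * insertHom n (j + 1) (mk k a) = mk k (Fin.insertNth j.succ x a) := by
  rw [mk_eq_prod, mk_eq_prod, map_prod, Fin.prod_univ_succAbove _ j.succ]
  simp only [insertHom_ι', Fin.insertNth_apply_same, Fin.insertNth_apply_succAbove]

/-- A permutation of `n + 1` entries amounts to a position for `x` and a permutation of the
remaining `n` entries; placing `x` at position `j` contributes the sign `(-1) ^ j`. -/
lemma cyclicInsertion_antisymm {n : ℕ} (a x : A) (r : Fin n → A) :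
    cyclicInsertion x n (antisymm a r : Cyc k A n) = antisymm a (Fin.cons x r : Fin (n + 1) → A) := by
  -- The cycle brings position `j` to the front, and then `σ` permutes the others. The position is
  -- recovered as the preimage of `0`.
  let e (p : Fin (n + 1) × Equiv.Perm (Fin n)) : Equiv.Perm (Fin (n + 1)) :=
    Equiv.Perm.decomposeFin.symm (0, p.2) * Fin.cycleRange p.1
  have he_apply (p : Fin (n + 1) × Equiv.Perm (Fin n)) : e p p.1 = 0 := by
    simp [e]
  have he : Function.Bijective e := by
    rw [Fintype.bijective_iff_injective_and_card]
    refine ⟨?_, by simp [Fintype.card_perm, Nat.factorial_succ]⟩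
    rintro ⟨j, σ⟩ ⟨j', σ'⟩ h
    obtain rfl : j = j' := by
      have h₁ := he_apply (j', σ')
      rw [← h, ← he_apply (j, σ)] at h₁
      exact ((e (j, σ)).injective h₁).symm
    have h₂ := mul_right_cancel h
    simpa using h₂
  rw [antisymm, antisymm, ← Fintype.sum_bijective e he _ _ fun _ => rfl, Fintype.sum_prod_type,
    map_sum, Finset.sum_comm]
  refine Finset.sum_congr rfl fun σ _ => ?_
  rw [map_zsmul, cyclicInsertion_apply, Finset.smul_sum]
  refine Finset.sum_congr rfl fun j _ => ?_
  have h₁ : ((Fin.cons x r : Fin (n + 1) → A) ∘ e (j, σ)) = Fin.insertNth j x (r ∘ σ) := by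
    rw [← Fin.cons_comp_cycleRange, Equiv.Perm.coe_mul, ← Function.comp_assoc]
    congr 1
    funext i
    cases i using Fin.cases <;> simp
  have h₂ : ((e (j, σ)).sign : ℤ) = σ.sign * (-1) ^ (j : ℕ) := by
    simp [e, Equiv.Perm.decomposeFin.symm_sign]
  rw [ι_mul_insertHom_mk, Fin.insertNth_succ_cons, h₁, h₂, smul_smul]

lemma antisymm_zero (a : A) (r : Fin 0 → A) : (antisymm a r : Cyc k A 0) = ι k A 0 a := by
  rw [antisymm, Fintype.sum_unique, ι_eq_mk]
  simp only [Equiv.Perm.default_eq, Equiv.Perm.sign_one, Units.val_one, one_smul]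
  congr 1
  funext i
  obtain rfl := Fin.fin_one_eq_zero i
  simp

lemma smul_mk_cons {n : ℕ} (a b : A) (r : Fin n → A) :
    a • mk k (Fin.cons b r : Fin (n + 1) → A) = mk k (Fin.cons (a * b) r : Fin (n + 1) → A) := by
  rw [smul_mk]
  congr 1
  funext i
  cases i using Fin.cases with
  | zero => simp
  | succ i => simp

lemma smul_antisymm {n : ℕ} (a b : A) (r : Fin n → A) :
    a • (antisymm b r : Cyc k A n) = antisymm (a * b) r := by
  rw [antisymm, antisymm, Finset.smul_sum]
  refine Finset.sum_congr rfl fun σ _ => ?_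
  rw [smul_comm, smul_mk_cons]

/-- The ideal of the diagonal. -/
def diffIdeal (k A : Type u) [CommRing k] [CommRing A] [Algebra k A] : Ideal (A ⊗[k] A) :=
  Ideal.span (Set.range (diff k))

lemma diff_mem (a : A) : diff k a ∈ diffIdeal k A := Ideal.subset_span ⟨a, rfl⟩

/-- The quotient map from the bar complex to the Hochschild complex: it multiplies the last factor
into the first one. -/
abbrev close (n : ℕ) : Cyc k A (n + 1) →ₐ[A] Cyc k A n := face (Fin.last (n + 1))

lemma close_ι {n : ℕ} (j : Fin (n + 2)) (a : A) :
    close n (ι k A j a) = ι k A (if h : (j : ℕ) < n + 1 then ⟨j, h⟩ else 0) a := by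
  rw [close, face_apply, faceHom_ι]
  congr 2
  ext
  have := j.isLt
  simp only [faceIdx, Fin.val_last]
  split_ifs <;> simp <;> omega

lemma close_insertHom {n : ℕ} (v : Cyc k A n) : close n (insertHom n (n + 1) v) = v := by
  have : ((close (k := k) (A := A) n).restrictScalars k).comp (insertHom n (n + 1)) =
      AlgHom.id k _ :=
    algHom_ext fun i a => by
      rw [AlgHom.comp_apply, insertHom_ι, AlgHom.restrictScalars_apply, close_ι, AlgHom.id_apply]
      congr 2
      ext
      simp only [clip]
      split_ifs <;> simp <;> omega
  exact DFunLike.congr_fun this v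

lemma close_surjective (n : ℕ) : Function.Surjective (close (k := k) (A := A) n) :=
  fun v => ⟨_, close_insertHom v⟩

/-- Modulo the ideal of the diagonal, the last factor may be moved into the first. Hence `close`
followed by the insertion of a last factor `1` is the identity modulo that ideal, and the Hochschild
complex is the bar complex divided by it. -/
lemma close_eq_zero_iff {n : ℕ} (v : Cyc k A (n + 1)) :
    close n v = 0 ↔ v ∈ diffIdeal k A • (⊤ : Submodule (A ⊗[k] A) (Cyc k A (n + 1))) := by
  constructor
  · intro h
    rw [Ideal.smul_top_eq_map, Submodule.restrictScalars_mem]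
    let J := (diffIdeal k A).map (algebraMap (A ⊗[k] A) (Cyc k A (n + 1)))
    have key : (Ideal.Quotient.mkₐ k J).comp
        ((insertHom n (n + 1)).comp ((close (k := k) (A := A) n).restrictScalars k)) = Ideal.Quotient.mkₐ k J := by
      refine algHom_ext fun i a => ?_
      rw [AlgHom.comp_apply, AlgHom.comp_apply, AlgHom.restrictScalars_apply, close_ι, insertHom_ι]
      by_cases hi : (i : ℕ) < n + 1
      · congr 3
        ext
        simp only [hi, dite_true, if_true, clip]
        omega
      · obtain rfl : i = Fin.last (n + 1) := by ext; simp; omega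
        refine (Ideal.Quotient.eq).2 ?_
        have := Ideal.mem_map_of_mem (algebraMap (A ⊗[k] A) (Cyc k A (n + 1))) (diff_mem (k := k) a)
        convert this using 1
        change _ = ends k A (n + 1) (diff k a)
        rw [diff, map_sub, ends_tmul, ends_tmul, map_one, map_one, mul_one, one_mul]
        congr 3
        rw [dif_neg hi]
        rfl
    have := DFunLike.congr_fun key v
    rw [AlgHom.comp_apply, AlgHom.comp_apply, AlgHom.restrictScalars_apply, h, map_zero, map_zero,
      eq_comm] at this
    exact Ideal.Quotient.eq_zero_iff_mem.1 this
  · intro h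
    induction h using Submodule.smul_induction_on' with
    | smul g hg v _ =>
      have hg' : close n (ends k A (n + 1) g) = 0 := by
        induction hg using Submodule.span_induction with
        | mem g hg =>
          obtain ⟨a, rfl⟩ := hg
          rw [diff, map_sub, ends_tmul, ends_tmul, map_one, map_one, mul_one, one_mul, map_sub,
            close_ι, close_ι, sub_eq_zero]
          simp
        | zero => rw [map_zero, map_zero]
        | add x y _ _ hx hy => rw [map_add, map_add, hx, hy, add_zero]
        | smul r x _ hx => rw [smul_eq_mul, map_mul, map_mul, hx, mul_zero]
      rw [tensor_smul_def, map_mul, hg', zero_mul]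
    | add x _ y _ hx hy => rw [map_add, hx, hy, add_zero]

/-- The simplicial identities exchange the last face with the faces below it; the last Hochschild
face comes from the bar face that merges the final two factors. -/
lemma close_barD {n : ℕ} (v : Cyc k A (n + 2)) : close n (barD (n + 1) v) = b n (close (n + 1) v) := by
  rw [b_apply, barD_apply, ← Fin.sum_univ_eq_sum_range fun i => (-1 : ℤ) ^ i • barFaceHom (n + 1) i v,
    map_sum]
  refine Finset.sum_congr rfl fun i _ => ?_
  rw [map_zsmul, ← face_castSucc]
  congr 1
  exact face_face _ i.castSucc (by simp only [Fin.val_castSucc, Fin.val_last]; omega) v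

/-- Closing leaves the inner positions unchanged, and there is exactly one of them after each factor
of the closed tensor. -/
lemma close_insertion (x : A) {n : ℕ} (v : Cyc k A (n + 1)) :
    close (n + 1) (insertion x (n + 1) v) = cyclicInsertion x n (close n v) := by
  rw [insertion_apply, cyclicInsertion_apply, map_sum, ← Fin.sum_univ_eq_sum_range fun j =>
    close (n + 1) ((-1 : ℤ) ^ j • (ι k A (clip (n + 2) (j + 1)) x * insertHom (n + 1) (j + 1) v))]
  refine Finset.sum_congr rfl fun j _ => ?_
  have : ((close (n + 1)).restrictScalars k).comp (insertHom (n + 1) (j + 1)) =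
      (insertHom n (j + 1)).comp ((close (k := k) (A := A) n).restrictScalars k) :=
    algHom_ext fun i a => by
      simp only [AlgHom.comp_apply, AlgHom.restrictScalars_apply, close_ι, insertHom_ι]
      congr 2
      ext
      have := i.isLt
      have := j.isLt
      by_cases h₁ : (i : ℕ) < n + 1 <;> by_cases h₂ : (i : ℕ) ≤ j <;>
        simp only [clip, h₁, h₂, dite_true, dite_false, if_true, if_false] <;>
        split_ifs <;> simp_all <;> omega
  have h := DFunLike.congr_fun this v
  rw [map_zsmul, map_mul, close_ι]
  refine congrArg (_ • ·) (congrArg₂ (· * ·) ?_ h)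
  congr 2
  ext
  have := j.isLt
  rw [dif_pos (by simp only [clip]; omega)]
  simp only [clip, Fin.val_succ]
  omega

lemma insertList_apply_of_ne (l : List A) {n : ℕ} (h : n ≠ l.length) :
    (insertList l : BarTotal k A) n = 0 := by
  induction l generalizing n with
  | nil => exact Pi.single_eq_of_ne h _
  | cons x l ih =>
    change totalInsertion x (insertList l) n = 0
    cases n with
    | zero => rfl
    | succ n =>
      rw [totalInsertion_succ, ih (by simpa using h), map_zero]

lemma close_insertList (l : List A) {n : ℕ} (h : l.length = n) :
    close n ((insertList l : BarTotal k A) n) = antisymm 1 (fun i : Fin n => l[i]) := by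
  subst h
  induction l with
  | nil =>
    rw [antisymm_zero, map_one]
    change close 0 ((totalUnit : BarTotal k A) 0) = 1
    rw [totalUnit, Pi.single_eq_same, map_one]
  | cons x l ih =>
    change close (l.length + 1) (insertion x (l.length + 1) (insertList l l.length)) = _
    rw [close_insertion, ih, cyclicInsertion_antisymm]
    congr 1
    funext i
    refine Fin.cases ?_ (fun i => ?_) i
    · rfl
    · rfl

/-- The identity `d h = ξ - h d` applies to insertion of any element, so iterated insertions become
cycles modulo the diagonal ideal without any condition on the inserted elements. -/
lemma totalD_insertList_mem (l : List A) : totalD (insertList l : BarTotal k A) ∈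
    diffIdeal k A • (⊤ : Submodule (A ⊗[k] A) (BarTotal k A)) := by
  induction l with
  | nil =>
    change totalD totalUnit ∈ _
    rw [totalD_totalUnit]
    exact zero_mem _
  | cons x l ih =>
    change totalD (totalInsertion x (insertList l)) ∈ _
    rw [eq_sub_of_add_eq (totalD_totalInsertion x _)]
    refine sub_mem (Submodule.smul_mem_smul (diff_mem x) trivial) ?_
    have := Submodule.mem_map_of_mem (f := totalInsertion (k := k) x) ih
    rw [Submodule.map_smul''] at this
    exact Submodule.smul_mono le_rfl le_top this

lemma apply_mem_smul_top {I : Ideal (A ⊗[k] A)} {v : BarTotal k A}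
    (hv : v ∈ I • (⊤ : Submodule (A ⊗[k] A) (BarTotal k A))) (n : ℕ) :
    v n ∈ I • (⊤ : Submodule (A ⊗[k] A) (Cyc k A (n + 1))) := by
  have := Submodule.mem_map_of_mem
    (f := (LinearMap.proj n : BarTotal k A →ₗ[A ⊗[k] A] Cyc k A (n + 1))) hv
  rw [Submodule.map_smul''] at this
  exact Submodule.smul_mono le_rfl le_top this

lemma single_mem_smul_top {I : Ideal (A ⊗[k] A)} {n : ℕ} {v : Cyc k A (n + 1)}
    (hv : v ∈ I • (⊤ : Submodule (A ⊗[k] A) (Cyc k A (n + 1)))) :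
    (Pi.single n v : BarTotal k A) ∈ I • (⊤ : Submodule (A ⊗[k] A) (BarTotal k A)) := by
  have := Submodule.mem_map_of_mem
    (f := (LinearMap.single (A ⊗[k] A) (fun n => Cyc k A (n + 1)) n)) hv
  rw [Submodule.map_smul''] at this
  exact Submodule.smul_mono le_rfl le_top this

/-- Antisymmetrizations are Hochschild cycles. -/
lemma b_antisymm {n : ℕ} (a : A) (r : Fin (n + 1) → A) : b n (antisymm a r : Cyc k A (n + 1)) = 0 := by
  have h := close_insertList (k := k) (List.ofFn r) (List.length_ofFn (f := r))
  rw [← mul_one a, ← smul_antisymm, map_smul]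
  have h' : r = fun i => (List.ofFn r)[i] := by
    funext i
    rw [Fin.getElem_fin, List.getElem_ofFn]
  -- The antisymmetrization is the closing of an iterated insertion, whose boundary lies in the
  -- kernel of `close`.
  rw [h', ← h, ← close_barD, ← totalD_apply,
    (close_eq_zero_iff _).2 (apply_mem_smul_top (totalD_insertList_mem _) n), smul_zero]

end Closing

end Cyc

namespace Cyc

variable {k : Type u} [CommRing k] {A : Type u} [CommRing A] [Algebra k A]

/-! ### The diagonal ideal near the diagonal -/

section Separability

variable {ι' : Type} [Algebra (MvPolynomial ι' k) A] [IsScalarTower k (MvPolynomial ι' k) A]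

lemma diffIdeal_eq : diffIdeal k A = KaehlerDifferential.ideal k A := by
  rw [← KaehlerDifferential.span_range_eq_ideal]
  refine le_antisymm (Ideal.span_le.2 ?_) (Ideal.span_le.2 ?_)
  · rintro _ ⟨a, rfl⟩
    rw [diff, ← neg_sub]
    exact neg_mem (Ideal.subset_span ⟨a, rfl⟩)
  · rintro _ ⟨a, rfl⟩
    dsimp only
    rw [← neg_sub]
    exact neg_mem (Ideal.subset_span ⟨a, rfl⟩)

/-- Modulo the differences of the coordinates, the left and the right copy of the polynomial ring
agree on the variables, hence everywhere. -/
lemma diff_algebraMap_mem (q : MvPolynomial ι' k) :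
    diff k (algebraMap _ A q) ∈ Ideal.span (Set.range fun i : ι' => diff k (coord k A i)) := by
  let J := Ideal.span (Set.range fun i : ι' => diff k (coord k A i))
  have h : (Ideal.Quotient.mkₐ k J).comp (Algebra.TensorProduct.includeLeft.comp
      (IsScalarTower.toAlgHom k (MvPolynomial ι' k) A)) =
      (Ideal.Quotient.mkₐ k J).comp (Algebra.TensorProduct.includeRight.comp
        (IsScalarTower.toAlgHom k (MvPolynomial ι' k) A)) := by
    ext i
    exact Ideal.Quotient.eq.2 (Ideal.subset_span ⟨i, rfl⟩)
  exact Ideal.Quotient.eq.1 (DFunLike.congr_fun h q)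

/-- For an unramified algebra over a polynomial ring, the ideal of the diagonal is generated by the
differences of the coordinates near the diagonal. -/
lemma exists_separating [Algebra.EssFiniteType (MvPolynomial ι' k) A]
    [Algebra.FormallyUnramified (MvPolynomial ι' k) A] :
    ∃ f : A ⊗[k] A, f - 1 ∈ diffIdeal k A ∧
      ∀ a : A, f * diff k a ∈ Ideal.span (Set.range fun i : ι' => diff k (coord k A i)) := by
  -- The element `t` is a separability element of `A` over the polynomial ring. It multiplies to `1`
  -- and is annihilated by all differences; `f` will be a lift of it to `A ⊗[k] A`.
  obtain ⟨t, ht, ht'⟩ := (Algebra.FormallyUnramified.iff_exists_tensorProduct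
    (R := MvPolynomial ι' k) (S := A)).1 inferInstance
  let J := Ideal.span (Set.range fun i : ι' => diff k (coord k A i))
  let l : A →ₐ[MvPolynomial ι' k] (A ⊗[k] A) ⧸ J :=
    (Ideal.Quotient.mkₐ (MvPolynomial ι' k) J).comp Algebra.TensorProduct.includeLeft
  let r : A →ₐ[MvPolynomial ι' k] (A ⊗[k] A) ⧸ J :=
    { (Ideal.Quotient.mk J).comp
        (Algebra.TensorProduct.includeRight : A →ₐ[k] A ⊗[k] A).toRingHom with
      commutes' := fun q => (Ideal.Quotient.eq.2 (diff_algebraMap_mem q)).symm }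
  -- The tensor product over the polynomial ring maps to the quotient by `J`, because both copies of
  -- that ring agree there. Relations satisfied by `t` thus hold for `f` modulo `J`.
  let m : A ⊗[MvPolynomial ι' k] A →ₐ[MvPolynomial ι' k] (A ⊗[k] A) ⧸ J :=
    Algebra.TensorProduct.productMap l r
  let π : A ⊗[k] A →ₐ[k] A ⊗[MvPolynomial ι' k] A :=
    Algebra.TensorProduct.productMap
      ((Algebra.TensorProduct.includeLeft : A →ₐ[MvPolynomial ι' k] _).restrictScalars k)
      ((Algebra.TensorProduct.includeRight : A →ₐ[MvPolynomial ι' k] _).restrictScalars k)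
  have hπ (a b : A) : π (a ⊗ₜ b) = a ⊗ₜ b := by simp [π]
  have hmπ : (m.restrictScalars k).comp π = Ideal.Quotient.mkₐ k J := by
    refine Algebra.TensorProduct.ext ?_ ?_ <;> ext a <;> simp [m, π, l, r, ← map_mul]
  have hmul : (Algebra.TensorProduct.lmul' (MvPolynomial ι' k) (S := A)).toLinearMap.restrictScalars k ∘ₗ
      π.toLinearMap = (Algebra.TensorProduct.lmul' k (S := A)).toLinearMap := by
    ext a b
    simp [hπ]
  obtain ⟨f, rfl⟩ : ∃ f, π f = t := by
    clear ht ht'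
    induction t using TensorProduct.induction_on with
    | zero => exact ⟨0, map_zero _⟩
    | tmul a b => exact ⟨a ⊗ₜ b, hπ a b⟩
    | add x y hx hy =>
      obtain ⟨x, rfl⟩ := hx
      obtain ⟨y, rfl⟩ := hy
      exact ⟨x + y, map_add _ _ _⟩
  refine ⟨f, ?_, fun a => ?_⟩
  · rw [diffIdeal_eq, KaehlerDifferential.ideal, RingHom.mem_ker]
    have := LinearMap.congr_fun hmul f
    change Algebra.TensorProduct.lmul' (MvPolynomial ι' k) (π f) =
      Algebra.TensorProduct.lmul' k f at this
    rw [map_sub, map_one, sub_eq_zero, ← ht', this]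
  · rw [← Ideal.Quotient.eq_zero_iff_mem]
    have h₁ := ht a
    have h₂ := DFunLike.congr_fun hmπ (f * diff k a)
    rw [AlgHom.comp_apply] at h₂
    refine h₂.symm.trans ?_
    rw [map_mul, diff, map_sub, hπ, hπ, mul_comm, ← neg_sub, neg_mul, h₁, neg_zero, map_zero]

lemma smul_mem_sumSMul_of_separating [Fintype ι'] {f : A ⊗[k] A}
    (hf : ∀ a : A, f * diff k a ∈ Ideal.span (Set.range fun i : ι' => diff k (coord k A i)))
    {M : Type*} [AddCommGroup M] [Module (A ⊗[k] A) M] {v : M}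
    (hv : v ∈ diffIdeal k A • (⊤ : Submodule (A ⊗[k] A) M)) :
    f • v ∈ sumSMul M (fun i : ι' => diff k (coord k A i)) Finset.univ := by
  have hspan {c : A ⊗[k] A}
      (hc : c ∈ Ideal.span (Set.range fun i : ι' => diff k (coord k A i))) (w : M) :
      c • w ∈ sumSMul M (fun i : ι' => diff k (coord k A i)) Finset.univ := by
    induction hc using Submodule.span_induction with
    | mem x hx =>
      obtain ⟨l, rfl⟩ := hx
      exact smul_mem_sumSMul (Finset.mem_univ l) w
    | zero => rw [zero_smul]; exact zero_mem _
    | add x y _ _ hx hy => rw [add_smul]; exact add_mem hx hy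
    | smul r x _ hx => rw [smul_assoc]; exact Submodule.smul_mem _ _ hx
  induction hv using Submodule.smul_induction_on' with
  | smul g hg w _ =>
    rw [smul_smul]
    refine hspan ?_ w
    induction hg using Submodule.span_induction with
    | mem x hx =>
      obtain ⟨a, rfl⟩ := hx
      exact hf a
    | zero => rw [mul_zero]; exact zero_mem _
    | add x y _ _ hx hy => rw [mul_add]; exact add_mem hx hy
    | smul r x _ hx => rw [smul_eq_mul, mul_left_comm]; exact Ideal.mul_mem_left _ _ hx
  | add x _ y _ hx hy => rw [smul_add]; exact add_mem hx hy

end Separability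

/-! ### Hochschild homology in étale coordinates -/

section Generators

variable {ι' : Type} [Algebra (MvPolynomial ι' k) A] [IsScalarTower k (MvPolynomial ι' k) A]
  [Fintype ι'] [LinearOrder ι']

variable (k A) in
/-- The coordinates with indices in `s`. -/
def coords {n : ℕ} (s : Set.powersetCard ι' n) (i : Fin n) : A :=
  coord k A (Set.powersetCard.ofFinEmbEquiv.symm s i)

lemma close_insertList_coords {n : ℕ} (s : Set.powersetCard ι' n) :
    close n ((insertList ((s.1.sort (· ≤ ·)).map (coord k A)) : BarTotal k A) n) =
      antisymm 1 (coords k A s) := by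
  have hs : s.1.card = n := s.2
  rw [close_insertList _ (by simp [hs])]
  congr 1
  funext i
  rw [coords, Set.powersetCard.ofFinEmbEquiv_symm_apply]
  simp only [Fin.getElem_fin, List.getElem_map]
  exact congrArg (coord k A) (Finset.orderEmbOfFin_apply _ hs i).symm

/-- A generator with index set `t` lives in degree `t.card`, so only the sets with `n` elements
contribute. -/
lemma close_sum_elt [Module.Flat (MvPolynomial ι' k) A] (c : Finset ι' → A) (n : ℕ) :
    close n ((∑ t ∈ Finset.univ.powerset, c t • (barKoszul (k := k) (A := A) (ι' := ι')).elt t) n) =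
      ∑ s : Set.powersetCard ι' n, c s.1 • antisymm 1 (coords k A s) := by
  rw [Finset.sum_apply, map_sum, Finset.powerset_univ]
  have (t : Finset ι') (ht : t.card ≠ n) :
      close n ((c t • (barKoszul (k := k) (A := A) (ι' := ι')).elt t) n) = 0 := by
    change close n (c t • (insertList ((t.sort (· ≤ ·)).map (coord k A)) : BarTotal k A) n) = 0
    rw [insertList_apply_of_ne _ (by simpa using ht.symm), smul_zero, map_zero]
  rw [← Finset.sum_subset (Finset.subset_univ (Finset.univ.powersetCard n)) fun t _ ht =>
    this t fun h => ht (Finset.mem_powersetCard.2 ⟨Finset.subset_univ _, h⟩)]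
  refine Finset.sum_bij' (fun t ht => (⟨t, (Finset.mem_powersetCard.1 ht).2⟩ : Set.powersetCard ι' n))
    (fun s _ => s.1) (fun _ _ => Finset.mem_univ _)
    (fun s _ => Finset.mem_powersetCard.2 ⟨Finset.subset_univ _, s.2⟩) (fun _ _ => rfl)
    (fun _ _ => rfl) fun t ht => ?_
  rw [← close_insertList_coords]
  exact map_smul (close n) (c t) _

variable [Module.Flat (MvPolynomial ι' k) A] [Algebra.EssFiniteType (MvPolynomial ι' k) A]
  [Algebra.FormallyUnramified (MvPolynomial ι' k) A]

lemma close_sub_sub {c z w : BarTotal k A} {n : ℕ} (h : z - c - totalD w ∈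
    diffIdeal k A • (⊤ : Submodule (A ⊗[k] A) (BarTotal k A))) :
    close n (z n) = close n (c n) + b n (close (n + 1) (w (n + 1))) := by
  have := (close_eq_zero_iff _).2 (apply_mem_smul_top h n)
  rw [Pi.sub_apply, Pi.sub_apply, map_sub, map_sub, totalD_apply, close_barD, sub_sub,
    sub_eq_zero] at this
  exact this

/-- Hochschild cycles of an algebra with étale coordinates are, up to boundaries, linear combinations
of the antisymmetrizations of the coordinates. -/
lemma exists_eq_sum_antisymm {n : ℕ} (z : Cyc k A n)
    (hz : ∀ m (h : n = m + 1), b m (h ▸ z) = 0) :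
    ∃ (c : Set.powersetCard ι' n → A) (w : Cyc k A (n + 1)),
      z = ∑ s, c s • antisymm 1 (coords k A s) + b n w := by
  obtain ⟨f, hf, hf'⟩ := exists_separating (k := k) (A := A) (ι' := ι')
  obtain ⟨z, rfl⟩ := close_surjective n z
  -- A lift of a Hochschild cycle to the bar complex is a cycle only modulo the diagonal ideal,
  -- which is all that is needed. It is placed in degree `n` of the total complex, with zeros
  -- elsewhere.
  obtain ⟨c, w, h⟩ := (barKoszul (k := k) (A := A) (ι' := ι')).exists_of_d_mem_ideal
    (s := Finset.univ) hf (fun v hv => smul_mem_sumSMul_of_separating hf' hv)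
    (fun i => diff_mem _) (Pi.single n z) (by
      change totalD _ ∈ _
      cases n with
      | zero =>
        have : totalD (Pi.single 0 z : BarTotal k A) = 0 := by
          funext m
          rw [totalD_apply, Pi.single_eq_of_ne (by omega), map_zero]; rfl
        rw [this]
        exact zero_mem _
      | succ n =>
        have : totalD (Pi.single (n + 1) z : BarTotal k A) = Pi.single n (barD (n + 1) z) := by
          funext m
          rw [totalD_apply]
          by_cases h : m = n
          · subst h; rw [Pi.single_eq_same, Pi.single_eq_same]
          · rw [Pi.single_eq_of_ne (by omega), Pi.single_eq_of_ne h, map_zero]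
        rw [this]
        refine single_mem_smul_top ((close_eq_zero_iff _).1 ?_)
        rw [close_barD]
        exact hz n rfl)
  have := close_sub_sub (n := n) h
  rw [Pi.single_eq_same, close_sum_elt] at this
  exact ⟨fun s => c s.1, _, this⟩

lemma eq_zero_of_sum_antisymm {n : ℕ} (c : Set.powersetCard ι' n → A) (w : Cyc k A (n + 1))
    (h : ∑ s, c s • antisymm 1 (coords k A s) = b n w) : c = 0 := by
  classical
  obtain ⟨f, hf, hf'⟩ := exists_separating (k := k) (A := A) (ι' := ι')
  obtain ⟨w, rfl⟩ := close_surjective (n + 1) w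
  -- With zero coefficients off cardinality `n`, the relation in the total complex is concentrated
  -- in degree `n`, where it is the given one.
  let c' : Finset ι' → A := fun t => if ht : t.card = n then c ⟨t, ht⟩ else 0
  have hc' (s : Set.powersetCard ι' n) : c' s.1 = c s := dif_pos s.2
  have hmem : (∑ t ∈ Finset.univ.powerset, c' t • (barKoszul (k := k) (A := A) (ι' := ι')).elt t) -
      (barKoszul (k := k) (A := A) (ι' := ι')).d (Pi.single (n + 1) w) ∈
      diffIdeal k A • (⊤ : Submodule (A ⊗[k] A) (BarTotal k A)) := by
    have : ∀ v : BarTotal k A, (∀ m, m ≠ n → v m = 0) → close n (v n) = 0 →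
        v ∈ diffIdeal k A • (⊤ : Submodule (A ⊗[k] A) (BarTotal k A)) := by
      intro v hv hv'
      have : v = Pi.single n (v n) := by
        funext m
        by_cases h : m = n
        · subst h; rw [Pi.single_eq_same]
        · rw [Pi.single_eq_of_ne h, hv m h]
      rw [this]
      exact single_mem_smul_top ((close_eq_zero_iff _).1 hv')
    refine this _ (fun m hm => ?_) ?_
    · have h₁ : (barKoszul (k := k) (A := A) (ι' := ι')).d (Pi.single (n + 1) w) m = 0 := by
        change barD (m + 1) ((Pi.single (n + 1) w : BarTotal k A) (m + 1)) = 0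
        rw [Pi.single_eq_of_ne (by omega), map_zero]
      rw [Pi.sub_apply, h₁, sub_zero, Finset.sum_apply]
      refine Finset.sum_eq_zero fun t _ => ?_
      change c' t • (insertList ((t.sort (· ≤ ·)).map (coord k A)) : BarTotal k A) m = 0
      by_cases ht : t.card = n
      · rw [insertList_apply_of_ne _ (by simpa [ht] using hm), smul_zero]
      · simp only [c', dif_neg ht, zero_smul]
    · rw [Pi.sub_apply, map_sub, close_sum_elt]
      change _ - close n (barD (n + 1) ((Pi.single (n + 1) w : BarTotal k A) (n + 1))) = 0
      rw [Pi.single_eq_same, close_barD, ← h, sub_eq_zero]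
      exact Finset.sum_congr rfl fun s _ => by rw [hc']
  have := (barKoszul (k := k) (A := A) (ι' := ι')).eq_zero_of_sum_sub_d_mem_ideal
    (s := Finset.univ) hf (fun v hv => smul_mem_sumSMul_of_separating hf' hv) (diff k) rfl
    totalInsertion totalD_totalInsertion c' _ hmem
  funext s
  rw [← hc']
  exact this _ (Finset.mem_powerset.2 (Finset.subset_univ _))

end Generators

end Cyc

/-! ### Multilinear and alternating maps tested on a spanning set -/

section MultilinearExtension

variable {R ι M N : Type*} [CommRing R] [Finite ι] [AddCommGroup M] [Module R M]
  [AddCommGroup N] [Module R N] {S : Set M}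

lemma multilinearMap_eq_zero_of_span (hS : Submodule.span R S = ⊤)
    (f : MultilinearMap R (fun _ : ι => M) N) (h : ∀ v : ι → M, (∀ i, v i ∈ S) → f v = 0) : f = 0 := by
  classical
  have := Fintype.ofFinite ι
  have key (s : Finset ι) : ∀ v : ι → M, (∀ i, i ∉ s → v i ∈ S) → f v = 0 := by
    induction s using Finset.induction_on with
    | empty => exact fun v hv => h v fun i => hv i (by simp)
    | insert i s _ ih =>
      intro v hv
      have hi : v i ∈ Submodule.span R S := by rw [hS]; trivial
      rw [← Function.update_eq_self i v]
      generalize v i = x at hi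
      induction hi using Submodule.span_induction with
      | mem x hx =>
        refine ih _ fun j hj => ?_
        by_cases hji : j = i
        · subst hji; rwa [Function.update_self]
        · rw [Function.update_of_ne hji]
          exact hv j (by simp [hji, hj])
      | zero => rw [MultilinearMap.map_update_zero]
      | add x y _ _ hx hy => rw [MultilinearMap.map_update_add, hx, hy, add_zero]
      | smul a x _ hx => rw [MultilinearMap.map_update_smul, hx, smul_zero]
  exact MultilinearMap.ext fun v => key Finset.univ v fun i hi => (hi (Finset.mem_univ i)).elim

/-- Vanishing on repeated spanning vectors is not enough: a repeated sum `x + y` leaves two cross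
terms. They cancel by the separately required antisymmetry. -/
lemma multilinearMap_alternating_of_span (hS : Submodule.span R S = ⊤)
    (f : MultilinearMap R (fun _ : ι => M) N)
    (h : ∀ v : ι → M, (∀ i, v i ∈ S) → ∀ i j, v i = v j → i ≠ j → f v = 0)
    [DecidableEq ι]
    (h' : ∀ v : ι → M, (∀ i, v i ∈ S) → ∀ i j, i ≠ j → f v + f (v ∘ Equiv.swap i j) = 0)
    (v : ι → M) (i j : ι) (hv : v i = v j) (hij : i ≠ j) : f v = 0 := by
  have swap (v : ι → M) : f v + f (v ∘ Equiv.swap i j) = 0 :=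
    MultilinearMap.congr_fun (multilinearMap_eq_zero_of_span hS
      (f + f.domDomCongr (Equiv.swap i j)) fun v hv => h' v hv i j hij) v
  have hv' : v = Function.update (Function.update v i (v i)) j (v i) := by
    rw [Function.update_eq_self, hv, Function.update_eq_self]
  have hi : v i ∈ Submodule.span R S := by rw [hS]; trivial
  rw [hv']
  generalize v i = x at hi
  induction hi using Submodule.span_induction with
  | mem x hx =>
    -- With the two equal slots frozen at a spanning vector, the map is multilinear in the remaining
    -- slots and can be tested on the spanning set.
    let P (l : ι) : Prop := l ≠ i ∧ l ≠ j
    have h₀ : f.domDomRestrict P (fun _ => x) = 0 := by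
      refine multilinearMap_eq_zero_of_span hS _ fun w hw => ?_
      rw [MultilinearMap.domDomRestrict_apply]
      refine h _ (fun l => ?_) i j ?_ hij
      · split_ifs with hl
        · exact hw _
        · exact hx
      · simp [P]
    have := MultilinearMap.congr_fun h₀ fun l => v l
    rw [MultilinearMap.domDomRestrict_apply] at this
    refine Eq.trans (congrArg f ?_) this
    funext l
    by_cases hlj : l = j
    · subst hlj; simp [P]
    · by_cases hli : l = i
      · subst hli; simp [P, hlj]
      · simp [P, hlj, hli]
  | zero => exact MultilinearMap.map_update_zero f _ _
  | add x y _ _ hx hy =>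
    have hsw := swap (Function.update (Function.update v i x) j y)
    have e : Function.update (Function.update v i x) j y ∘ Equiv.swap i j =
        Function.update (Function.update v i y) j x := by
      funext l
      by_cases hlj : l = j
      · subst hlj; simp [hij]
      · by_cases hli : l = i
        · subst hli; simp [hlj]
        · simp [hlj, hli, Equiv.swap_apply_of_ne_of_ne]
    rw [e] at hsw
    have comm (a b : M) : Function.update (Function.update v i a) j b =
        Function.update (Function.update v j b) i a := Function.update_comm hij a b v
    rw [MultilinearMap.map_update_add, comm, comm, MultilinearMap.map_update_add,
      MultilinearMap.map_update_add, ← comm, ← comm, ← comm, ← comm, hx, hy, zero_add, add_zero,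
      add_comm, hsw]
  | smul a x _ hx =>
    rw [MultilinearMap.map_update_smul, Function.update_comm hij, MultilinearMap.map_update_smul,
      Function.update_comm hij.symm, hx, smul_zero, smul_zero]

end MultilinearExtension

/-! ### Maps on differential forms from multiderivations -/

section Multiderivations

variable {k A M : Type*} [CommRing k] [CommRing A] [Algebra k A] [AddCommGroup M] [Module A M]
  [Module k M] [IsScalarTower k A M]

/-- A multilinear map which is a derivation in each variable extends to differentials. -/
lemma exists_multilinearMap_of_leibniz {n : ℕ} (F : MultilinearMap k (fun _ : Fin n => A) M)
    (hF : ∀ (r : Fin n → A) (i : Fin n) (x y : A), F (Function.update r i (x * y)) =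
      x • F (Function.update r i y) + y • F (Function.update r i x)) :
    ∃ L : MultilinearMap A (fun _ : Fin n => Ω[A⁄k]) M,
      ∀ r : Fin n → A, L (fun i => KaehlerDifferential.D k A (r i)) = F r := by
  induction n with
  | zero => exact ⟨MultilinearMap.constOfIsEmpty A _ (F default), fun r => by
      rw [MultilinearMap.constOfIsEmpty_apply, Subsingleton.elim default r]; rfl⟩
  | succ n ih =>
    -- For a fixed first variable the map extends by induction. The extension is a derivation in
    -- that variable and factors through differentials.
    have hF' (x : A) := ih (F.curryLeft x) fun r i y z => by
      simp only [MultilinearMap.curryLeft_apply, Fin.cons_update, hF]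
    choose L hL using hF'
    have ext {f g : MultilinearMap A (fun _ : Fin n => Ω[A⁄k]) M}
        (h : ∀ r : Fin n → A, f (fun i => KaehlerDifferential.D k A (r i)) =
          g (fun i => KaehlerDifferential.D k A (r i))) : f = g := by
      refine sub_eq_zero.1 (multilinearMap_eq_zero_of_span
        (KaehlerDifferential.span_range_derivation k A) _ fun v hv => ?_)
      choose r hr using hv
      obtain rfl := funext hr
      exact sub_eq_zero.2 (h r)
    have : IsScalarTower k A (MultilinearMap A (fun _ : Fin n => Ω[A⁄k]) M) :=
      ⟨fun _ _ _ => MultilinearMap.ext fun _ => smul_assoc _ _ _⟩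
    let D : Derivation k A (MultilinearMap A (fun _ : Fin n => Ω[A⁄k]) M) :=
      Derivation.mk'
        { toFun := L
          map_add' := fun x y => ext fun r => by
            rw [add_apply, hL, hL, hL, map_add, add_apply]
          map_smul' := fun c x => ext fun r => by
            rw [RingHom.id_apply, smul_apply, hL, hL, map_smul,
              smul_apply] }
        fun x y => ext fun r => by
          change L (x * y) _ = x • L y _ + y • L x _
          rw [hL, hL, hL]
          simpa only [MultilinearMap.curryLeft_apply, Fin.update_cons_zero] using
            hF (Fin.cons 0 r) 0 x y
    refine ⟨D.liftKaehlerDifferential.uncurryLeft, fun r => ?_⟩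
    rw [LinearMap.uncurryLeft_apply, Derivation.liftKaehlerDifferential_comp_D]
    refine (hL (r 0) (Fin.tail r)).trans ?_
    rw [MultilinearMap.curryLeft_apply, Fin.cons_self_tail]

/-- An alternating map which is a derivation in each variable defines a linear map on forms. -/
lemma exists_linearMap_of_leibniz {n : ℕ} (F : A [⋀^Fin n]→ₗ[k] M)
    (hF : ∀ (r : Fin n → A) (i : Fin n) (x y : A), F (Function.update r i (x * y)) =
      x • F (Function.update r i y) + y • F (Function.update r i x)) :
    ∃ L : ⋀[A]^n Ω[A⁄k] →ₗ[A] M,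
      ∀ r : Fin n → A, L (exteriorPower.ιMulti A n fun i => KaehlerDifferential.D k A (r i)) = F r := by
  obtain ⟨L, hL⟩ := exists_multilinearMap_of_leibniz F.toMultilinearMap hF
  let L' : Ω[A⁄k] [⋀^Fin n]→ₗ[A] M :=
    { L with
      map_eq_zero_of_eq' := multilinearMap_alternating_of_span
        (KaehlerDifferential.span_range_derivation k A) L (fun v hv i j hij hne => by
          choose r hr using hv
          obtain rfl := funext hr
          -- Equal differentials need not come from equal elements. Replacing `r j` by `r i` leaves
          -- the differentials unchanged and makes the arguments of `F` repeat.
          have e : (fun l => KaehlerDifferential.D k A (r l)) =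
              fun l => KaehlerDifferential.D k A (Function.update r j (r i) l) := by
            funext l
            by_cases hl : l = j
            · subst hl; rw [Function.update_self]; exact hij.symm
            · rw [Function.update_of_ne hl]
          rw [e, hL]
          exact F.map_eq_zero_of_eq _ (by simp [hne]) hne) (fun v hv i j hij => by
          choose r hr using hv
          obtain rfl := funext hr
          have := hL (r ∘ Equiv.swap i j)
          refine (congrArg₂ (· + ·) (hL r) this).trans ?_
          exact F.map_add_swap r hij) }
  refine ⟨exteriorPower.alternatingMapLinearEquiv L', fun r => ?_⟩
  rw [exteriorPower.alternatingMapLinearEquiv_apply_ιMulti]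
  exact hL r

end Multiderivations

/-! ### Comparison of antisymmetrization with the projection to forms -/

section FormsAndChains

variable {k : Type u} [CommRing k] {A : Type u} [CommRing A] [Algebra k A]

/-- Reordering the wedge produces the sign a second time, so each of the `n!` permutations
contributes the same form. -/
lemma proj_antisymm {n : ℕ} (a : A) (r : Fin n → A) :
    proj k A n (Cyc.antisymm a r) = n.factorial • dForm a r := by
  have (σ : Equiv.Perm (Fin n)) : (σ.sign : ℤ) • proj k A n (Cyc.mk k (Fin.cons a (r ∘ σ))) =
      dForm a r := by
    rw [proj_mk, Fin.cons_zero, Fin.tail_cons, dForm, dForm]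
    have := (exteriorPower.ιMulti A n (M := Ω[A⁄k])).map_perm
      (fun i => KaehlerDifferential.D k A (r i)) σ
    rw [smul_comm]
    congr 1
    refine (congrArg ((σ.sign : ℤ) • ·) this).trans ?_
    rw [Units.smul_def, smul_smul, ← Units.val_mul, Int.units_mul_self, Units.val_one, one_smul]
  rw [Cyc.antisymm, map_sum]
  simp only [map_zsmul, this]
  rw [Finset.sum_const, Finset.card_univ, Fintype.card_perm, Fintype.card_fin]

variable (k A) in
/-- Pure tensors as a multilinear map. -/
def mkMultilinear (n : ℕ) : MultilinearMap k (fun _ : Fin (n + 1) => A) (Cyc k A n) :=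
  PiTensorProduct.tprod k

variable (k A) in
/-- Antisymmetrization as an alternating map. -/
def antisymmAlternating (n : ℕ) : A [⋀^Fin n]→ₗ[k] Cyc k A n :=
  MultilinearMap.alternatization ((mkMultilinear k A n).curryLeft 1)

lemma antisymmAlternating_apply {n : ℕ} (r : Fin n → A) :
    antisymmAlternating k A n r = Cyc.antisymm 1 r := by
  rw [antisymmAlternating, MultilinearMap.alternatization_apply, Cyc.antisymm]
  exact Finset.sum_congr rfl fun σ _ => rfl

section Coordinates

variable {ι' : Type} [Algebra (MvPolynomial ι' k) A] [IsScalarTower k (MvPolynomial ι' k) A]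

/-- The relative differentials over the polynomial ring vanish, so by the first exact sequence those
of the polynomial ring generate. -/
lemma span_D_coord [Algebra.FormallyUnramified (MvPolynomial ι' k) A] :
    Submodule.span A (Set.range fun i : ι' => KaehlerDifferential.D k A (Cyc.coord k A i)) = ⊤ := by
  have h₁ : Function.Surjective (KaehlerDifferential.mapBaseChange k (MvPolynomial ι' k) A) := by
    intro x
    exact (KaehlerDifferential.exact_mapBaseChange_map k (MvPolynomial ι' k) A x).1
      (Subsingleton.elim _ _)
  rw [eq_top_iff]
  rintro x -
  obtain ⟨x, rfl⟩ := h₁ x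
  induction x using TensorProduct.induction_on with
  | zero => rw [map_zero]; exact zero_mem _
  | add x y hx hy => rw [map_add]; exact add_mem hx hy
  | tmul a x =>
    rw [KaehlerDifferential.mapBaseChange_tmul]
    refine Submodule.smul_mem _ _ ?_
    have hx : x ∈ Submodule.span (MvPolynomial ι' k)
        (Set.range (KaehlerDifferential.mvPolynomialBasis k ι')) := by
      rw [Module.Basis.span_eq]; trivial
    induction hx using Submodule.span_induction with
    | mem x hx =>
      obtain ⟨i, rfl⟩ := hx
      refine Submodule.subset_span ⟨i, ?_⟩
      rw [KaehlerDifferential.mvPolynomialBasis_apply, KaehlerDifferential.map_D]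
      rfl
    | zero => rw [map_zero]; exact zero_mem _
    | add x y _ _ hx hy => rw [map_add]; exact add_mem hx hy
    | smul r x _ hx =>
      rw [map_smul, algebra_compatible_smul A r]
      exact Submodule.smul_mem _ _ hx

lemma span_dForm_coords [LinearOrder ι'] [Algebra.FormallyUnramified (MvPolynomial ι' k) A] (n : ℕ) :
    Submodule.span A (Set.range fun s : Set.powersetCard ι' n =>
      (dForm 1 (Cyc.coords k A s) : ⋀[A]^n Ω[A⁄k])) = ⊤ := by
  rw [← exteriorPower.ιMulti_family_span_of_span A (n := n) (span_D_coord (k := k) (A := A) (ι' := ι'))]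
  congr 2
  funext s
  rw [dForm, one_smul]
  rfl

end Coordinates

section Polynomial

variable {ι' : Type} [LinearOrder ι']

lemma linearIndependent_dForm_coords (n : ℕ) :
    LinearIndependent (MvPolynomial ι' k) fun s : Set.powersetCard ι' n =>
      (dForm 1 (Cyc.coords k (MvPolynomial ι' k) s) :
        ⋀[MvPolynomial ι' k]^n Ω[MvPolynomial ι' k⁄k]) := by
  have e : (fun s : Set.powersetCard ι' n => (dForm 1 (Cyc.coords k (MvPolynomial ι' k) s) :
      ⋀[MvPolynomial ι' k]^n Ω[MvPolynomial ι' k⁄k])) =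
      exteriorPower.ιMulti_family (MvPolynomial ι' k) n (KaehlerDifferential.mvPolynomialBasis k ι') := by
    funext s
    rw [dForm, one_smul, exteriorPower.ιMulti_family]
    congr 1
    funext i
    exact (KaehlerDifferential.mvPolynomialBasis_apply k ι' _).symm
  rw [e]
  exact exteriorPower.ιMulti_family_linearIndependent_ofBasis _ n _

/-- Over a torsion free base, forms detect the Hochschild homology of a polynomial ring. -/
lemma exists_eq_b_of_proj_eq_zero [Fintype ι'] [IsAddTorsionFree k] {n : ℕ}
    (z : Cyc k (MvPolynomial ι' k) (n + 1)) (hz : Cyc.b n z = 0)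
    (hz' : proj k (MvPolynomial ι' k) (n + 1) z = 0) : ∃ w, z = Cyc.b (n + 1) w := by
  obtain ⟨c, w, rfl⟩ := Cyc.exists_eq_sum_antisymm (ι' := ι') z fun m h => by cases h; exact hz
  refine ⟨w, ?_⟩
  rw [map_add, proj_b, add_zero, map_sum] at hz'
  simp only [map_smul, proj_antisymm] at hz'
  -- Projection sends the cycle to the combination of basis forms with coefficients `(n + 1)! • c
  -- s`. They vanish, and since `k` has no torsion, so do the `c s`.
  have h := Fintype.linearIndependent_iff.1 (linearIndependent_dForm_coords (k := k) (ι' := ι') (n + 1))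
    (fun s => (n + 1).factorial • c s) (by
      rw [← hz']
      exact Finset.sum_congr rfl fun s _ => by rw [smul_assoc, smul_comm])
  rw [Finset.sum_eq_zero, zero_add]
  intro s _
  have hs : c s = 0 := by
    ext m
    have := congrArg (MvPolynomial.coeff m) (h s)
    rw [MvPolynomial.coeff_smul, MvPolynomial.coeff_zero] at this
    exact (smul_eq_zero_iff_right (Nat.factorial_ne_zero _)).1 this
  rw [hs, zero_smul]

end Polynomial

/-! ### Change of base ring and the Leibniz rule up to boundaries -/

section BaseChange

namespace Cyc

/-- Both maps agree on scalars, which lie in the first factor, so they become algebra maps for the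
structure on `B` defined by `f`. -/
lemma ringHom_ext {B : Type u} [CommRing B] {n : ℕ} {f g : Cyc k A n →+* B}
    (h : ∀ i a, f (ι k A i a) = g (ι k A i a)) : f = g := by
  let := (f.comp (algebraMap k (Cyc k A n))).toAlgebra
  have hg (x : k) : g (algebraMap k _ x) = algebraMap k B x := by
    rw [← (ι k A (0 : Fin (n + 1))).commutes, ← h, (ι k A (0 : Fin (n + 1))).commutes]
    rfl
  have : (⟨f, fun _ => rfl⟩ : Cyc k A n →ₐ[k] B) = ⟨g, hg⟩ := algHom_ext h
  exact congrArg (AlgHom.toRingHom) this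

variable {R Q : Type u} [CommRing R] [CommRing Q] [Algebra R Q] (ρ : R →+* k) (φ : Q →+* A)
  (hφ : ∀ r, φ (algebraMap R Q r) = algebraMap k A (ρ r))

/-- Functoriality of the Hochschild complex in the base ring. -/
def baseMap (n : ℕ) : Cyc R Q n →+* Cyc k A n :=
  letI := ((algebraMap k (Cyc k A n)).comp ρ).toAlgebra
  (lift fun i => (⟨(ι k A i).toRingHom.comp φ, fun r =>
    (congrArg (ι k A i) (hφ r)).trans ((ι k A i).commutes _)⟩ : Q →ₐ[R] Cyc k A n)).toRingHom

lemma baseMap_ι {n : ℕ} (i : Fin (n + 1)) (a : Q) :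
    baseMap ρ φ hφ n (ι R Q i a) = ι k A i (φ a) :=
  letI := ((algebraMap k (Cyc k A n)).comp ρ).toAlgebra
  lift_ι _ _ _

lemma baseMap_mk {n : ℕ} (a : Fin (n + 1) → Q) :
    baseMap ρ φ hφ n (mk R a) = mk k (fun i => φ (a i)) := by
  rw [mk_eq_prod, mk_eq_prod, map_prod]
  simp only [baseMap_ι]

lemma baseMap_b {n : ℕ} (v : Cyc R Q (n + 1)) :
    baseMap ρ φ hφ n (b n v) = b n (baseMap ρ φ hφ (n + 1) v) := by
  simp only [b_apply, map_sum, map_zsmul]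
  refine Finset.sum_congr rfl fun i _ => congrArg (_ • ·) ?_
  have : (baseMap ρ φ hφ n).comp (faceHom i).toRingHom =
      (faceHom i).toRingHom.comp (baseMap ρ φ hφ (n + 1)) := ringHom_ext fun j a => by
    change baseMap ρ φ hφ n (faceHom i _) = faceHom i (baseMap ρ φ hφ (n + 1) _)
    rw [faceHom_ι, baseMap_ι, baseMap_ι, faceHom_ι]
  exact DFunLike.congr_fun this v

lemma baseMap_antisymm {n : ℕ} (a : Q) (r : Fin n → Q) :
    baseMap ρ φ hφ n (antisymm a r) = antisymm (φ a) (fun i => φ (r i)) := by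
  simp only [antisymm, map_sum, map_zsmul, baseMap_mk]
  refine Finset.sum_congr rfl fun σ _ => ?_
  congr 2
  funext i
  cases i using Fin.cases <;> rfl

lemma baseMap_smul {n : ℕ} (a : Q) (v : Cyc R Q n) :
    baseMap ρ φ hφ n (a • v) = φ a • baseMap ρ φ hφ n v := by
  rw [smul_eq, smul_eq, map_mul, baseMap_ι]

/-- The antisymmetrization is a derivation in each variable, up to boundaries. -/
lemma antisymm_leibniz {n : ℕ} (r : Fin n → A) (i : Fin n) (x y : A) : ∃ w : Cyc k A (n + 1),
    antisymm 1 (Function.update r i (x * y)) - (x • antisymm 1 (Function.update r i y) +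
      y • antisymm 1 (Function.update r i x)) = b n w := by
  obtain _ | n := n
  · exact i.elim0
  -- The universal case: variables for `x`, `y` and the `n + 1` entries of `r` over the integers,
  -- lifted to the universe of `k`.
  let Q := MvPolynomial (Fin (n + 3)) (ULift.{u} ℤ)
  let ρ : ULift.{u} ℤ →+* k := (Int.castRingHom k).comp ULift.ringEquiv.toRingHom
  let φ : Q →+* A := MvPolynomial.eval₂Hom ((algebraMap k A).comp ρ) (Fin.cons x (Fin.cons y r))
  have hφ (c : ULift.{u} ℤ) : φ (algebraMap _ Q c) = algebraMap k A (ρ c) :=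
    MvPolynomial.eval₂Hom_C _ _ _
  let x₀ : Q := MvPolynomial.X 0
  let y₀ : Q := MvPolynomial.X 1
  let r₀ (i : Fin (n + 1)) : Q := MvPolynomial.X i.succ.succ
  have hx : φ x₀ = x := MvPolynomial.eval₂Hom_X' _ _ _
  have hy : φ y₀ = y := MvPolynomial.eval₂Hom_X' _ _ _
  have hr (i : Fin (n + 1)) : φ (r₀ i) = r i := MvPolynomial.eval₂Hom_X' _ _ _
  have : IsAddTorsionFree (ULift.{u} ℤ) := ⟨fun m hm a b h => ULift.ext _ _ (by
    simpa [hm] using congrArg ULift.down h)⟩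
  obtain ⟨w, hw⟩ := exists_eq_b_of_proj_eq_zero (k := ULift.{u} ℤ)
    (antisymm 1 (Function.update r₀ i (x₀ * y₀)) - (x₀ • antisymm 1 (Function.update r₀ i y₀) +
      y₀ • antisymm 1 (Function.update r₀ i x₀)))
    (by simp only [map_sub, map_add, map_smul, b_antisymm, smul_zero, add_zero, sub_zero])
    -- The projection kills this cycle, because forms satisfy the Leibniz rule exactly; hence it is
    -- a boundary over the integers.
    (by
      simp only [map_sub, map_add, map_smul, proj_antisymm]
      rw [dForm_leibniz, one_mul, one_mul, smul_comm, smul_comm y₀, ← smul_add, sub_eq_zero]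
      simp only [dForm, one_smul])
  refine ⟨baseMap ρ φ hφ _ w, ?_⟩
  rw [← baseMap_b, ← hw]
  have hu (z : Q) : (fun j => φ (Function.update r₀ i z j)) = Function.update r i (φ z) := by
    funext j
    by_cases h : j = i
    · subst h; rw [Function.update_self, Function.update_self]
    · rw [Function.update_of_ne h, Function.update_of_ne h, hr]
  rw [map_sub, map_add, baseMap_smul, baseMap_smul, baseMap_antisymm, baseMap_antisymm,
    baseMap_antisymm, hu, hu, hu, map_mul, map_one, hx, hy]

end Cyc

end BaseChange

end FormsAndChains

/-! ### Antisymmetrization into chains modulo boundaries -/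

section Opcycles

variable {k : Type u} [CommRing k] {A : Type u} [CommRing A] [Algebra k A]

variable (k A) in
/-- Hochschild chains modulo boundaries. -/
abbrev Opcycles (n : ℕ) : Type u :=
  Cyc k A n ⧸ LinearMap.range (Cyc.b (k := k) (A := A) n)

lemma mk_eq_zero_iff {n : ℕ} (z : Cyc k A n) :
    (Submodule.Quotient.mk z : Opcycles k A n) = 0 ↔ ∃ w, z = Cyc.b n w := by
  rw [Submodule.Quotient.mk_eq_zero, LinearMap.mem_range]
  exact exists_congr fun w => eq_comm

lemma exists_formsToOpcycles (n : ℕ) : ∃ L : ⋀[A]^n Ω[A⁄k] →ₗ[A] Opcycles k A n,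
    ∀ (a : A) (r : Fin n → A), L (dForm a r) = Submodule.Quotient.mk (Cyc.antisymm a r) := by
  let q : Cyc k A n →ₗ[A] Opcycles k A n := Submodule.mkQ _
  obtain ⟨L, hL⟩ := exists_linearMap_of_leibniz
    ((q.restrictScalars k).compAlternatingMap (antisymmAlternating k A n)) fun r i x y => by
      obtain ⟨w, hw⟩ := Cyc.antisymm_leibniz (k := k) r i x y
      change q (antisymmAlternating k A n _) = x • q (antisymmAlternating k A n _) +
        y • q (antisymmAlternating k A n _)
      simp only [antisymmAlternating_apply]
      rw [← sub_eq_zero, ← map_smul, ← map_smul, ← map_add, ← map_sub]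
      exact (mk_eq_zero_iff _).2 ⟨w, hw⟩
  refine ⟨L, fun a r => ?_⟩
  rw [dForm, map_smul, hL]
  change a • q (antisymmAlternating k A n r) = q _
  rw [antisymmAlternating_apply, ← map_smul, Cyc.smul_antisymm, mul_one]

variable (k A) in
/-- The map from forms to Hochschild chains modulo boundaries given by antisymmetrization. -/
def formsToOpcycles (n : ℕ) : ⋀[A]^n Ω[A⁄k] →ₗ[A] Opcycles k A n :=
  (exists_formsToOpcycles n).choose

lemma formsToOpcycles_dForm {n : ℕ} (a : A) (r : Fin n → A) :
    formsToOpcycles k A n (dForm a r) = Submodule.Quotient.mk (Cyc.antisymm a r) :=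
  (exists_formsToOpcycles n).choose_spec a r

/-- The coordinate forms generate all forms, and their antisymmetrizations are independent modulo
boundaries. In particular no basis of forms on `A` is needed in advance. -/
lemma formsToOpcycles_injective (ι' : Type) [Algebra (MvPolynomial ι' k) A] [IsScalarTower k (MvPolynomial ι' k) A]
    [Fintype ι'] [LinearOrder ι'] [Module.Flat (MvPolynomial ι' k) A]
    [Algebra.EssFiniteType (MvPolynomial ι' k) A] [Algebra.FormallyUnramified (MvPolynomial ι' k) A] (n : ℕ) : Function.Injective (formsToOpcycles k A n) := by
  rw [injective_iff_map_eq_zero]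
  intro z hz
  have hz' : z ∈ Submodule.span A (Set.range fun s : Set.powersetCard ι' n =>
      (dForm 1 (Cyc.coords k A s) : ⋀[A]^n Ω[A⁄k])) := by
    rw [span_dForm_coords (ι' := ι')]; trivial
  obtain ⟨c, rfl⟩ := (Submodule.mem_span_range_iff_exists_fun A).1 hz'
  simp only [map_sum, map_smul, formsToOpcycles_dForm] at hz
  have : (Submodule.Quotient.mk (∑ s, c s • Cyc.antisymm 1 (Cyc.coords k A s)) : Opcycles k A n) = 0 := by
    rw [← hz]
    exact (map_sum (Submodule.mkQ (LinearMap.range (Cyc.b (k := k) (A := A) n))) _ _)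
  obtain ⟨w, hw⟩ := (mk_eq_zero_iff _).1 this
  rw [Cyc.eq_zero_of_sum_antisymm c w hw]
  simp

lemma mk_mem_range_formsToOpcycles (ι' : Type) [Algebra (MvPolynomial ι' k) A] [IsScalarTower k (MvPolynomial ι' k) A]
    [Fintype ι'] [LinearOrder ι'] [Module.Flat (MvPolynomial ι' k) A]
    [Algebra.EssFiniteType (MvPolynomial ι' k) A] [Algebra.FormallyUnramified (MvPolynomial ι' k) A] {n : ℕ} (z : Cyc k A n)
    (hz : ∀ m (h : n = m + 1), Cyc.b m (h ▸ z) = 0) :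
    ∃ x, formsToOpcycles k A n x = Submodule.Quotient.mk z := by
  obtain ⟨c, w, rfl⟩ := Cyc.exists_eq_sum_antisymm (ι' := ι') z hz
  refine ⟨∑ s, c s • dForm 1 (Cyc.coords k A s), ?_⟩
  simp only [map_sum, map_smul, formsToOpcycles_dForm]
  rw [Submodule.Quotient.mk_add, (mk_eq_zero_iff (Cyc.b n w)).2 ⟨w, rfl⟩, add_zero]
  exact (map_sum (Submodule.mkQ (LinearMap.range (Cyc.b (k := k) (A := A) n))) _ _).symm

end Opcycles

/-! ### Functoriality of chains modulo boundaries -/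

section OpcyclesFunctor

variable (k : Type u) [CommRing k]

/-- Functoriality of the Hochschild complex as a semilinear map. -/
def mapSemilinear {k A B : Type u} [CommRing k] [CommRing A] [Algebra k A] [CommRing B]
    [Algebra k B] (φ : A →ₐ[k] B) (n : ℕ) : Cyc k A n →ₛₗ[φ.toRingHom] Cyc k B n :=
  { toFun := Cyc.mapHom φ n
    map_add' := map_add _
    map_smul' := Cyc.mapHom_smul φ }

/-- Functoriality of chains modulo boundaries. -/
def opcyclesMap {k A B : Type u} [CommRing k] [CommRing A] [Algebra k A] [CommRing B]
    [Algebra k B] (φ : A →ₐ[k] B) (n : ℕ) : Opcycles k A n →ₛₗ[φ.toRingHom] Opcycles k B n :=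
  Submodule.mapQ _ _ (mapSemilinear φ n) (by
    rintro _ ⟨w, rfl⟩
    exact ⟨Cyc.mapHom φ _ w, (Cyc.mapHom_b φ w).symm⟩)

lemma formsToOpcycles_formsMap {k A B : Type u} [CommRing k] [CommRing A] [Algebra k A] [CommRing B]
    [Algebra k B] (φ : A →ₐ[k] B) {n : ℕ} (x : ⋀[A]^n Ω[A⁄k]) :
    formsToOpcycles k B n (formsMap φ n x) = opcyclesMap φ n (formsToOpcycles k A n x) := by
  induction x using dForm_induction with
  | zero => rw [map_zero, map_zero, map_zero, map_zero]
  | form a r =>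
    rw [formsMap_dForm, formsToOpcycles_dForm, formsToOpcycles_dForm]
    refine congrArg Submodule.Quotient.mk (?_ : _ = Cyc.mapHom φ n (Cyc.antisymm a r))
    simp only [Cyc.antisymm, map_sum, map_zsmul, Cyc.mapHom_mk]
    refine Finset.sum_congr rfl fun σ _ => ?_
    congr 2
    funext i
    cases i using Fin.cases <;> rfl
  | add x y hx hy => rw [map_add, map_add, hx, hy, map_add, map_add]

/-- `A ↦ C_n(A) / b C_{n + 1}(A)`. -/
def opcyc (n : ℕ) : ModuleFunctor k where
  obj A := ModuleCat.of A (Opcycles k A n)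
  map φ := (opcyclesMap φ.hom n).toAddMonoidHom
  map_smul φ a x := LinearMap.map_smulₛₗ (opcyclesMap φ.hom n) a x
  map_id {A} x := by
    obtain ⟨x, rfl⟩ := Submodule.Quotient.mk_surjective (LinearMap.range (Cyc.b (k := k) (A := A) n)) x
    exact congrArg Submodule.Quotient.mk (Cyc.mapHom_id x)
  map_comp {A _ _} φ ψ x := by
    obtain ⟨x, rfl⟩ := Submodule.Quotient.mk_surjective (LinearMap.range (Cyc.b (k := k) (A := A) n)) x
    exact congrArg Submodule.Quotient.mk (Cyc.mapHom_comp φ.hom ψ.hom x)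

/-- The projection from chains to chains modulo boundaries. -/
def cycToOpcyc (n : ℕ) : cyc k n ⟶ opcyc k n where
  app A := Submodule.mkQ (LinearMap.range (Cyc.b (k := k) (A := A) n))
  naturality _ _ := rfl

/-- The differential on chains modulo boundaries. -/
def opcycD (n : ℕ) : opcyc k (n + 1) ⟶ cyc k n where
  app A := Submodule.liftQ (LinearMap.range (Cyc.b (k := k) (A := A) (n + 1))) (Cyc.b n) (by
    rintro _ ⟨w, rfl⟩
    exact Cyc.b_b w)
  naturality {A _} φ x := by
    obtain ⟨x, rfl⟩ := Submodule.Quotient.mk_surjective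
      (LinearMap.range (Cyc.b (k := k) (A := A) (n + 1))) x
    exact (Cyc.mapHom_b φ.hom x).symm

/-- Antisymmetrization as a natural map from forms to chains modulo boundaries. -/
def formsToOpcyc (n : ℕ) : forms k n ⟶ opcyc k n where
  app A := formsToOpcycles k A n
  naturality φ x := formsToOpcycles_formsMap φ.hom x

end OpcyclesFunctor

/-! ### Exactness after sheafification, from local exactness -/

section SheafExactness

variable {X : Scheme.{u}}

variable (X) in
/-- The associated sheaf of a presheaf of `𝒪_X`-modules. -/
def sheafification : X.PresheafOfModules ⥤ X.Modules :=
  PresheafOfModules.sheafification (𝟙 X.ringCatSheaf.obj)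

instance : (sheafification X).IsLeftAdjoint :=
  inferInstanceAs (PresheafOfModules.sheafification (𝟙 X.ringCatSheaf.obj)).IsLeftAdjoint

instance : (sheafification X).PreservesZeroMorphisms :=
  inferInstanceAs (PresheafOfModules.sheafification (𝟙 X.ringCatSheaf.obj)).PreservesZeroMorphisms

instance : PreservesFiniteLimits (sheafification X) :=
  inferInstanceAs (PreservesFiniteLimits (PresheafOfModules.sheafification (𝟙 X.ringCatSheaf.obj)))

/-- A presheaf of modules whose sections vanish locally has zero associated sheaf. -/
lemma isZero_sheafification (H : X.PresheafOfModules)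
    (h : ∀ (U : X.Opens) (y : H.obj (.op U)), ∀ x ∈ U, ∃ (V : X.Opens) (i : V ⟶ U), x ∈ V ∧
      H.map i.op y = 0) : IsZero ((sheafification X).obj H) := by
  rw [IsZero.iff_id_eq_zero]
  -- By adjunction it suffices that every map from `H` to a sheaf is zero; this is tested locally,
  -- where sections of `H` die.
  apply ((PresheafOfModules.sheafificationAdjunction (𝟙 X.ringCatSheaf.obj)).homEquiv H _).injective
  have key (F : X.Modules) (m : H ⟶ (PresheafOfModules.restrictScalars (𝟙 X.ringCatSheaf.obj)).obj
      ((SheafOfModules.forget _).obj F)) : m = 0 := by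
    ext U y
    refine TopCat.Presheaf.IsSheaf.section_ext F.isSheaf (s := m.app U y) (t := (0 : Γ(F, U.unop)))
      fun x hx => ?_
    obtain ⟨V, i, hV, hy⟩ := h U.unop y x hx
    refine ⟨V, i.le, hV, ?_⟩
    rw [map_zero]
    exact (PresheafOfModules.naturality_apply m i.op y).symm.trans
      ((congrArg (m.app (.op V)) hy).trans (map_zero (m.app (.op V)).hom))
  exact (key _ _).trans (key _ _).symm

/-- Sheafification is exact, so it commutes with homology, and the hypothesis makes every section of
the homology presheaf vanish locally. -/
lemma exact_map_sheafification (S : ShortComplex X.PresheafOfModules)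
    (h : ∀ (U : X.Opens) (y : S.X₂.obj (.op U)), S.g.app (.op U) y = 0 → ∀ x ∈ U,
      ∃ (V : X.Opens) (i : V ⟶ U), x ∈ V ∧ ∃ z, S.f.app (.op V) z = S.X₂.map i.op y) :
    (S.map (sheafification X)).Exact := by
  rw [ShortComplex.exact_iff_isZero_homology]
  refine IsZero.of_iso (isZero_sheafification S.homology fun U y x hx => ?_)
    (S.mapHomologyIso (sheafification X))
  obtain ⟨c, rfl⟩ := PresheafOfModules.surjective_of_epi S.homologyπ _ y
  obtain ⟨V, i, hV, z, hz⟩ := h U (S.iCycles.app _ c) (by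
    exact ConcreteCategory.congr_hom (congrArg (fun t => PresheafOfModules.Hom.app t (.op U))
      S.iCycles_g) c) x hx
  refine ⟨V, i, hV, ?_⟩
  have hc : (show S.cycles.obj (.op V) from S.cycles.map i.op c) = S.toCycles.app _ z := by
    refine PresheafOfModules.injective_of_mono S.iCycles (.op V) ?_
    refine (PresheafOfModules.naturality_apply S.iCycles i.op c).trans (hz.symm.trans ?_)
    exact (ConcreteCategory.congr_hom (congrArg (fun t => PresheafOfModules.Hom.app t (.op V))
      S.toCycles_i) z).symm
  refine (PresheafOfModules.naturality_apply S.homologyπ i.op c).symm.trans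
    ((congrArg (S.homologyπ.app (.op V)) hc).trans ?_)
  exact ConcreteCategory.congr_hom (congrArg (fun t => PresheafOfModules.Hom.app t (.op V))
    S.toCycles_comp_homologyπ) z

lemma mono_map_sheafification {M N : X.PresheafOfModules} (φ : M ⟶ N)
    (h : ∀ (U : X.Opens) (y : M.obj (.op U)), φ.app (.op U) y = 0 → ∀ x ∈ U,
      ∃ (V : X.Opens) (i : V ⟶ U), x ∈ V ∧ M.map i.op y = 0) :
    Mono ((sheafification X).map φ) := by
  have := exact_map_sheafification (ShortComplex.mk (0 : M ⟶ M) φ zero_comp) fun U y hy x hx => by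
    obtain ⟨V, i, hV, h⟩ := h U y hy x hx
    exact ⟨V, i, hV, 0, h.symm⟩
  exact this.mono_g ((sheafification X).map_zero _ _)

lemma epi_map_sheafification {M N : X.PresheafOfModules} (φ : M ⟶ N)
    (h : ∀ (U : X.Opens) (y : N.obj (.op U)), ∀ x ∈ U,
      ∃ (V : X.Opens) (i : V ⟶ U), x ∈ V ∧ ∃ z, φ.app (.op V) z = N.map i.op y) :
    Epi ((sheafification X).map φ) := by
  have := exact_map_sheafification (ShortComplex.mk φ (0 : N ⟶ N) comp_zero)
    fun U y _ x hx => h U y x hx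
  exact this.epi_f ((sheafification X).map_zero _ _)

namespace ModuleFunctor

variable {k : Type u} [CommRing k] (f : X ⟶ Spec (.of k)) {M N P : ModuleFunctor k}

/-- Exactness is required only for the section algebras of arbitrarily small neighbourhoods. A
section killed by `ψ` is first restricted to one of them, which is possible because `ψ` is natural.
-/
lemma exact_sheafMap (φ : M ⟶ N) (ψ : N ⟶ P) (w : ∀ A x, (φ ≫ ψ).app A x = 0)
    (h : ∀ (U : X.Opens), ∀ x ∈ U, ∃ V ≤ U, x ∈ V ∧ ∀ y, ψ.app (sections f V) y = 0 →
      ∃ z, φ.app (sections f V) z = y) :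
    (ShortComplex.mk (sheafMap f φ) (sheafMap f ψ)
      (by rw [← sheafMap_comp]; exact sheafMap_eq_zero f _ w)).Exact :=
  exact_map_sheafification (ShortComplex.mk (presheafMap f φ) (presheafMap f ψ) (by
    ext U y
    exact w (sections f U.unop) y)) fun U y hy x hx => by
      obtain ⟨V, hVU, hxV, h⟩ := h U x hx
      exact ⟨V, homOfLE hVU, hxV, h (N.map (restr f (homOfLE hVU)) y) (by
        refine (ψ.naturality (restr f (homOfLE hVU)) y).trans ?_
        exact (congrArg (P.map (restr f (homOfLE hVU))) hy).trans (map_zero _))⟩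

lemma mono_sheafMap (φ : M ⟶ N) (h : ∀ (U : X.Opens), ∀ x ∈ U, ∃ V ≤ U, x ∈ V ∧
      Function.Injective (φ.app (sections f V))) : Mono (sheafMap f φ) :=
  mono_map_sheafification (presheafMap f φ) fun U y hy x hx => by
    obtain ⟨V, hVU, hxV, h⟩ := h U x hx
    refine ⟨V, homOfLE hVU, hxV, h ?_⟩
    refine (φ.naturality (restr f (homOfLE hVU)) y).trans ?_
    exact (congrArg (N.map (restr f (homOfLE hVU))) hy).trans
      ((map_zero (N.map (restr f (homOfLE hVU)))).trans (map_zero (φ.app (sections f V))).symm)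

lemma epi_sheafMap (φ : M ⟶ N) (h : ∀ A, Function.Surjective (φ.app A)) : Epi (sheafMap f φ) :=
  epi_map_sheafification (presheafMap f φ) fun U _ _ hx =>
    ⟨U, 𝟙 U, hx, h (sections f U) _⟩

end ModuleFunctor

end SheafExactness

/-! ### Étale coordinates on smooth schemes -/

section Charts

variable {k : Type u} [CommRing k] {X : Scheme.{u}} (f : X ⟶ Spec (.of k))

/-- `A` is étale over a polynomial ring. -/
def HasEtaleCoordinates (A : CommAlgCat.{u} k) : Prop :=
  ∃ (n : ℕ) (_ : Algebra (MvPolynomial (Fin n) k) A),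
    IsScalarTower k (MvPolynomial (Fin n) k) A ∧ Algebra.Etale (MvPolynomial (Fin n) k) A

lemma smooth_structureMap [Smooth f] {W : X.Opens} (hW : IsAffineOpen W) :
    (structureMap f W).Smooth := by
  have h := Smooth.smooth_appLE (f := f) (isAffineOpen_top (Spec (.of k))) hW le_top
  have h' : (Scheme.ΓSpecIso (.of k)).inv.hom.Smooth :=
    RingHom.Smooth.of_bijective (ConcreteCategory.bijective_of_isIso (Scheme.ΓSpecIso (.of k)).inv)
  exact h'.comp h

/-- A smooth ring map is standard smooth after localizing at elements that generate the unit ideal,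
and a standard smooth algebra is étale over a polynomial ring. The corresponding basic opens cover
an affine neighbourhood. -/
lemma exists_hasEtaleCoordinates [Smooth f] (U : X.Opens) (x : X) (hx : x ∈ U) :
    ∃ V ≤ U, x ∈ V ∧ HasEtaleCoordinates (sections f V) := by
  obtain ⟨W, hW, hxW, hWU⟩ := exists_isAffineOpen_mem_and_subset hx
  obtain ⟨s, hs, hst⟩ := RingHom.smooth_iff_locally_isStandardSmooth.1 (smooth_structureMap f hW)
  rw [← hW.iSup_basicOpen_eq_self_iff] at hs
  rw [← hs] at hxW
  obtain ⟨⟨t, ht⟩, hxt⟩ := Opens.mem_iSup.1 hxW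
  refine ⟨X.basicOpen t, (X.basicOpen_le t).trans hWU, hxt, ?_⟩
  obtain ⟨n, g, hg, hg'⟩ := (hst t ht).exists_etale_mvPolynomial
  have := hW.isLocalization_basicOpen t
  let e : Localization.Away t ≃ₐ[Γ(X, W)] Γ(X, X.basicOpen t) :=
    IsLocalization.algEquiv (Submonoid.powers t) _ _
  have he : ((e.toRingEquiv.toRingHom.comp g).comp MvPolynomial.C) = structureMap f (X.basicOpen t) := by
    rw [RingHom.comp_assoc, hg]
    ext c
    refine (e.commutes _).trans ?_
    exact ConcreteCategory.congr_hom (structureHom_map f (homOfLE (X.basicOpen_le t))) c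
  have he' : (e.toRingEquiv.toRingHom.comp g).Etale :=
    RingHom.Etale.stableUnderComposition _ _ hg' (.of_bijective e.bijective)
  let alg : Algebra (MvPolynomial (Fin n) k) (sections f (X.basicOpen t)) :=
    RingHom.toAlgebra (S := Γ(X, X.basicOpen t)) (e.toRingEquiv.toRingHom.comp g)
  have : IsScalarTower k (MvPolynomial (Fin n) k) (sections f (X.basicOpen t)) :=
    IsScalarTower.of_algebraMap_eq fun c => (DFunLike.congr_fun he c).symm
  exact ⟨n, alg, this, he'⟩

lemma HasEtaleCoordinates.formsToOpcyc_injective {A : CommAlgCat.{u} k} (hA : HasEtaleCoordinates A)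
    (n : ℕ) : Function.Injective ((formsToOpcyc k n).app A) := by
  obtain ⟨N, _, _, _⟩ := hA
  exact formsToOpcycles_injective (Fin N) n

lemma HasEtaleCoordinates.exists_formsToOpcyc {A : CommAlgCat.{u} k} (hA : HasEtaleCoordinates A)
    {n : ℕ} (z : Cyc k A n) (hz : ∀ m (h : n = m + 1), Cyc.b m (h ▸ z) = 0) :
    ∃ x, (formsToOpcyc k n).app A x = (cycToOpcyc k n).app A z := by
  obtain ⟨N, _, _, _⟩ := hA
  exact mk_mem_range_formsToOpcycles (Fin N) z hz

end Charts

/-! ### Homology sheaves and the Hochschild–Kostant–Rosenberg isomorphism -/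

section HomologySheaves

namespace ModuleFunctor

variable {k : Type u} [CommRing k]

/-- The zero map. -/
def zeroHom (M N : ModuleFunctor k) : M ⟶ N :=
  ⟨fun _ => 0, fun φ _ => (map_zero (N.map φ)).symm⟩

/-- The kernel of a natural map. -/
def ker {M N : ModuleFunctor k} (φ : M ⟶ N) : ModuleFunctor k where
  obj A := ModuleCat.of A (LinearMap.ker (φ.app A))
  map ψ := ((M.map ψ).comp (LinearMap.ker (φ.app _)).subtype.toAddMonoidHom).codRestrict
    (LinearMap.ker (φ.app _)).toAddSubgroup fun x => by
      change φ.app _ (M.map ψ x.1) = 0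
      rw [φ.naturality, LinearMap.mem_ker.1 x.2, map_zero]
  map_smul ψ a x := Subtype.ext (M.map_smul ψ a x.1)
  map_id x := Subtype.ext (M.map_id x.1)
  map_comp ψ ψ' x := Subtype.ext (M.map_comp ψ ψ' x.1)

/-- The inclusion of the kernel. -/
def kerι {M N : ModuleFunctor k} (φ : M ⟶ N) : ker φ ⟶ M where
  app A := (LinearMap.ker (φ.app A)).subtype
  naturality _ _ := rfl

end ModuleFunctor

open ModuleFunctor

section Differentials

variable (k : Type u) [CommRing k]

/-- The Hochschild differential on chains of degree `n`. -/
def cycDFrom : (n : ℕ) → (cyc k n ⟶ cyc k (n - 1))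
  | 0 => zeroHom _ _
  | n + 1 => cycD k n

/-- The Hochschild differential on chains of degree `n` modulo boundaries. -/
def opcycDFrom : (n : ℕ) → (opcyc k n ⟶ cyc k (n - 1))
  | 0 => zeroHom _ _
  | n + 1 => opcycD k n

lemma cycToOpcyc_opcycDFrom (n : ℕ) : cycToOpcyc k n ≫ opcycDFrom k n = cycDFrom k n := by
  cases n <;> rfl

lemma cycDFrom_antisymm {A : CommAlgCat.{u} k} {n : ℕ} (a : A) (r : Fin n → A) :
    (cycDFrom k n).app A (Cyc.antisymm a r) = 0 := by
  cases n with
  | zero => rfl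
  | succ n => exact Cyc.b_antisymm a r

lemma opcycDFrom_formsToOpcyc (n : ℕ) (A : CommAlgCat.{u} k) (x : (forms k n).obj A) :
    (formsToOpcyc k n ≫ opcycDFrom k n).app A x = 0 := by
  let L : ⋀[A]^n Ω[A⁄k] →ₗ[A] Cyc k A (n - 1) := (formsToOpcyc k n ≫ opcycDFrom k n).app A
  change L x = 0
  induction x using dForm_induction with
  | zero => exact map_zero L
  | form a r =>
    change (opcycDFrom k n).app A (formsToOpcycles k A n (dForm a r)) = 0
    rw [formsToOpcycles_dForm]
    exact (congrArg (fun φ => φ.app A (Cyc.antisymm a r)) (cycToOpcyc_opcycDFrom k n)).trans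
      (cycDFrom_antisymm k a r)
  | add x y hx hy => exact (map_add L x y).trans (by rw [hx, hy, add_zero])

variable {k} in
lemma HasEtaleCoordinates.exists_of_opcycDFrom {A : CommAlgCat.{u} k} (hA : HasEtaleCoordinates A)
    {n : ℕ} (z : (opcyc k n).obj A) (hz : (opcycDFrom k n).app A z = 0) :
    ∃ x, (formsToOpcyc k n).app A x = z := by
  obtain ⟨z, rfl⟩ := Submodule.Quotient.mk_surjective (LinearMap.range (Cyc.b (k := k) (A := A) n)) z
  refine hA.exists_formsToOpcyc z fun m h => ?_
  subst h
  exact hz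

end Differentials

variable {k : Type u} [CommRing k] {X : Scheme.{u}} (f : X ⟶ Spec (.of k))

/-- For `n = 0` the truncated subtraction gives `d 0 0`, which is zero as `0` is not a successor of
itself. This treats cycles uniformly in all degrees. -/
lemma hochschildComplex_dFrom (n : ℕ) :
    (hochschildComplex f).d n (n - 1) = sheafMap f (cycDFrom k n) := by
  cases n with
  | zero =>
    rw [HomologicalComplex.shape _ _ _ (by simp)]
    exact (sheafMap_eq_zero f _ fun _ _ => rfl).symm
  | succ n => exact hochschildComplex_d f n

lemma exact_hochschildComplex_d (n i : ℕ) (hi : i = n + 1) :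
    ∃ w : (hochschildComplex f).d i n ≫ sheafMap f (cycToOpcyc k n) = 0,
      (ShortComplex.mk _ _ w).Exact := by
  subst hi
  have := exact_sheafMap f (cycD k n) (cycToOpcyc k n)
    (fun A x => (Submodule.Quotient.mk_eq_zero _).2 ⟨x, rfl⟩)
    fun U x hx => ⟨U, le_rfl, hx, fun y hy => (Submodule.Quotient.mk_eq_zero _).1 hy⟩
  rw [hochschildComplex_d]
  exact ⟨_, this⟩

instance epi_sheafMap_cycToOpcyc (n : ℕ) : Epi (sheafMap f (cycToOpcyc k n)) :=
  epi_sheafMap f _ fun _ => Submodule.mkQ_surjective _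

instance mono_sheafMap_formsToOpcyc [Smooth f] (n : ℕ) : Mono (sheafMap f (formsToOpcyc k n)) :=
  mono_sheafMap f _ fun U x hx => by
    obtain ⟨V, hVU, hx, hV⟩ := exists_hasEtaleCoordinates f U x hx
    exact ⟨V, hVU, hx, hV.formsToOpcyc_injective n⟩

/-- The map `q` is left abstract so that the one supplied by the universal property of the cokernel
can be used. It is the sheafified differential, because chains map epimorphically onto chains modulo
boundaries. -/
lemma exact_formsToOpcyc [Smooth f] (n j : ℕ) (hj : j = n - 1)
    (q : (opcyc k n).sheaf f ⟶ (hochschildComplex f).X j)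
    (hq : sheafMap f (cycToOpcyc k n) ≫ q = (hochschildComplex f).d n j) :
    ∃ w : sheafMap f (formsToOpcyc k n) ≫ q = 0, (ShortComplex.mk _ _ w).Exact := by
  subst hj
  obtain rfl : q = sheafMap f (opcycDFrom k n) := by
    refine (cancel_epi (sheafMap f (cycToOpcyc k n))).1 (hq.trans ?_)
    refine (hochschildComplex_dFrom f n).trans ?_
    rw [← cycToOpcyc_opcycDFrom]
    exact sheafMap_comp f _ _
  exact ⟨_, exact_sheafMap f (formsToOpcyc k n) (opcycDFrom k n) (opcycDFrom_formsToOpcyc k n)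
    fun U x hx => by
      obtain ⟨V, hVU, hx, hV⟩ := exists_hasEtaleCoordinates f U x hx
      exact ⟨V, hVU, hx, fun z hz => hV.exists_of_opcycDFrom z hz⟩⟩

lemma chainComplex_next (n : ℕ) : (ComplexShape.down ℕ).next n = n - 1 := by
  cases n <;> simp

/-- Chains modulo boundaries as a cokernel. -/
def isColimitOpcyc (n : ℕ) : IsColimit (CokernelCofork.ofπ (f := ((hochschildComplex f).sc n).f)
    (sheafMap f (cycToOpcyc k n))
    (exact_hochschildComplex_d f n _ (ChainComplex.prev ℕ n)).choose) :=
  @ShortComplex.Exact.gIsCokernel _ _ _ _ _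
    (exact_hochschildComplex_d f n _ (ChainComplex.prev ℕ n)).choose_spec
    (epi_sheafMap_cycToOpcyc f n)

lemma exact_formsToOpcyc_desc [Smooth f] (n : ℕ) :
    ∃ w : sheafMap f (formsToOpcyc k n) ≫ (isColimitOpcyc f n).desc
      (CokernelCofork.ofπ _ ((hochschildComplex f).sc n).zero) = 0, (ShortComplex.mk _ _ w).Exact :=
  exact_formsToOpcyc f n _ (chainComplex_next n) _
    ((isColimitOpcyc f n).fac (CokernelCofork.ofπ _ ((hochschildComplex f).sc n).zero)
      WalkingParallelPair.one)

/-- The homology sheaves of the Hochschild complex of a smooth scheme are the sheaves of forms. -/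
def hochschildHomologyData [Smooth f] (n : ℕ) :
    ((hochschildComplex f).sc n).RightHomologyData where
  Q := (opcyc k n).sheaf f
  H := Omega f n
  p := sheafMap f (cycToOpcyc k n)
  ι := sheafMap f (formsToOpcyc k n)
  wp := (exact_hochschildComplex_d f n _ (ChainComplex.prev ℕ n)).choose
  hp := isColimitOpcyc f n
  wι := (exact_formsToOpcyc_desc f n).choose
  hι := @ShortComplex.Exact.fIsKernel _ _ _ _ _ (exact_formsToOpcyc_desc f n).choose_spec
    (mono_sheafMap_formsToOpcyc f n)

/-- The Hochschild-Kostant-Rosenberg isomorphism. -/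
def hkrIso [Smooth f] (n : ℕ) : Omega f n ≅ (hochschildComplex f).homology n :=
  (hochschildHomologyData f n).homologyIso.symm

/-- The map from the sheaf associated with Hochschild cycles to the sheaf of cycles. -/
def cyclesLift (n : ℕ) : (ker (cycDFrom k n)).sheaf f ⟶ (hochschildComplex f).cycles n :=
  (hochschildComplex f).liftCycles (sheafMap f (kerι (cycDFrom k n))) (n - 1) (chainComplex_next n)
    ((congrArg (sheafMap f (kerι (cycDFrom k n)) ≫ ·) (hochschildComplex_dFrom f n)).trans
      ((sheafMap_comp f _ _).symm.trans (sheafMap_eq_zero f _ fun _ x => x.2)))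

lemma cyclesLift_iCycles (n : ℕ) :
    cyclesLift f n ≫ (hochschildComplex f).iCycles n = sheafMap f (kerι (cycDFrom k n)) :=
  (hochschildComplex f).liftCycles_i _ _ _ _

/-- The antisymmetrization as a section of the sheaf of Hochschild cycles. -/
def antisymmCycle (n : ℕ) (U : X.Opens) (a : Γ(X, U)) (r : Fin n → Γ(X, U)) :
    Γ((hochschildComplex f).cycles n, U) :=
  (cyclesLift f n).app U (sheafSection f (ker (cycDFrom k n)) U
    ⟨Cyc.antisymm (k := k) (A := sections f U) a r, cycDFrom_antisymm k _ _⟩)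

lemma app_congr {F G : X.Modules} {φ ψ : F ⟶ G} (h : φ = ψ) {U : X.Opens} (x : Γ(F, U)) :
    φ.app U x = ψ.app U x := by
  rw [h]

lemma iCycles_antisymmCycle (n : ℕ) (U : X.Opens) (a : Γ(X, U)) (r : Fin n → Γ(X, U)) :
    ((hochschildComplex f).iCycles n).app U (antisymmCycle f n U a r) = antisymmSection f n U a r :=
  (app_congr (cyclesLift_iCycles f n) _).trans (sheafMap_sheafSection f _ U _)

lemma app_injective_of_mono {F G : X.Modules} (φ : F ⟶ G) [Mono φ] (U : X.Opens) :
    Function.Injective (φ.app U) := by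
  have : Mono ((Scheme.Modules.toPresheaf X).map φ) := inferInstance
  exact (AddCommGrpCat.mono_iff_injective _).1
    ((NatTrans.mono_iff_mono_app ((Scheme.Modules.toPresheaf X).map φ)).1 this (.op U))

/-- Homology embeds into chains modulo boundaries, and there both sides are the class of the
antisymmetrization. -/
lemma hkrIso_formSection [Smooth f] (n : ℕ) (U : X.Opens) (a : Γ(X, U)) (r : Fin n → Γ(X, U)) :
    (hkrIso f n).hom.app U (formSection f n U a r) =
      ((hochschildComplex f).homologyπ n).app U (antisymmCycle f n U a r) := by
  have h₁ : (hkrIso f n).hom ≫ (hochschildComplex f).homologyι n =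
      sheafMap f (formsToOpcyc k n) ≫ (hochschildHomologyData f n).opcyclesIso.inv := by
    exact (hochschildHomologyData f n).homologyIso_inv_comp_homologyι
  have h₂ : (hochschildComplex f).homologyπ n ≫ (hochschildComplex f).homologyι n =
      (hochschildComplex f).iCycles n ≫ sheafMap f (cycToOpcyc k n) ≫
        (hochschildHomologyData f n).opcyclesIso.inv := by
    rw [HomologicalComplex.homology_π_ι]
    congr 1
    exact ((hochschildHomologyData f n).p_comp_opcyclesIso_inv).symm
  apply app_injective_of_mono ((hochschildComplex f).homologyι n)
  refine (app_congr h₁ _).trans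
    (Eq.trans ?_ (app_congr h₂ _).symm)
  refine congrArg ((hochschildHomologyData f n).opcyclesIso.inv.app U) ?_
  refine (sheafMap_sheafSection f (formsToOpcyc k n) U _).trans ?_
  refine Eq.trans ?_ (congrArg ((sheafMap f (cycToOpcyc k n)).app U)
    (iCycles_antisymmCycle f n U a r)).symm
  refine Eq.trans ?_ (sheafMap_sheafSection f (cycToOpcyc k n) U _).symm
  exact congrArg (sheafSection f (opcyc k n) U) (formsToOpcycles_dForm _ _)

/-- The projection from Hochschild chains to forms. -/
def projToOmega (n : ℕ) : (hochschildComplex f).X n ⟶ Omega f n := sheafMap f (cycProj k n)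

lemma projToOmega_antisymmSection (n : ℕ) (U : X.Opens) (a : Γ(X, U)) (r : Fin n → Γ(X, U)) :
    (projToOmega f n).app U (antisymmSection f n U a r) = n.factorial • formSection f n U a r := by
  refine (sheafMap_sheafSection f (cycProj k n) U _).trans ?_
  refine (congrArg (sheafSection f (forms k n) U) (proj_antisymm (k := k) (A := sections f U) _ _)).trans ?_
  exact map_nsmul (sheafSection f (forms k n) U) _ _

/-- This reduces the map on homology to the projection of representing cycles. -/
lemma homologyπ_homologyToOmega (n : ℕ) :
    (hochschildComplex f).homologyπ n ≫ homologyToOmega f n =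
      (hochschildComplex f).iCycles n ≫ projToOmega f n := by
  have h : (toOmega f n).f n ≫ (HomologicalComplex.singleObjXSelf (.down ℕ) n (Omega f n)).hom =
      projToOmega f n := by
    refine (congrArg (· ≫ (HomologicalComplex.singleObjXSelf (.down ℕ) n (Omega f n)).hom)
      (HomologicalComplex.mkHomToSingle_f _ _)).trans ?_
    refine (Category.assoc _ _ _).trans ?_
    rw [Iso.inv_hom_id]
    exact Category.comp_id _
  rw [homologyToOmega, HomologicalComplex.homologyπ_naturality_assoc,
    HomologicalComplex.homologyπ_singleObjHomologySelfIso_hom,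
    HomologicalComplex.singleObjCyclesSelfIso_hom, HomologicalComplex.cyclesMap_i_assoc]
  exact congrArg _ h

lemma homologyToOmega_homologyπ_antisymmCycle (n : ℕ) (U : X.Opens) (a : Γ(X, U))
    (r : Fin n → Γ(X, U)) : (homologyToOmega f n).app U
      (((hochschildComplex f).homologyπ n).app U (antisymmCycle f n U a r)) =
        n.factorial • formSection f n U a r := by
  have h := app_congr (homologyπ_homologyToOmega f n) (antisymmCycle f n U a r)
  rw [Scheme.Modules.Hom.comp_app, Scheme.Modules.Hom.comp_app, AddCommGrpCat.comp_apply,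
    AddCommGrpCat.comp_apply, iCycles_antisymmCycle, projToOmega_antisymmSection] at h
  exact h

lemma app_nsmul_id (m : ℕ) {F : X.Modules} {U : X.Opens} (x : Γ(F, U)) :
    (m • 𝟙 F).app U x = m • x := by
  induction m with
  | zero => rw [zero_smul, zero_smul]; rfl
  | succ m ih => rw [succ_nsmul, succ_nsmul, ← ih]; rfl

/-- Maps out of an associated sheaf are determined by sections from the presheaf, which are sums of
forms `a dr₁ ∧ ⋯ ∧ drₙ`; on these the factor comes from `proj_antisymm`. -/
lemma hkrIso_homologyToOmega [Smooth f] (n : ℕ) :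
    (hkrIso f n).hom ≫ homologyToOmega f n = n.factorial • 𝟙 (Omega f n) := by
  refine hom_ext_sheaf f (forms k n) fun U x => ?_
  have key (a : Γ(X, U)) (r : Fin n → Γ(X, U)) :
      ((hkrIso f n).hom ≫ homologyToOmega f n).app U (formSection f n U a r) =
        n.factorial • formSection f n U a r := by
    rw [Scheme.Modules.Hom.comp_app, AddCommGrpCat.comp_apply, hkrIso_formSection,
      homologyToOmega_homologyπ_antisymmCycle]
  refine Eq.trans ?_ (app_nsmul_id n.factorial _).symm
  let T : ⋀[sections f U]^n Ω[sections f U⁄k] →+ Γ(Omega f n, U) := sheafSection f (forms k n) U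
  change ((hkrIso f n).hom ≫ homologyToOmega f n).app U (T x) = n.factorial • T x
  induction x using dForm_induction with
  | zero => rw [map_zero, map_zero, smul_zero]
  | form a r => exact key a r
  | add x y hx hy => rw [map_add, map_add, hx, hy, smul_add]

end HomologySheaves

/-! ### The truncated complex as a sum of shifted sheaves of forms -/

section Decomposition

open HomologicalComplex

section General

variable {C D : Type*} [Category* C] [Category* D] [Abelian C] [Abelian D]

section Biproduct

variable {ι : Type*} {c : ComplexShape ι} {J : Type} [Fintype J] (F : J → HomologicalComplex C c)
  [HasBiproduct F]

lemma sum_homologyMap_biproduct (i : ι) :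
    ∑ j, homologyMap (biproduct.π F j) i ≫ homologyMap (biproduct.ι F j) i = 𝟙 _ := by
  rw [← homologyMap_id]
  refine Eq.trans ?_ (congrArg (fun φ => homologyMap φ i) (biproduct.total (f := F)))
  refine Eq.trans ?_ ((homologyFunctor C c i).map_sum _ _).symm
  exact Finset.sum_congr rfl fun j _ => (homologyMap_comp _ _ _).symm

lemma isZero_homology_biproduct {i : ι} (h : ∀ j, IsZero ((F j).homology i)) :
    IsZero ((⨁ F).homology i) := by
  rw [IsZero.iff_id_eq_zero, ← sum_homologyMap_biproduct]
  exact Finset.sum_eq_zero fun j _ => by rw [(h j).eq_of_tgt (homologyMap _ i) 0, zero_comp]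

/-- In the decomposition of the identity on homology only the `j`-th summand survives, so the
inclusion is inverse to the projection. -/
lemma quasiIsoAt_biproduct_π {i : ι} (j : J) (h : ∀ j', j' ≠ j → IsZero ((F j').homology i)) :
    QuasiIsoAt (biproduct.π F j) i := by
  rw [quasiIsoAt_iff_isIso_homologyMap]
  refine ⟨homologyMap (biproduct.ι F j) i, ?_, ?_⟩
  · rw [← sum_homologyMap_biproduct, Finset.sum_eq_single j _ fun hj => absurd (Finset.mem_univ j) hj]
    intro j' _ hj'
    rw [(h j' hj').eq_of_tgt (homologyMap _ i) 0, zero_comp]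
  · rw [← homologyMap_comp, biproduct.ι_π_self, homologyMap_id]

end Biproduct

lemma hom_ext_map_biproduct (F : C ⥤ D) [F.Additive] {J : Type} [Fintype J] (G : J → C)
    [HasBiproduct G] {Z : D} {φ ψ : Z ⟶ F.obj (⨁ G)}
    (h : ∀ j, φ ≫ F.map (biproduct.π G j) = ψ ≫ F.map (biproduct.π G j)) : φ = ψ := by
  have total : ∑ j, F.map (biproduct.π G j) ≫ F.map (biproduct.ι G j) = 𝟙 (F.obj (⨁ G)) := by
    rw [← F.map_id]
    refine Eq.trans ?_ (congrArg F.map (biproduct.total (f := G)))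
    refine Eq.trans ?_ (F.map_sum _ _).symm
    exact Finset.sum_congr rfl fun j _ => (F.map_comp _ _).symm
  rw [← Category.comp_id φ, ← Category.comp_id ψ, ← total, Preadditive.comp_sum,
    Preadditive.comp_sum]
  exact Finset.sum_congr rfl fun j _ => by
    rw [← Category.assoc, h, Category.assoc]

lemma isZero_homology_single {ι : Type*} [DecidableEq ι] (c : ComplexShape ι) {i j : ι}
    (h : i ≠ j) (A : C) : IsZero (((single C c j).obj A).homology i) :=
  (exactAt_single_obj c j A i h).isZero_homology

/-- Outside the degrees `1 - p, …, 0` both homologies vanish. In degree `-t` the truncation map and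
the projection to the `t`-th summand are isomorphisms on homology, so the claim reduces to `φ t`. -/
lemma quasiIso_of_πTruncGE_comp {p : ℕ} (K : CochainComplex C ℤ)
    (hK : ∀ i : ℤ, 0 < i → IsZero (K.X i)) (A : Fin p → C)
    [HasBiproduct fun t : Fin p => (single C (.up ℤ) (-(t : ℤ))).obj (A t)]
    (φ : ∀ t : Fin p, K ⟶ (single C (.up ℤ) (-(t : ℤ))).obj (A t))
    (hφ : ∀ t, QuasiIsoAt (φ t) (-(t : ℤ)))
    (Φ : K.truncGE (1 - p) ⟶ ⨁ fun t : Fin p => (single C (.up ℤ) (-(t : ℤ))).obj (A t))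
    (hΦ : ∀ t, K.πTruncGE (1 - p) ≫ Φ ≫ biproduct.π _ t = φ t) : QuasiIso Φ := by
  refine ⟨fun i => ?_⟩
  have hzero (h : ∀ t : Fin p, i ≠ -(t : ℤ)) :
      IsZero ((⨁ fun t : Fin p => (single C (.up ℤ) (-(t : ℤ))).obj (A t)).homology i) :=
    isZero_homology_biproduct _ fun t => isZero_homology_single _ (h t) _
  by_cases hi : i < 1 - p
  · rw [quasiIsoAt_iff_isIso_homologyMap]
    exact isIso_of_source_target_iso_zero _
      (CochainComplex.isZero_of_isGE _ (1 - p) i hi).isoZero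
      (hzero fun t => by have := t.isLt; omega).isoZero
  · have := K.quasiIsoAt_πTruncGE (1 - p) i (by omega)
    rw [← quasiIsoAt_iff_comp_left (K.πTruncGE (1 - p)) Φ i]
    by_cases hi' : 0 < i
    · rw [quasiIsoAt_iff_isIso_homologyMap]
      exact isIso_of_source_target_iso_zero _
        (ShortComplex.isZero_homology_of_isZero_X₂ _ (hK i hi')).isoZero
        (hzero fun t => by omega).isoZero
    · obtain ⟨t, rfl⟩ : ∃ t : Fin p, i = -(t : ℤ) := ⟨⟨(-i).toNat, by omega⟩, by simp; omega⟩
      have := quasiIsoAt_biproduct_π (i := -(t : ℤ))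
        (fun t : Fin p => (single C (.up ℤ) (-(t : ℤ))).obj (A t)) t fun t' h =>
          isZero_homology_single _ (fun h' => h (Fin.ext (by omega))) _
      rw [← quasiIsoAt_iff_comp_right _ (biproduct.π _ t), Category.assoc, hΦ]
      exact hφ t

lemma extendCompare_f (F : C ⥤ D) [F.Additive] (K : ChainComplex C ℕ) {n : ℕ} {i : ℤ}
    (h : ComplexShape.embeddingDownNat.f n = i) : (extendCompare F K).f i =
      (extendXIso ((F.mapHomologicalComplex _).obj K) ComplexShape.embeddingDownNat h).hom ≫
        F.map (extendXIso K ComplexShape.embeddingDownNat h).inv := by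
  have key : ∀ {j : Option ℕ} (hj : j = some n), extendCompareX F K j =
      (extend.XIso ((F.mapHomologicalComplex _).obj K) hj).hom ≫
        F.map (extend.XIso K hj).inv := by
    rintro _ rfl
    refine Eq.symm ((congrArg₂ (· ≫ ·) (?_ : _ = 𝟙 _) (?_ : _ = 𝟙 _)).trans (Category.comp_id _))
    · rfl
    · exact F.map_id _
  exact key (ComplexShape.embeddingDownNat.r_eq_some h)

end General

variable {k : Type u} [CommRing k] {X Y : Scheme.{u}} (f : X ⟶ Spec (.of k))

open ModuleFunctor

lemma isZero_HH_X {i : ℤ} (hi : 0 < i) : IsZero ((HH f).X i) :=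
  isZero_extend_X _ _ _ fun n h => by
    have : -(n : ℤ) = i := h
    omega

lemma πTruncGE_truncHHToSumOmega_π (p : ℕ) (t : Fin p) :
    (HH f).πTruncGE (1 - p) ≫ truncHHToSumOmega f p ≫ biproduct.π _ t = HHToOmega f t := by
  rw [truncHHToSumOmega, biproduct.lift_π, π_truncLift]

lemma sheafSection_algebraMap_smul (M : ModuleFunctor k) (U : X.Opens) (m : ℕ) (hm : (m : k) = 0)
    (x : M.obj (sections f U)) : m • sheafSection f M U x = 0 := by
  rw [← map_nsmul]
  have h : (m : sections f U) = 0 := by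
    rw [← map_natCast (algebraMap k (sections f U)), hm, map_zero]
  rw [← Nat.cast_smul_eq_nsmul (sections f U), h, zero_smul, map_zero]

lemma nsmul_id_sheaf (M : ModuleFunctor k) (m : ℕ) (hm : (m : k) = 0) :
    m • 𝟙 (M.sheaf f) = 0 :=
  hom_ext_sheaf f M fun U x =>
    (app_nsmul_id m _).trans (sheafSection_algebraMap_smul f M U m hm x)

/-- Bézout: since `n` acts by zero, the Bézout coefficient of `m` gives an inverse. -/
lemma isIso_nsmul_id {C : Type*} [Category* C] [Preadditive C] {F : C} {m n : ℕ}
    (hmn : m.Coprime n) (hn : n • 𝟙 F = 0) : IsIso (m • 𝟙 F) := by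
  have h : (m : ℤ) * m.gcdA n + n * m.gcdB n = 1 := by
    rw [← Nat.gcd_eq_gcd_ab, hmn, Nat.cast_one]
  have hn' : (n : ℤ) • 𝟙 F = 0 := by rw [natCast_zsmul, hn]
  have key : (m.gcdA n * m : ℤ) • 𝟙 F = 𝟙 F := by
    have := congrArg (· • 𝟙 F) h
    simpa only [add_smul, mul_comm (n : ℤ), mul_smul _ (n : ℤ), hn', smul_zero, add_zero, one_smul,
      mul_comm (m : ℤ)] using this
  refine ⟨m.gcdA n • 𝟙 F, ?_, ?_⟩ <;>
  simpa [← natCast_zsmul, smul_smul, mul_comm] using key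

variable {p : ℕ}

/-- A power of `p` kills the sheaf of forms and is coprime to `t!` for `t < p`. So `t!` is
invertible on forms, and the inverse of the projection is the HKR map up to this factor. -/
lemma isIso_homologyToOmega [Smooth f] (hp : p.Prime) (hk : IsNilpotent (p : k)) {t : ℕ}
    (ht : t < p) : IsIso (homologyToOmega f t) := by
  obtain ⟨N, hN⟩ := hk
  have : IsIso ((hkrIso f t).hom ≫ homologyToOmega f t) := by
    rw [hkrIso_homologyToOmega]
    exact isIso_nsmul_id (((hp.coprime_factorial_of_lt ht).symm).pow_right N)
      (nsmul_id_sheaf f (forms k t) (p ^ N) (by rw [Nat.cast_pow, hN]))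
  exact IsIso.of_isIso_comp_left (hkrIso f t).hom _

lemma quasiIsoAt_HHToOmega [Smooth f] (hp : p.Prime) (hk : IsNilpotent (p : k)) {t : ℕ}
    (ht : t < p) : QuasiIsoAt (HHToOmega f t) (-(t : ℤ)) := by
  have := isIso_homologyToOmega f hp hk ht
  have : QuasiIsoAt (toOmega f t) t := by
    rw [quasiIsoAt_iff_isIso_homologyMap]
    have : IsIso (homologyMap (toOmega f t) t ≫
        (singleObjHomologySelfIso _ t (Omega f t)).hom) := this
    exact IsIso.of_isIso_comp_right _ (singleObjHomologySelfIso _ t (Omega f t)).hom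
  have := (quasiIsoAt_extendMap_iff (toOmega f t) ComplexShape.embeddingDownNat
    (j := t) (j' := -(t : ℤ)) rfl).2 this
  exact (quasiIsoAt_iff_comp_right _ _ _).2 this

lemma quasiIso_truncHHToSumOmega [Smooth f] (hp : p.Prime) (hk : IsNilpotent (p : k)) :
    QuasiIso (truncHHToSumOmega f p) :=
  quasiIso_of_πTruncGE_comp (HH f) (fun _ => isZero_HH_X f) (fun t : Fin p => Omega f t)
    (fun t => HHToOmega f t) (fun t => quasiIsoAt_HHToOmega f hp hk t.isLt) _
    (πTruncGE_truncHHToSumOmega_π f p)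

/-! ### Naturality along morphisms of schemes -/

section Naturality

variable {g : Y ⟶ Spec (.of k)} (h : X ⟶ Y) (w : h ≫ g = f)

lemma πTruncGE_truncHHPullback (p : ℕ) :
    (HH g).πTruncGE (1 - p) ≫ truncHHPullback f h w p = HHPullback f h w ≫
      ((Scheme.Modules.pushforward h).mapHomologicalComplex _).map ((HH f).πTruncGE (1 - p)) := by
  rw [truncHHPullback, π_truncLift]

/-- Functoriality of the sheaf of forms. -/
def omegaPullback (t : ℕ) : Omega g t ⟶ (Scheme.Modules.pushforward h).obj (Omega f t) :=
  pullback f (forms k t) h w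

/-- Functoriality of `Ω^t[t]`. -/
def singleOmegaPullback (t : ℕ) :
    (single Y.Modules (.up ℤ) (-(t : ℤ))).obj (Omega g t) ⟶
      ((Scheme.Modules.pushforward h).mapHomologicalComplex _).obj
        ((single X.Modules (.up ℤ) (-(t : ℤ))).obj (Omega f t)) :=
  (single Y.Modules (.up ℤ) (-(t : ℤ))).map (omegaPullback f h w t) ≫
    (singleMapHomologicalComplex (Scheme.Modules.pushforward h) (.up ℤ)
        (-(t : ℤ))).inv.app (Omega f t)

lemma ι_sumOmegaPullback (p : ℕ) (t : Fin p) :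
    biproduct.ι (fun t : Fin p => (single Y.Modules (.up ℤ) (-(t : ℤ))).obj (Omega g t)) t ≫
        sumOmegaPullback f h w p =
      singleOmegaPullback f h w t ≫ ((Scheme.Modules.pushforward h).mapHomologicalComplex _).map
        (biproduct.ι (fun t : Fin p => (single X.Modules (.up ℤ) (-(t : ℤ))).obj (Omega f t)) t) :=
  (biproduct.ι_desc _ _).trans (Category.assoc _ _ _).symm

lemma sumOmegaPullback_π (p : ℕ) (t : Fin p) :
    sumOmegaPullback f h w p ≫ ((Scheme.Modules.pushforward h).mapHomologicalComplex _).map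
        (biproduct.π (fun t : Fin p => (single X.Modules (.up ℤ) (-(t : ℤ))).obj (Omega f t)) t) =
      biproduct.π (fun t : Fin p => (single Y.Modules (.up ℤ) (-(t : ℤ))).obj (Omega g t)) t ≫
        singleOmegaPullback f h w t := by
  refine biproduct.hom_ext' _ _ fun s => ?_
  rw [← Category.assoc, ι_sumOmegaPullback, Category.assoc, ← CategoryTheory.Functor.map_comp]
  by_cases hst : s = t
  · subst hst
    rw [biproduct.ι_π_self, biproduct.ι_π_self_assoc, CategoryTheory.Functor.map_id, Category.comp_id]
  · rw [biproduct.ι_π_ne _ hst, biproduct.ι_π_ne_assoc _ hst, CategoryTheory.Functor.map_zero, comp_zero,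
      zero_comp]

lemma toOmega_f (t : ℕ) : (toOmega f t).f t =
    projToOmega f t ≫ (singleObjXSelf (.down ℕ) t (Omega f t)).inv :=
  mkHomToSingle_f _ _

lemma embeddingDownNat_f (t : ℕ) : ComplexShape.embeddingDownNat.f t = -(t : ℤ) := rfl

lemma comp_inv_comp_hom_comp {C : Type*} [Category* C] {A B E F G : C} (a : A ⟶ B) (b : B ⟶ E)
    (i : F ≅ E) (c : E ⟶ G) : (a ≫ b ≫ i.inv) ≫ i.hom ≫ c = a ≫ b ≫ c := by simp

/-- The term of `HH` in cohomological degree `-t`. -/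
def HHXIso (t : ℕ) : (HH f).X (-(t : ℤ)) ≅ (hochschildComplex f).X t :=
  extendXIso (hochschildComplex f) ComplexShape.embeddingDownNat (embeddingDownNat_f t)

lemma HHToOmega_f (t : ℕ) : (HHToOmega f t).f (-(t : ℤ)) =
    (HHXIso f t).hom ≫ projToOmega f t ≫ (singleObjXSelf (.up ℤ) (-(t : ℤ)) (Omega f t)).inv := by
  have h₁ := extendMap_f (toOmega f t) ComplexShape.embeddingDownNat (embeddingDownNat_f t)
  have h₂ := extendSingleIso_hom_f ComplexShape.embeddingDownNat (Omega f t) t (-(t : ℤ)) rfl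
  refine (congrArg₂ (· ≫ ·) h₁ h₂).trans ?_
  refine (comp_inv_comp_hom_comp _ _ _ _).trans ?_
  refine congrArg (fun a => (HHXIso f t).hom ≫ a) ?_
  refine (congrArg (· ≫ _) (toOmega_f f t)).trans ?_
  simp

lemma hom_ext_map_single {C D : Type*} [Category* C] [Category* D] [Abelian C] [Abelian D]
    (F : C ⥤ D) [F.Additive] {ι : Type*} [DecidableEq ι] {c : ComplexShape ι} {j : ι} {A : C}
    {K : HomologicalComplex D c} {φ ψ : K ⟶ (F.mapHomologicalComplex c).obj ((single C c j).obj A)}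
    (h : φ.f j = ψ.f j) : φ = ψ := by
  ext i
  by_cases hi : i = j
  · subst hi
    exact h
  · exact (F.map_isZero (isZero_single_obj_X c j A i hi)).eq_of_tgt _ _

/-- Functoriality of the sheaf of Hochschild chains of degree `t`. -/
def chainsPullback (t : ℕ) : (hochschildComplex g).X t ⟶
    (Scheme.Modules.pushforward h).obj ((hochschildComplex f).X t) :=
  pullback f (cyc k t) h w

lemma HHPullback_f (t : ℕ) : (HHPullback f h w).f (-(t : ℤ)) =
    (HHXIso g t).hom ≫ chainsPullback f h w t ≫
      (Scheme.Modules.pushforward h).map (HHXIso f t).inv := by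
  have h₁ := extendMap_f (hochschildPullback f h w) ComplexShape.embeddingDownNat
    (embeddingDownNat_f t)
  have h₂ := extendCompare_f (Scheme.Modules.pushforward h) (hochschildComplex f)
    (embeddingDownNat_f t)
  refine (congrArg₂ (· ≫ ·) h₁ h₂).trans ?_
  exact comp_inv_comp_hom_comp _ _ _ _

lemma chainsPullback_projToOmega (t : ℕ) :
    chainsPullback f h w t ≫ (Scheme.Modules.pushforward h).map (projToOmega f t) =
      projToOmega g t ≫ omegaPullback f h w t :=
  pullback_sheafMap f (cycProj k t) h w

lemma singleOmegaPullback_f (t : ℕ) : (singleOmegaPullback f h w t).f (-(t : ℤ)) =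
    (singleObjXSelf (.up ℤ) (-(t : ℤ)) (Omega g t)).hom ≫ omegaPullback f h w t ≫
      (Scheme.Modules.pushforward h).map (singleObjXSelf (.up ℤ) (-(t : ℤ)) (Omega f t)).inv := by
  have h₁ := single_map_f_self (.up ℤ) (-(t : ℤ)) (omegaPullback f h w t)
  have h₂ := singleMapHomologicalComplex_inv_app_self (Scheme.Modules.pushforward h) (.up ℤ)
    (-(t : ℤ)) (Omega f t)
  exact (congrArg₂ (· ≫ ·) h₁ h₂).trans (comp_inv_comp_hom_comp _ _ _ _)

/-- The target is concentrated in degree `-t`. There the identity is the compatibility of the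
projection with pullback of chains and forms, up to the identifications of the terms. -/
lemma HHPullback_HHToOmega (t : ℕ) :
    HHPullback f h w ≫ ((Scheme.Modules.pushforward h).mapHomologicalComplex _).map
      (HHToOmega f t) = HHToOmega g t ≫ singleOmegaPullback f h w t := by
  refine hom_ext_map_single _ ?_
  refine (congrArg₂ (fun a b => a ≫ (Scheme.Modules.pushforward h).map b)
    (HHPullback_f f h w t) (HHToOmega_f f t)).trans
    (Eq.trans ?_ (congrArg₂ (· ≫ ·) (HHToOmega_f g t) (singleOmegaPullback_f f h w t)).symm)
  simp only [Category.assoc, Iso.inv_hom_id_assoc, CategoryTheory.Functor.map_comp]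
  rw [← CategoryTheory.Functor.map_comp_assoc _ (HHXIso f t).inv, Iso.inv_hom_id,
    CategoryTheory.Functor.map_id, Category.id_comp]
  refine Eq.trans ?_ (comp_inv_comp_hom_comp _ _ _ _).symm
  refine congrArg (fun a => (HHXIso g t).hom ≫ a) ?_
  refine (Category.assoc _ _ _).symm.trans ?_
  rw [chainsPullback_projToOmega, Category.assoc]

/-- The map from the full complex to its truncation is an epimorphism, and maps into the direct
image of the biproduct are detected by its projections. This reduces the square to the untruncated
one for each `t`. -/
lemma truncHHPullback_truncHHToSumOmega (p : ℕ) :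
    truncHHPullback f h w p ≫ ((Scheme.Modules.pushforward h).mapHomologicalComplex (.up ℤ)).map
        (truncHHToSumOmega f p) = truncHHToSumOmega g p ≫ sumOmegaPullback f h w p := by
  have : Epi ((HH g).πTruncGE (1 - p)) :=
    inferInstanceAs (Epi (HomologicalComplex.πTruncGE (HH g) _))
  rw [← cancel_epi ((HH g).πTruncGE (1 - p)), ← Category.assoc, πTruncGE_truncHHPullback]
  refine hom_ext_map_biproduct _ _ fun t => ?_
  rw [Category.assoc, Category.assoc, Category.assoc, Category.assoc, sumOmegaPullback_π,
    ← CategoryTheory.Functor.map_comp, ← CategoryTheory.Functor.map_comp, πTruncGE_truncHHToSumOmega_π, HHPullback_HHToOmega,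
    ← πTruncGE_truncHHToSumOmega_π g p t, Category.assoc, Category.assoc]

end Naturality

end Decomposition

end HKR

end

theorem lemma3p5 {k : Type u} [CommRing k] {p : ℕ} (hp : p.Prime) (hk : IsNilpotent (p : k)) :
    (∀ (X : Scheme.{u}) (f : X ⟶ Spec (.of k)) [Smooth f] [IsProper f],
      QuasiIso (HKR.truncHHToSumOmega f p) ∧
      ∀ t : ℕ, ∃ ε : HKR.Omega f t ≅ (HKR.hochschildComplex f).homology t,
        (∀ (U : X.Opens) (a : Γ(X, U)) (r : Fin t → Γ(X, U)),
          ∃ z : Γ((HKR.hochschildComplex f).cycles t, U),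
            ((HKR.hochschildComplex f).iCycles t).app U z = HKR.antisymmSection f t U a r ∧
            ε.hom.app U (HKR.formSection f t U a r) =
              ((HKR.hochschildComplex f).homologyπ t).app U z) ∧
        ε.hom ≫ HKR.homologyToOmega f t = t.factorial • 𝟙 (HKR.Omega f t)) ∧
    (∀ (X Y : Scheme.{u}) (f : X ⟶ Spec (.of k)) (g : Y ⟶ Spec (.of k))
      [Smooth f] [IsProper f] [Smooth g] [IsProper g] (h : X ⟶ Y) (w : h ≫ g = f),
      HKR.truncHHPullback f h w p ≫
          ((Scheme.Modules.pushforward h).mapHomologicalComplex (.up ℤ)).map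
            (HKR.truncHHToSumOmega f p) =
        HKR.truncHHToSumOmega g p ≫ HKR.sumOmegaPullback f h w p) := by
  refine ⟨fun X f _ _ => ⟨HKR.quasiIso_truncHHToSumOmega f hp hk, fun t => ⟨HKR.hkrIso f t,
    fun U a r => ⟨HKR.antisymmCycle f t U a r, HKR.iCycles_antisymmCycle f t U a r,
      HKR.hkrIso_formSection f t U a r⟩, HKR.hkrIso_homologyToOmega f t⟩⟩,
    fun X Y f g _ _ _ _ h w => HKR.truncHHPullback_truncHHToSumOmega f h w p⟩
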